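/- Let $K/\mathbb{Q}$ be a number field with algebraic closure $\bar K$, let $\mathfrak p$ be a nonzero prime of (the ring of integers of) $K$ of residue characteristic $p$, and let $E/K$ be an elliptic curve with good reduction at $\mathfrak p$. Let $\bar{\mathfrak p}$ be a prime of $\bar K$ lying over $\mathfrak p$, let $|\cdot|_{\bar{\mathfrak p}}$ be the associated absolute value on $\bar K$, normalized to extend the usual $p$-adic absolute value of $\mathbb{Q}$ (so $|p|_{\bar{\mathfrak p}}=1/p$), and put $\bar v=-\log|\cdot|_{\bar{\mathfrak p}}$. Let $\sigma\in\mathrm{Gal}(\bar K/K)$ be a Frobenius element at $\bar{\mathfrak p}$, i.e. $\sigma(\alpha)\equiv\alpha^{q}\pmod{\bar{\mathfrak p}}$ for every algebraic integer $\alpha\in\bar K$, where $q=\mathrm N_{K/\mathbb{Q}}\mathfrak p$. For a prime $\ell\ne p$ let $$\Phi_{\mathfrak p}(X)=\det\bigl(X-\sigma\bigm|T_\ell(E)\bigr)\in\mathbb{Z}[X]$$ be the characteristic polynomial of Frobenius at $\mathfrak p$; it acts on $E(\bar K)$ through $X\mapsto\sigma$. Let $\hat\lambda_{\bar{\mathfrak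 p}}:E(\bar K)\to\mathbb{R}\cup\{\infty\}$ be the local canonical height (Néron function) at $\bar{\mathfrak p}$ for the divisor $(O)$: $\hat\lambda_{\bar{\mathfrak p}}(O)=\infty$, and on $E(\bar K)\smallsetminus\{O\}$ it is the unique real-valued function that is $\bar{\mathfrak p}$-adically continuous, is bounded outside every $\bar{\mathfrak p}$-adic neighbourhood of $O$, is such that $\lim_{P\to O}\bigl(\hat\lambda_{\bar{\mathfrak p}}(P)+\tfrac12\bar v(x(P))\bigr)$ exists in $\mathbb{R}$, and satisfies $$\hat\lambda_{\bar{\mathfrak p}}(2P)=4\hat\lambda_{\bar{\mathfrak p}}(P)+\bar v\bigl((2y+a_1x+a_3)(P)\bigr)-\tfrac14\bar v(\Delta)\qquad\text{whenever }2P\neq O,$$ where $x,y,a_1,a_3,\Delta$ belong to a Weierstrass equation of $E/K$ (the function does not depend on the choice of equation). Let $P\in E(\bar K)$ be a nontorsion point, and let $e$ be the absolute ramification index of $\bar{\mathfrak p}$ in the field of definition $K(P)$ of $P$, i.e. the ramification index of $\bar{\mathfrak p}\cap K(P)$ over $p$. Then $$\hat\lambda_{\bar{\mathfrak p}}\bigl(\Phi_{\mathfrak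 p}(\sigma)P\bigr)\ \ge\ \frac{\log p}{e}.$$ -/

import Mathlib

open scoped NumberField Polynomial

/-! ### The Tate module and characteristic polynomials on it -/

section TateModule

variable (ℓ : ℕ) (A : Type*) [AddCommGroup A]

/-- The Tate module `T_ℓ(A) = lim A[ℓ^n]`: sequences `t` with `t 0 = 0` and `ℓ • t (n + 1) = t n`,
so that `t n` is killed by `ℓ ^ n`. -/
def TateModule : AddSubgroup (ℕ → A) where
  carrier := {t | t 0 = 0 ∧ ∀ n, ℓ • t (n + 1) = t n}
  zero_mem' := ⟨rfl, fun _ => smul_zero _⟩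
  add_mem' := by
    rintro s t ⟨hs, hs'⟩ ⟨ht, ht'⟩
    exact ⟨by simp [hs, ht], fun n => by simp [smul_add, hs', ht']⟩
  neg_mem' := by
    rintro t ⟨ht, ht'⟩
    exact ⟨by simp [ht], fun n => by simp [smul_neg, ht']⟩

variable {ℓ A}

lemma TateModule.pow_smul (t : TateModule ℓ A) (n : ℕ) : ℓ ^ n • t.1 n = 0 := by
  induction n with
  | zero => simpa using t.2.1
  | succ n ih => rw [pow_succ, mul_smul, t.2.2 n, ih]

lemma TateModule.smul_congr (t : TateModule ℓ A) {n a b : ℕ}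
    (h : (a : ZMod (ℓ ^ n)) = b) : a • t.1 n = b • t.1 n := by
  have key : ∀ c : ℕ, c • t.1 n = (c % ℓ ^ n) • t.1 n := fun c => by
    conv_lhs => rw [← Nat.div_add_mod c (ℓ ^ n), add_smul, mul_comm, mul_smul, TateModule.pow_smul t,
      smul_zero, zero_add]
  rw [key a, key b, (ZMod.natCast_eq_natCast_iff' _ _ _).1 h]

variable [Fact ℓ.Prime]

lemma TateModule.smul_congr_val (t : TateModule ℓ A) {n b : ℕ} {z : ZMod (ℓ ^ n)}
    (h : z = (b : ZMod (ℓ ^ n))) : z.val • t.1 n = b • t.1 n :=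
  TateModule.smul_congr t (by rw [ZMod.natCast_zmod_val, h])

/-- `ℤ_ℓ` acts on the `n`-th component through its quotient `ℤ / ℓ ^ n`. -/
noncomputable instance : SMul ℤ_[ℓ] (TateModule ℓ A) where
  smul c t := ⟨fun n => (PadicInt.toZModPow n c).val • t.1 n, by
    refine ⟨by simp [t.2.1], fun n => ?_⟩
    rw [smul_comm, t.2.2 n]
    refine (TateModule.smul_congr_val t ?_).symm
    rw [← PadicInt.cast_toZModPow n (n + 1) n.le_succ c, ZMod.natCast_val]⟩

lemma TateModule.smul_apply (c : ℤ_[ℓ]) (t : TateModule ℓ A) (n : ℕ) :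
    (c • t).1 n = (PadicInt.toZModPow n c).val • t.1 n := rfl

noncomputable instance : Module ℤ_[ℓ] (TateModule ℓ A) where
  one_smul t := by
    ext n
    rw [TateModule.smul_apply]
    simpa using TateModule.smul_congr_val t (b := 1) (by simp)
  mul_smul c d t := by
    ext n
    simp only [TateModule.smul_apply, ← mul_smul]
    exact TateModule.smul_congr_val t (by simp)
  smul_zero c := by ext n; simp [TateModule.smul_apply]
  smul_add c s t := by ext n; simp [TateModule.smul_apply]
  add_smul c d t := by
    ext n
    simp only [TateModule.smul_apply, AddSubgroup.coe_add, Pi.add_apply, ← add_smul]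
    exact TateModule.smul_congr_val t (by simp)
  zero_smul t := by ext n; simp [TateModule.smul_apply]

variable (ℓ)

/-- The `ℤ_ℓ`-linear endomorphism of `T_ℓ(A)` induced by an endomorphism of `A`. -/
noncomputable def TateModule.map (f : AddMonoid.End A) :
    TateModule ℓ A →ₗ[ℤ_[ℓ]] TateModule ℓ A where
  toFun t := ⟨fun n => f (t.1 n), by simp [t.2.1],
    fun n => by rw [← map_nsmul, t.2.2 n]⟩
  map_add' s t := by ext n; exact map_add f _ _
  map_smul' c t := by ext n; exact map_nsmul f _ _

/-- `det (X - f | T_ℓ(A))`, the determinant of the endomorphism `X - f` of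
`ℤ_ℓ[X] ⊗ T_ℓ(A)`. -/
noncomputable def TateModule.charpoly (f : AddMonoid.End A) : ℤ_[ℓ][X] :=
  LinearMap.det ((Polynomial.X : ℤ_[ℓ][X]) • LinearMap.id - (TateModule.map ℓ f).baseChange ℤ_[ℓ][X])

open Classical in
/-- `det (X - f | T_ℓ(A))` as a polynomial with integer coefficients (it is unique, and it exists
for Frobenius elements acting on elliptic curves with good reduction; otherwise `0`). -/
noncomputable def TateModule.intCharpoly (f : AddMonoid.End A) : ℤ[X] :=
  if h : ∃ Φ : ℤ[X], Φ.map (Int.castRingHom ℤ_[ℓ]) = TateModule.charpoly ℓ f then h.choose else 0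

end TateModule

/-! ### Places and primes -/

/-- `v` is a nonarchimedean absolute value on `F` extending the usual `p`-adic absolute value
of `ℚ` (so `v p = 1 / p`). -/
structure IsPlaceOver (p : ℕ) {F : Type*} [Field F] [CharZero F] (v : AbsoluteValue F ℝ) :
    Prop where
  nonarch : IsNonarchimedean v
  extends_padic : ∀ x : ℚ, v (x : F) = (padicNorm p x : ℝ)

/-- Algebraic integers have absolute value at most `1`. -/
lemma IsNonarchimedean.le_one_of_isIntegral {F : Type*} [Field F] {v : AbsoluteValue F ℝ}
    (hv : IsNonarchimedean v) {x : F} (hx : IsIntegral ℤ x) : v x ≤ 1 := by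
  let w : Valuation F NNReal :=
    { toFun := fun x => ⟨v x, v.nonneg x⟩
      map_zero' := Subtype.ext (map_zero v)
      map_one' := Subtype.ext (map_one v)
      map_mul' := fun a b => Subtype.ext (map_mul v a b)
      map_add_le_max' := fun a b => hv a b }
  have h : IsIntegral w.integer x := hx.tower_top
  exact (Valuation.integer.integers w).isIntegral_iff_v_le_one.1 h

/-- The prime ideal `{x | v x < 1}` of the ring of algebraic integers of `F` that belongs to a
nonarchimedean absolute value `v`. -/
def primeIdealOf {F : Type*} [Field F] (v : AbsoluteValue F ℝ) (hv : IsNonarchimedean v) :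
    Ideal (𝓞 F) where
  carrier := {x | v (x : F) < 1}
  zero_mem' := by simp
  add_mem' := fun {a b} ha hb => by
    simp only [Set.mem_ofPred_eq, map_add] at *
    exact (hv _ _).trans_lt (max_lt ha hb)
  smul_mem' := fun c x hx => by
    simp only [Set.mem_ofPred_eq, smul_eq_mul, map_mul] at *
    exact mul_lt_one_of_nonneg_of_lt_one_right (hv.le_one_of_isIntegral c.2) (v.nonneg _) hx

/-! ### Local heights -/

namespace WeierstrassCurve

section LocalHeight

variable {F : Type*} [Field F] [DecidableEq F]

/-- `h` (its value at `O` is irrelevant) is the Néron local height function for the divisor `(O)`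
on `E(F) \ {O}`, where `F` carries the absolute value `|·| = v` and `-log |·|` is the
corresponding additive valuation. The sets `{|x| > R}` are the punctured basic neighbourhoods
of `O`. -/
structure IsNeronFunction (v : AbsoluteValue F ℝ) (E : WeierstrassCurve F)
    (h : E.toAffine.Point → ℝ) : Prop where
  continuous : ∀ x y hxy, ∀ ε > 0, ∃ δ > 0, ∀ x' y' hxy', v (x' - x) < δ → v (y' - y) < δ →
    |h (.some x' y' hxy') - h (.some x y hxy)| < ε
  bounded : ∀ R : ℝ, ∃ B : ℝ, ∀ x y hxy, v x ≤ R → |h (.some x y hxy)| ≤ B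
  limit : ∃ c : ℝ, ∀ ε > 0, ∃ R : ℝ, ∀ x y hxy, R < v x →
    |h (.some x y hxy) + 1 / 2 * (-Real.log (v x)) - c| < ε
  duplication : ∀ x y hxy, 2 • (.some x y hxy : E.toAffine.Point) ≠ 0 →
    h (2 • .some x y hxy) = 4 * h (.some x y hxy)
      + (-Real.log (v (2 * y + E.a₁ * x + E.a₃))) - 1 / 4 * (-Real.log (v E.Δ))

open Classical in
/-- The local canonical height at `v`: the (unique) Néron function, with value `∞` at `O`. -/
noncomputable def localHeight (v : AbsoluteValue F ℝ) (E : WeierstrassCurve F)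
    (P : E.toAffine.Point) : WithTop ℝ :=
  if P = 0 then ⊤
  else if h : ∃ f, IsNeronFunction v E f then ((h.choose P : ℝ) : WithTop ℝ) else 0

end LocalHeight

/-! ### Elliptic curves over number fields -/

section NumberField

variable {K : Type*} [Field K]

/-- `E` is isomorphic over `K` to a curve given by a minimal Weierstrass equation at `𝔭` that has
good reduction. -/
def HasGoodReductionAt [NumberField K] (E : WeierstrassCurve K)
    (𝔭 : IsDedekindDomain.HeightOneSpectrum (𝓞 K)) : Prop :=
  ∃ C : VariableChange K, (C • E).HasGoodReduction (𝔭.valuation K).integer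

variable {L : Type*} [Field L] [Algebra K L]

/-- The action of `σ ∈ Gal(L/K)` on `E(L)`. -/
noncomputable def galoisEnd [DecidableEq L] (E : WeierstrassCurve K) (σ : L ≃ₐ[K] L) :
    AddMonoid.End (E.baseChange L).toAffine.Point :=
  Affine.Point.map (W' := E) (σ : L →ₐ[K] L)

/-- `σ ∈ Gal(L/K)` is a Frobenius element at the prime `𝔓` of `L`: for `q` the norm of `𝔓 ∩ K`,
`σ x ≡ x ^ q` modulo `𝔓` for every algebraic integer `x` of `L`. -/
def IsFrobeniusAt (σ : L ≃ₐ[K] L) (𝔓 : Ideal (𝓞 L)) : Prop :=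
  (NumberField.RingOfIntegers.mapAlgHom (k := K) (σ : L →ₐ[K] L)).IsArithFrobAt 𝔓

/-- The field of definition `K(P)` of a point `P ∈ E(L)`. -/
def fieldOfDefinition {E : WeierstrassCurve K} :
    (E.baseChange L).toAffine.Point → IntermediateField K L
  | .zero => ⊥
  | .some x y _ => IntermediateField.adjoin K {x, y}

end NumberField

end WeierstrassCurve

/-! Write q = N𝔭 = p ^ n, |·| for the absolute value and c = p^(-1/e). On a smooth integral model
with coordinates X, Y, the Néron function is ½ log max(1, |X|) (`isNeronFunction_goodHeight`). So
the claim is that Φ(σ)P, when it is not O, has parameter z = X/Y with |z| ≤ c: it lies in the kernel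
of reduction to the depth of a uniformizer of K(P). The difficulty is that Φ(σ)P involves the
conjugates of P, and the field they generate may be more ramified than K(P), so ordinary reduction
gives a weaker bound.

The device is the ring B = {x : |x| ≤ 1, |σx - x^q| ≤ c} (`congruenceSubalgebra`). It is a σ-stable
local ring. It contains the valuation ring of K(P) (`IsFrobeniusLift.sub_le`). A nonunit of B
satisfies |x| ≤ c, because |x| = |σx| exceeds |x^q| when 0 < |x| < 1, which forces |x| = |σx - x^q|
(`le_of_sub_le`). Hence a point that reduces to O through coordinates in B automatically has |z| ≤
c. The relation `ReducesTo` is therefore set up for arbitrary local rings; it respects addition and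
σ (`ReducesTo.add`, `ReducesTo.aeval`), so Φ(σ)P reduces through B to Φ(Frob) of the reduction of P.

It remains that Φ(Frob) is zero on the reduced curve. By Cayley–Hamilton Φ(σ) kills the entries of
every sequence in T_ℓ. Prime-to-p torsion reduces injectively, so Φ(Frob) kills infinitely many
points. Applied to the generic point and specialized, this forces Φ(Frob) = 0
(`aeval_pointEnd_eq_zero_of_infinite`). Only finite generation of T_ℓ and the existence of one
nonzero element are used, not its rank. The existence and divisibility of torsion come from the
degree n² of multiplication by n on x-coordinates, a consequence of the parallelogram law for x.

Finally, `localHeight` is defined by a choice, and boundedness with duplication identifies it at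
points none of whose multiples by powers of 2 vanish. So Φ(σ)P is shown to be nontorsion: some σ^N
fixes P, and Φ is coprime to X^N - 1, because a common root would give a nonzero σ^N-fixed vector of
T_ℓ and hence infinitely many points over a finite field. -/

namespace WeierstrassCurve

/-! ### Projective coordinates and addition formulas over a field. -/

section FieldFormulas

set_option linter.unusedSectionVars false

open scoped WeierstrassCurve.Projective

variable {F : Type*} [Field F] [DecidableEq F] {W : WeierstrassCurve F}

/-- `p` is a vector of projective coordinates of the point `P`. -/
def IsProjRep (P : W.toAffine.Point) (p : Fin 3 → F) : Prop :=
  (P = 0 ∧ p 0 = 0 ∧ p 2 = 0 ∧ p 1 ≠ 0) ∨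
    ∃ x y h, P = .some x y h ∧ p 2 ≠ 0 ∧ p 0 = x * p 2 ∧ p 1 = y * p 2

lemma isProjRep_iff {P : W.toAffine.Point} {p : Fin 3 → F} :
    IsProjRep P p ↔ W.toProjective.Nonsingular p ∧ Projective.Point.toAffine W p = P := by
  constructor
  · rintro (⟨rfl, h0, h2, h1⟩ | ⟨x, y, h, rfl, h2, h0, h1⟩)
    · refine ⟨?_, Projective.Point.toAffine_of_Z_eq_zero h2⟩
      rw [Projective.nonsingular_of_Z_eq_zero h2]
      refine ⟨?_, ?_⟩
      · rw [Projective.equation_of_Z_eq_zero h2, h0]; simp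
      · simp [h0, h1]
    · have hx : p 0 / p 2 = x := by rw [h0]; field_simp
      have hy : p 1 / p 2 = y := by rw [h1]; field_simp
      have hn : W.toProjective.Nonsingular p := by
        rw [Projective.nonsingular_of_Z_ne_zero h2, hx, hy]; exact h
      refine ⟨hn, ?_⟩
      rw [Projective.Point.toAffine_of_Z_ne_zero hn h2]
      simp [hx, hy]
  · rintro ⟨hn, rfl⟩
    by_cases h2 : p 2 = 0
    · have h0 : p 0 = 0 := Projective.X_eq_zero_of_Z_eq_zero hn.1 h2
      refine .inl ⟨Projective.Point.toAffine_of_Z_eq_zero h2, h0, h2, ?_⟩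
      exact Projective.Y_ne_zero_of_Z_eq_zero hn h2
    · refine .inr ⟨_, _, _, Projective.Point.toAffine_of_Z_ne_zero hn h2, h2, ?_, ?_⟩ <;> field_simp

lemma IsProjRep.smul {P : W.toAffine.Point} {p : Fin 3 → F} (h : IsProjRep P p) {u : F}
    (hu : u ≠ 0) : IsProjRep P (u • p) := by
  rcases h with ⟨rfl, h0, h2, h1⟩ | ⟨x, y, h, rfl, h2, h0, h1⟩
  · exact .inl ⟨rfl, by simp [h0], by simp [h2], by simp [hu, h1]⟩
  · exact .inr ⟨x, y, h, rfl, by simp [hu, h2], by simp [h0]; ring, by simp [h1]; ring⟩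

lemma IsProjRep.of_smul {P : W.toAffine.Point} {p : Fin 3 → F} {u : F} (h : IsProjRep P (u • p))
    (hu : u ≠ 0) : IsProjRep P p := by
  have := h.smul (inv_ne_zero hu)
  rwa [smul_smul, inv_mul_cancel₀ hu, one_smul] at this

lemma IsProjRep.unique {P : W.toAffine.Point} {p q : Fin 3 → F} (hp : IsProjRep P p)
    (hq : IsProjRep P q) : p ≈ q := by
  rcases hp with ⟨rfl, h0, h2, h1⟩ | ⟨x, y, h, rfl, h2, h0, h1⟩
  · rcases hq with ⟨-, k0, k2, k1⟩ | ⟨x, y, h, h', -⟩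
    · refine ⟨Units.mk0 (p 1 / q 1) (div_ne_zero h1 k1), ?_⟩
      ext i; fin_cases i <;> simp [Units.smul_def, h0, h2, k0, k2, k1]
    · cases h'
  · rcases hq with ⟨h', -⟩ | ⟨x', y', h', e, k2, k0, k1⟩
    · cases h'
    · cases e
      exact Projective.equiv_of_X_eq_of_Y_eq h2 k2 (by rw [h0, k0]; ring) (by rw [h1, k1]; ring)

lemma IsProjRep.add_of_not_equiv {P Q : W.toAffine.Point} {p q : Fin 3 → F} (hp : IsProjRep P p)
    (hq : IsProjRep Q q) (h : ¬ p ≈ q) : IsProjRep (P + Q) (W.toProjective.addXYZ p q) := by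
  rw [isProjRep_iff] at hp hq ⊢
  rw [← Projective.add_of_not_equiv h]
  exact ⟨Projective.nonsingular_add hp.1 hq.1,
    by rw [Projective.Point.toAffine_add hp.1 hq.1, hp.2, hq.2]⟩

lemma IsProjRep.neg {P : W.toAffine.Point} {p : Fin 3 → F} (hp : IsProjRep P p) :
    IsProjRep (-P) ![p 0, -p 1 - W.a₁ * p 0 - W.a₃ * p 2, p 2] := by
  rcases hp with ⟨rfl, h0, h2, h1⟩ | ⟨x, y, h, rfl, h2, h0, h1⟩
  · exact .inl ⟨by simp, by simp [h0], by simp [h2], by simp [h0, h2, h1]⟩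
  · refine .inr ⟨x, _, _, Affine.Point.neg_some h, by simpa using h2, by simpa using h0, ?_⟩
    simp [h0, h1, Affine.negY]; ring


/-- The difference of the two Weierstrass equations factors as (y₁ - y₂) D = (x₁ - x₂) N, with D and
N the two brackets here. The quotient N/D is the slope of the chord and of the tangent alike, so it
survives when two distinct points have the same reduction. -/
lemma slope_mul_eq {x₁ y₁ x₂ y₂ : F} (h₁ : W.toAffine.Equation x₁ y₁)
    (h₂ : W.toAffine.Equation x₂ y₂) (h : ¬ (x₁ = x₂ ∧ y₁ = W.toAffine.negY x₂ y₂)) :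
    W.toAffine.slope x₁ x₂ y₁ y₂ * (y₁ + y₂ + W.a₁ * x₁ + W.a₃) =
      x₁ ^ 2 + x₁ * x₂ + x₂ ^ 2 + W.a₂ * (x₁ + x₂) + W.a₄ - W.a₁ * y₂ := by
  have e₁ := (Affine.equation_iff _ _).1 h₁
  have e₂ := (Affine.equation_iff _ _).1 h₂
  by_cases hx : x₁ = x₂
  · subst hx
    have hy : y₁ ≠ W.toAffine.negY x₁ y₂ := fun hy => h ⟨rfl, hy⟩
    have hyy : y₁ = y₂ := by
      have := Affine.Y_eq_of_Y_ne h₁ h₂ rfl hy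
      exact this
    subst hyy
    rw [Affine.slope_of_Y_ne rfl hy]
    have : y₁ - W.toAffine.negY x₁ y₁ ≠ 0 := sub_ne_zero.2 hy
    rw [div_mul_eq_mul_div, div_eq_iff this, Affine.negY]
    ring
  · rw [Affine.slope_of_X_ne hx, div_mul_eq_mul_div, div_eq_iff (sub_ne_zero.2 hx)]
    linear_combination e₁ - e₂

lemma isProjRep_add_of_den {x₁ y₁ x₂ y₂ l : F} (h₁ : W.toAffine.Nonsingular x₁ y₁)
    (h₂ : W.toAffine.Nonsingular x₂ y₂) (hD : y₁ + y₂ + W.a₁ * x₁ + W.a₃ ≠ 0)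
    (hl : l * (y₁ + y₂ + W.a₁ * x₁ + W.a₃) =
      x₁ ^ 2 + x₁ * x₂ + x₂ ^ 2 + W.a₂ * (x₁ + x₂) + W.a₄ - W.a₁ * y₂) :
    IsProjRep (.some x₁ y₁ h₁ + .some x₂ y₂ h₂ : W.toAffine.Point)
      ![l ^ 2 + W.a₁ * l - W.a₂ - x₁ - x₂,
        -(l * (l ^ 2 + W.a₁ * l - W.a₂ - x₁ - x₂ - x₁) + y₁)
          - W.a₁ * (l ^ 2 + W.a₁ * l - W.a₂ - x₁ - x₂) - W.a₃, 1] := by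
  have h : ¬ (x₁ = x₂ ∧ y₁ = W.toAffine.negY x₂ y₂) := by
    rintro ⟨rfl, hy⟩
    rw [Affine.negY] at hy
    exact hD (by rw [hy]; ring)
  have hs : W.toAffine.slope x₁ x₂ y₁ y₂ = l :=
    mul_right_cancel₀ hD ((slope_mul_eq h₁.1 h₂.1 h).trans hl.symm)
  rw [Affine.Point.add_some h]
  refine .inr ⟨_, _, _, rfl, by simp, ?_, ?_⟩
  · simp [Affine.addX, hs]
  · simp only [Affine.addY, Affine.negY, Affine.negAddY, Affine.addX, hs, Matrix.cons_val]
    ring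

/-- Here m is the inverse slope and the coordinates are those of the previous formula multiplied by
m³. They stay meaningful at m = 0, where the line is vertical and the sum is O. -/
lemma isProjRep_add_of_num {x₁ y₁ x₂ y₂ m : F} (h₁ : W.toAffine.Nonsingular x₁ y₁)
    (h₂ : W.toAffine.Nonsingular x₂ y₂)
    (hN : x₁ ^ 2 + x₁ * x₂ + x₂ ^ 2 + W.a₂ * (x₁ + x₂) + W.a₄ - W.a₁ * y₂ ≠ 0)
    (hm : m * (x₁ ^ 2 + x₁ * x₂ + x₂ ^ 2 + W.a₂ * (x₁ + x₂) + W.a₄ - W.a₁ * y₂) =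
      y₁ + y₂ + W.a₁ * x₁ + W.a₃) :
    IsProjRep (.some x₁ y₁ h₁ + .some x₂ y₂ h₂ : W.toAffine.Point)
      ![m + W.a₁ * m ^ 2 - (W.a₂ + x₁ + x₂) * m ^ 3,
        -(1 + W.a₁ * m - (W.a₂ + x₁ + x₂) * m ^ 2 - x₁ * m ^ 2 + y₁ * m ^ 3)
          - W.a₁ * (m + W.a₁ * m ^ 2 - (W.a₂ + x₁ + x₂) * m ^ 3) - W.a₃ * m ^ 3, m ^ 3] := by
  by_cases hD : y₁ + y₂ + W.a₁ * x₁ + W.a₃ = 0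
  · have e₁ := (Affine.equation_iff _ _).1 h₁.1
    have e₂ := (Affine.equation_iff _ _).1 h₂.1
    have hm0 : m = 0 := by
      rw [hD] at hm
      exact (mul_eq_zero.1 hm).resolve_right hN
    have hx : x₁ = x₂ := by
      refine sub_eq_zero.1 ((mul_eq_zero.1 (?_ : (x₁ - x₂) * _ = 0)).resolve_right hN)
      linear_combination (y₁ - y₂) * hD - e₁ + e₂
    refine .inl ⟨Affine.Point.add_of_Y_eq hx ?_, ?_⟩
    · rw [Affine.negY, ← hx]; linear_combination hD
    · simp [hm0]
  · have hm0 : m ≠ 0 := by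
      rintro rfl
      exact hD (by rw [← hm, zero_mul])
    have key := isProjRep_add_of_den (l := m⁻¹) h₁ h₂ hD (by rw [← hm]; field_simp)
    convert key.smul (pow_ne_zero 3 hm0) using 1
    ext i
    fin_cases i
    · simp; field_simp; ring
    · simp; field_simp; ring
    · simp

lemma IsProjRep.equation_of_Y_eq_one {P : W.toAffine.Point} {z w : F}
    (h : IsProjRep P ![z, 1, w]) :
    w + W.a₁ * z * w + W.a₃ * w ^ 2 =
      z ^ 3 + W.a₂ * z ^ 2 * w + W.a₄ * z * w ^ 2 + W.a₆ * w ^ 3 := by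
  have := (Projective.equation_iff _).1 (isProjRep_iff.1 h).1.1
  simp at this
  linear_combination this

lemma IsProjRep.exists_of_Y_eq_one {P : W.toAffine.Point} {z w : F}
    (h : IsProjRep P ![z, 1, w]) (hP : P ≠ 0) :
    w ≠ 0 ∧ ∃ hn : W.toAffine.Nonsingular (z / w) (1 / w), P = .some _ _ hn := by
  rcases h with ⟨rfl, -⟩ | ⟨x, y, hn, rfl, h2, h0, h1⟩
  · exact absurd rfl hP
  · simp at h0 h1 h2
    have hx : x = z / w := by rw [h0]; field_simp
    have hy : y = 1 / w := by rw [h1]; field_simp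
    subst hx hy
    exact ⟨h2, hn, rfl⟩

/-- The sum of two points in the chart `Y = 1`, through the line `Z = l X + n Y`. -/
lemma isProjRep_add_of_line {P Q : W.toAffine.Point} {z₁ w₁ z₂ w₂ l n A T : F}
    (hP : IsProjRep P ![z₁, 1, w₁]) (hQ : IsProjRep Q ![z₂, 1, w₂])
    (hP0 : P ≠ 0) (hQ0 : Q ≠ 0) (hPQ : P + Q ≠ 0)
    (hU : 1 + W.a₁ * z₁ + W.a₃ * (w₁ + w₂) - W.a₂ * z₁ ^ 2 - W.a₄ * z₁ * (w₁ + w₂)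
      - W.a₆ * (w₁ ^ 2 + w₁ * w₂ + w₂ ^ 2) ≠ 0)
    (hl : l * (1 + W.a₁ * z₁ + W.a₃ * (w₁ + w₂) - W.a₂ * z₁ ^ 2 - W.a₄ * z₁ * (w₁ + w₂)
      - W.a₆ * (w₁ ^ 2 + w₁ * w₂ + w₂ ^ 2)) =
      z₁ ^ 2 + z₁ * z₂ + z₂ ^ 2 + W.a₂ * w₂ * (z₁ + z₂) + W.a₄ * w₂ ^ 2 - W.a₁ * w₂)
    (hn : n = w₁ - l * z₁)
    (hA : A = 1 + W.a₂ * l + W.a₄ * l ^ 2 + W.a₆ * l ^ 3)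
    (hT : T = -(W.a₂ * n + 2 * W.a₄ * l * n + 3 * W.a₆ * l ^ 2 * n - W.a₁ * l - W.a₃ * l ^ 2)
      - A * (z₁ + z₂)) :
    IsProjRep (P + Q) ![T, -A - W.a₁ * T - W.a₃ * (l * T + n * A), l * T + n * A] := by
  have e₁ := hP.equation_of_Y_eq_one
  have e₂ := hQ.equation_of_Y_eq_one
  obtain ⟨hw₁, hn₁, rfl⟩ := hP.exists_of_Y_eq_one hP0
  obtain ⟨hw₂, hn₂, rfl⟩ := hQ.exists_of_Y_eq_one hQ0
  -- Both points lie on the line: the difference of the equations is (w₁ - w₂ - l (z₁ - z₂)) times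
  -- the nonzero denominator of l.
  have hw : w₂ = l * z₂ + n := by
    have : (w₁ - w₂ - l * (z₁ - z₂)) * (1 + W.a₁ * z₁ + W.a₃ * (w₁ + w₂) - W.a₂ * z₁ ^ 2
        - W.a₄ * z₁ * (w₁ + w₂) - W.a₆ * (w₁ ^ 2 + w₁ * w₂ + w₂ ^ 2)) = 0 := by
      linear_combination e₁ - e₂ - (z₁ - z₂) * hl
    have := (mul_eq_zero.1 this).resolve_right hU
    rw [hn]; linear_combination -this
  have hw' : w₁ = l * z₁ + n := by rw [hn]; ring
  -- Vieta for the cubic in z cut out by the line: A is its leading coefficient and T is A times the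
  -- third root. The third intersection point is [T : A : lT + nA], and its negative is the sum.
  have hC : -(l + W.a₁ * n + 2 * W.a₃ * l * n - W.a₄ * n ^ 2 - 3 * W.a₆ * l * n ^ 2) =
      A * (z₁ * z₂) + T * (z₁ + z₂) := by
    rw [hT, hA]
    rw [hw, hw'] at hl
    linear_combination -hl
  have hD : n + W.a₃ * n ^ 2 - W.a₆ * n ^ 3 = z₁ * z₂ * T := by
    rw [hw'] at e₁
    have hT' := hT
    rw [hA] at hC hT hT'
    linear_combination e₁ + z₁ * hC + z₁ ^ 2 * hT
  have hE2 : n ^ 3 = w₁ * w₂ * (l * T + n * A) := by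
    rw [hw, hw']
    have := hA
    linear_combination l ^ 3 * hD + l ^ 2 * n * hC - l * n ^ 2 * hT - n ^ 3 * hA
  have hE1 : n * (l ^ 2 - W.a₁ * l * n - W.a₂ * n ^ 2) =
      T * (w₁ * w₂) + (l * T + n * A) * (2 * l * (z₁ * z₂) + n * (z₁ + z₂)) := by
    rw [hw, hw']
    linear_combination 3 * l ^ 2 * hD + 2 * l * n * hC - n ^ 2 * hT
  have hxy : ¬ (z₁ / w₁ = z₂ / w₂ ∧ 1 / w₁ = W.toAffine.negY (z₂ / w₂) (1 / w₂)) := fun h =>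
    hPQ (Affine.Point.add_of_Y_eq h.1 h.2)
  have hslope : n ≠ 0 ∧ W.toAffine.slope (z₁ / w₁) (z₂ / w₂) (1 / w₁) (1 / w₂) = -l / n := by
    by_cases hx : z₁ / w₁ = z₂ / w₂
    · have hy : 1 / w₁ ≠ W.toAffine.negY (z₂ / w₂) (1 / w₂) := fun hy => hxy ⟨hx, hy⟩
      have hyy := Affine.Y_eq_of_Y_ne hn₁.1 hn₂.1 hx hy
      have hww : w₁ = w₂ := by field_simp at hyy; exact hyy.symm
      have hzz : z₁ = z₂ := by rw [hww] at hx; field_simp at hx; exact hx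
      subst hww hzz
      rw [Affine.negY] at hy
      have hD' : 2 + W.a₁ * z₁ + W.a₃ * w₁ ≠ 0 := by
        intro h0
        apply hy
        field_simp
        linear_combination h0
      have hnU : n * (1 + W.a₁ * z₁ + W.a₃ * (w₁ + w₁) - W.a₂ * z₁ ^ 2 - W.a₄ * z₁ * (w₁ + w₁)
          - W.a₆ * (w₁ ^ 2 + w₁ * w₁ + w₁ ^ 2)) = -(w₁ * (2 + W.a₁ * z₁ + W.a₃ * w₁)) := by
        rw [hn]
        linear_combination 3 * e₁ - z₁ * hl
      have hn0 : n ≠ 0 := by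
        rintro rfl
        rw [zero_mul, eq_comm, neg_eq_zero] at hnU
        exact (mul_ne_zero hw₁ hD') hnU
      refine ⟨hn0, ?_⟩
      rw [Affine.slope_of_Y_ne rfl (by rwa [Affine.negY]), Affine.negY]
      have : 1 / w₁ - (-(1 / w₁) - W.a₁ * (z₁ / w₁) - W.a₃) =
        (2 + W.a₁ * z₁ + W.a₃ * w₁) / w₁ := by field_simp; ring
      rw [this, div_eq_div_iff (div_ne_zero hD' hw₁) hn0]
      field_simp
      apply mul_right_cancel₀ hU
      linear_combination (3 * z₁ ^ 2 + 2 * z₁ * w₁ * W.a₂ + W.a₄ * w₁ ^ 2 - W.a₁ * w₁) * hnU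
        + w₁ * (2 + W.a₁ * z₁ + W.a₃ * w₁) * hl
    · have hd : z₁ * w₂ - z₂ * w₁ = (z₁ - z₂) * n := by rw [hw, hw']; ring
      have hx' : z₁ * w₂ - z₂ * w₁ ≠ 0 := by
        intro h0; apply hx; field_simp; linear_combination h0
      have hn0 : n ≠ 0 := by
        rintro rfl; rw [hd, mul_zero] at hx'; exact hx' rfl
      refine ⟨hn0, ?_⟩
      rw [Affine.slope_of_X_ne hx, div_eq_div_iff (sub_ne_zero.2 hx) hn0]
      field_simp
      rw [hw, hw']; ring
  obtain ⟨hn0, hs⟩ := hslope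
  have hZ : l * T + n * A ≠ 0 := by
    intro h0
    rw [h0, mul_zero] at hE2
    exact hn0 (pow_eq_zero_iff three_ne_zero |>.1 hE2)
  rw [Affine.Point.add_some hxy]
  have hX : W.toAffine.addX (z₁ / w₁) (z₂ / w₂) (-l / n) = T / (l * T + n * A) := by
    have h1 : (l ^ 2 - W.a₁ * l * n - W.a₂ * n ^ 2) / n ^ 2 =
        T * (w₁ * w₂) / n ^ 3 + (2 * l * (z₁ * z₂) + n * (z₁ + z₂)) / (w₁ * w₂) := by
      have h0 : (l ^ 2 - W.a₁ * l * n - W.a₂ * n ^ 2) / n ^ 2 =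
          n * (l ^ 2 - W.a₁ * l * n - W.a₂ * n ^ 2) / n ^ 3 := by field_simp
      rw [h0, hE1, add_div]
      congr 1
      rw [hE2]
      field_simp
    have h2 : T / (l * T + n * A) = T * (w₁ * w₂) / n ^ 3 := by
      rw [hE2]; field_simp
    have h3 : (2 * l * (z₁ * z₂) + n * (z₁ + z₂)) / (w₁ * w₂) = z₁ / w₁ + z₂ / w₂ := by
      rw [div_add_div _ _ hw₁ hw₂]
      congr 1
      rw [hw, hw']; ring
    rw [h2, Affine.addX]
    rw [h3] at h1
    have h4 : (-l / n) ^ 2 + W.a₁ * (-l / n) - W.a₂ = (l ^ 2 - W.a₁ * l * n - W.a₂ * n ^ 2) / n ^ 2 := by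
      field_simp; ring
    linear_combination h1 + h4
  refine .inr ⟨_, _, _, rfl, by simpa using hZ, ?_, ?_⟩
  · rw [hs, hX]; simp [hZ]
  · rw [hs, Affine.addY, Affine.negY, Affine.negAddY, hX]
    simp
    have : 1 = l * (z₁ / w₁) + n * w₁⁻¹ := by rw [hw'] at hw₁ ⊢; field_simp
    field_simp at this ⊢
    linear_combination -(n * A + T * l) * this

end FieldFormulas

end WeierstrassCurve

namespace WeierstrassCurve

/-! ### Specialization of points through a local ring. -/

section Reduction

variable {R B F k : Type*} [CommRing R] [CommRing B] [IsLocalRing B] [Field F] [Field k]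
  [Algebra R B] [Algebra R F] [Algebra R k] [DecidableEq F] [DecidableEq k]

/-- Some projective coordinates of `P` over the ring `B` specialize to coordinates of `Q`. -/
def ReducesTo (W : WeierstrassCurve R) (f : B →ₐ[R] F) (g : B →ₐ[R] k)
    (P : (W.baseChange F).toAffine.Point) (Q : (W.baseChange k).toAffine.Point) : Prop :=
  ∃ p : Fin 3 → B, IsProjRep P (f ∘ p) ∧ IsProjRep Q (g ∘ p)

variable {W : WeierstrassCurve R} {f : B →ₐ[R] F} {g : B →ₐ[R] k}

set_option linter.unusedSectionVars false

lemma ReducesTo.zero : ReducesTo W f g 0 0 :=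
  ⟨![0, 1, 0], .inl (by simp), .inl (by simp)⟩

lemma ReducesTo.neg {P : (W.baseChange F).toAffine.Point} {Q : (W.baseChange k).toAffine.Point}
    (h : ReducesTo W f g P Q) : ReducesTo W f g (-P) (-Q) := by
  obtain ⟨p, hP, hQ⟩ := h
  refine ⟨![p 0, -p 1 - algebraMap R B W.a₁ * p 0 - algebraMap R B W.a₃ * p 2, p 2], ?_, ?_⟩
  · convert hP.neg using 1
    ext i; fin_cases i <;> simp
  · convert hQ.neg using 1
    ext i; fin_cases i <;> simp

variable [hg : IsLocalHom g]

lemma isUnit_of_map_ne_zero {b : B} (h : g b ≠ 0) : IsUnit b :=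
  IsUnit.of_map g b (isUnit_iff_ne_zero.2 h)

/-- A coordinate of Q that is nonzero in `k` comes from a unit of `B`, as `g` is local. Dividing by
it gives the chart Y = 1 when Q = O, and the affine chart otherwise. -/
lemma ReducesTo.cases {P : (W.baseChange F).toAffine.Point} {Q : (W.baseChange k).toAffine.Point}
    (h : ReducesTo W f g P Q) :
    (Q = 0 ∧ ∃ z w : B, g z = 0 ∧ g w = 0 ∧ IsProjRep P ![f z, 1, f w]) ∨
      ∃ x y h h', P = .some (f x) (f y) h ∧ Q = .some (g x) (g y) h' := by
  obtain ⟨p, hP, hQ⟩ := h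
  rcases hQ with ⟨rfl, h0, h2, h1⟩ | ⟨x, y, h', rfl, h2, h0, h1⟩
  · obtain ⟨u, hu⟩ := isUnit_of_map_ne_zero (g := g) h1
    refine .inl ⟨rfl, ↑u⁻¹ * p 0, ↑u⁻¹ * p 2, ?_, ?_, ?_⟩
    · rw [map_mul]; simp only [Function.comp_apply] at h0; rw [h0, mul_zero]
    · rw [map_mul]; simp only [Function.comp_apply] at h2; rw [h2, mul_zero]
    · have : IsUnit (f (↑u⁻¹ : B)) := u⁻¹.isUnit.map f
      convert hP.smul this.ne_zero using 1
      ext i; fin_cases i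
      · simp
      · have := (u.isUnit.map f).ne_zero
        simp [← hu, this]
      · simp
  · obtain ⟨u, hu⟩ := isUnit_of_map_ne_zero (g := g) h2
    have hfu : f (↑u⁻¹ : B) ≠ 0 := (u⁻¹.isUnit.map f).ne_zero
    have hgu : g (↑u⁻¹ : B) ≠ 0 := (u⁻¹.isUnit.map g).ne_zero
    have hf2 : f (↑u⁻¹ : B) * f (p 2) = 1 := by rw [← map_mul, ← hu]; simp
    have hg2 : g (↑u⁻¹ : B) * g (p 2) = 1 := by rw [← map_mul, ← hu]; simp
    simp only [Function.comp_apply] at h0 h1 h2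
    have hx : x = g (↑u⁻¹ * p 0) := by
      rw [map_mul, h0]; linear_combination -x * hg2
    have hy : y = g (↑u⁻¹ * p 1) := by
      rw [map_mul, h1]; linear_combination -y * hg2
    subst hx hy
    rcases hP with ⟨rfl, k0, k2, k1⟩ | ⟨x', y', h'', rfl, k2, k0, k1⟩
    · simp only [Function.comp_apply] at k2
      rw [k2, mul_zero] at hf2
      exact absurd hf2 zero_ne_one
    · simp only [Function.comp_apply] at k0 k1 k2
      have hx : x' = f (↑u⁻¹ * p 0) := by
        rw [map_mul, k0]; linear_combination -x' * hf2
      have hy : y' = f (↑u⁻¹ * p 1) := by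
        rw [map_mul, k1]; linear_combination -y' * hf2
      subst hx hy
      exact .inr ⟨_, _, h'', h', rfl, rfl⟩

lemma ReducesTo.some {x y : B} (h : (W.baseChange F).toAffine.Nonsingular (f x) (f y))
    (h' : (W.baseChange k).toAffine.Nonsingular (g x) (g y)) :
    ReducesTo W f g (.some _ _ h) (.some _ _ h') :=
  ⟨![x, y, 1], .inr ⟨_, _, h, rfl, by simp⟩, .inr ⟨_, _, h', rfl, by simp⟩⟩

lemma ReducesTo.of_kernel {P : (W.baseChange F).toAffine.Point} {z w : B} (hz : g z = 0)
    (hw : g w = 0) (h : IsProjRep P ![f z, 1, f w]) : ReducesTo W f g P 0 := by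
  refine ⟨![z, 1, w], ?_, .inl ⟨rfl, by simpa using hz, by simpa using hw, by simp⟩⟩
  convert h using 1
  ext i; fin_cases i <;> simp

/-- In the chart Y = 1 the equation reads w · (1 + terms killed by `g`) = z³, and the bracket is a
unit. -/
lemma exists_eq_cube_mul (hf : Function.Injective f) {P : (W.baseChange F).toAffine.Point} {z w : B}
    (hz : g z = 0) (hw : g w = 0) (h : IsProjRep P ![f z, 1, f w]) :
    ∃ c : B, IsUnit c ∧ w = z ^ 3 * c := by
  have e := h.equation_of_Y_eq_one
  set a : R →+* B := algebraMap R B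
  have e' : w * (1 + a W.a₁ * z + a W.a₃ * w - a W.a₂ * z ^ 2 - a W.a₄ * z * w - a W.a₆ * w ^ 2) =
      z ^ 3 := by
    apply hf
    simp only [map_mul, map_sub, map_add, map_pow, map_one, a, AlgHom.commutes]
    simp only [baseChange, map_a₁, map_a₂, map_a₃, map_a₄, map_a₆] at e
    linear_combination e
  obtain ⟨u, hu⟩ : IsUnit
      (1 + a W.a₁ * z + a W.a₃ * w - a W.a₂ * z ^ 2 - a W.a₄ * z * w - a W.a₆ * w ^ 2) :=
    isUnit_of_map_ne_zero (g := g) (by simp [hz, hw])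
  refine ⟨↑u⁻¹, u⁻¹.isUnit, ?_⟩
  rw [← e', ← hu, mul_assoc, Units.mul_inv, mul_one]

/-- Addition in the kernel of reduction, modulo the square of an ideal. -/
lemma exists_kernel_add (hf : Function.Injective f) {P Q : (W.baseChange F).toAffine.Point}
    {z₁ w₁ z₂ w₂ : B} (hz₁ : g z₁ = 0) (hw₁ : g w₁ = 0) (hz₂ : g z₂ = 0) (hw₂ : g w₂ = 0)
    (hP : IsProjRep P ![f z₁, 1, f w₁]) (hQ : IsProjRep Q ![f z₂, 1, f w₂]) (I : Ideal B)
    (hI₁ : z₁ ∈ I) (hI₂ : z₂ ∈ I) :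
    ∃ z w : B, g z = 0 ∧ g w = 0 ∧ IsProjRep (P + Q) ![f z, 1, f w] ∧ z - z₁ - z₂ ∈ I ^ 2 := by
  by_cases hP0 : P = 0
  · subst hP0
    have : f z₁ = 0 := by
      rcases hP with ⟨-, h, -⟩ | ⟨x, y, h, e, -⟩
      · simpa using h
      · cases e
    have : z₁ = 0 := hf (by rw [this, map_zero])
    exact ⟨z₂, w₂, hz₂, hw₂, by rwa [zero_add], by simp [this]⟩
  by_cases hQ0 : Q = 0
  · subst hQ0
    have : f z₂ = 0 := by
      rcases hQ with ⟨-, h, -⟩ | ⟨x, y, h, e, -⟩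
      · simpa using h
      · cases e
    have : z₂ = 0 := hf (by rw [this, map_zero])
    exact ⟨z₁, w₁, hz₁, hw₁, by rwa [add_zero], by simp [this]⟩
  set a : R →+* B := algebraMap R B with ha
  obtain ⟨c₁, -, hc₁⟩ := exists_eq_cube_mul hf hz₁ hw₁ hP
  obtain ⟨c₂, -, hc₂⟩ := exists_eq_cube_mul hf hz₂ hw₂ hQ
  have sq : ∀ {s t : B}, s ∈ I → t ∈ I → s * t ∈ I ^ 2 := fun hs ht => by
    rw [pow_two]; exact Ideal.mul_mem_mul hs ht
  have hwI₁ : w₁ ∈ I ^ 2 := by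
    rw [hc₁, show z₁ ^ 3 * c₁ = (z₁ * c₁) * (z₁ * z₁) by ring]
    exact Ideal.mul_mem_left _ _ (sq hI₁ hI₁)
  have hwI₂ : w₂ ∈ I ^ 2 := by
    rw [hc₂, show z₂ ^ 3 * c₂ = (z₂ * c₂) * (z₂ * z₂) by ring]
    exact Ideal.mul_mem_left _ _ (sq hI₂ hI₂)
  have hle : I ^ 2 ≤ I := Ideal.pow_le_self two_ne_zero
  by_cases hPQ : P + Q = 0
  -- Since z(-P) = -z(P) / (1 + a₁z + a₃w), the sum z₁ + z₂ is quadratically small although it need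
  -- not vanish.
  · refine ⟨0, 0, map_zero _, map_zero _, ?_, ?_⟩
    · exact .inl ⟨hPQ, by simp, by simp, by simp⟩
    · have hQ' := hP.neg
      rw [← eq_neg_of_add_eq_zero_right hPQ] at hQ'
      obtain ⟨u, hu⟩ := hQ.unique hQ'
      have h0 := congrFun hu 0
      have h1 := congrFun hu 1
      have h2 : z₁ = -z₂ * (1 + a W.a₁ * z₁ + a W.a₃ * w₁) := by
        apply hf
        simp only [map_mul, map_add, map_one, map_neg, a, AlgHom.commutes]
        simp [Units.smul_def, baseChange] at h0 h1
        linear_combination (-1 - algebraMap R F W.a₁ * f z₁ - algebraMap R F W.a₃ * f w₁) * h0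
          - f z₁ * h1
      have h3 : 0 - z₁ - z₂ = a W.a₁ * (z₂ * z₁) + (a W.a₃ * z₂) * w₁ := by
        linear_combination -h2
      rw [h3]
      exact add_mem (Ideal.mul_mem_left _ _ (sq hI₂ hI₁)) (Ideal.mul_mem_left _ _ hwI₁)
  -- The denominator of the slope is congruent to 1, so chord and tangent need no separate treatment
  -- in the kernel of reduction.
  obtain ⟨u, hu⟩ : IsUnit (1 + a W.a₁ * z₁ + a W.a₃ * (w₁ + w₂) - a W.a₂ * z₁ ^ 2
      - a W.a₄ * z₁ * (w₁ + w₂) - a W.a₆ * (w₁ ^ 2 + w₁ * w₂ + w₂ ^ 2)) :=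
    isUnit_of_map_ne_zero (g := g) (by simp [hz₁, hw₁, hw₂])
  obtain ⟨V, hV⟩ : ∃ V, V = z₁ ^ 2 + z₁ * z₂ + z₂ ^ 2 + a W.a₂ * w₂ * (z₁ + z₂)
    + a W.a₄ * w₂ ^ 2 - a W.a₁ * w₂ := ⟨_, rfl⟩
  have hVI : V ∈ I ^ 2 := by
    have : V = z₁ * z₁ + z₁ * z₂ + z₂ * z₂ +
      (a W.a₂ * (z₁ + z₂) + a W.a₄ * w₂ - a W.a₁) * w₂ := by rw [hV]; ring
    rw [this]
    exact add_mem (add_mem (add_mem (sq hI₁ hI₁) (sq hI₁ hI₂)) (sq hI₂ hI₂))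
      (Ideal.mul_mem_left _ _ hwI₂)
  have hgV : g V = 0 := by rw [hV]; simp [hz₁, hz₂, hw₂]
  obtain ⟨l, hl⟩ : ∃ l, l = V * ↑u⁻¹ := ⟨_, rfl⟩
  have hlI : l ∈ I ^ 2 := hl ▸ Ideal.mul_mem_right _ _ hVI
  have hgl : g l = 0 := by rw [hl, map_mul, hgV, zero_mul]
  obtain ⟨n, hn⟩ : ∃ n, n = w₁ - l * z₁ := ⟨_, rfl⟩
  have hnI : n ∈ I ^ 2 := hn ▸ sub_mem hwI₁ (Ideal.mul_mem_right _ _ hlI)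
  have hgn : g n = 0 := by rw [hn]; simp [hw₁, hz₁]
  obtain ⟨A, hA⟩ : ∃ A, A = 1 + a W.a₂ * l + a W.a₄ * l ^ 2 + a W.a₆ * l ^ 3 := ⟨_, rfl⟩
  have hgA : g A = 1 := by rw [hA]; simp [hgl]
  obtain ⟨D, hD⟩ : ∃ D, D = a W.a₂ * n + 2 * a W.a₄ * l * n + 3 * a W.a₆ * l ^ 2 * n - a W.a₁ * l
    - a W.a₃ * l ^ 2 := ⟨_, rfl⟩
  have hDI : D ∈ I ^ 2 := by
    have : D = (a W.a₂ + 2 * a W.a₄ * l + 3 * a W.a₆ * l ^ 2) * n + (- a W.a₁ - a W.a₃ * l) * l := by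
      rw [hD]; ring
    rw [this]
    exact add_mem (Ideal.mul_mem_left _ _ hnI) (Ideal.mul_mem_left _ _ hlI)
  have hgD : g D = 0 := by rw [hD]; simp [hgn, hgl]
  obtain ⟨T, hT⟩ : ∃ T, T = -D - A * (z₁ + z₂) := ⟨_, rfl⟩
  have hTI : T ∈ I := hT ▸ sub_mem (neg_mem (hle hDI)) (Ideal.mul_mem_left _ _ (add_mem hI₁ hI₂))
  have hgT : g T = 0 := by rw [hT]; simp [hgD, hz₁, hz₂]
  -- Minus the Y-coordinate of the sum; dividing by it returns to the chart Y = 1.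
  obtain ⟨v, hv⟩ : IsUnit (A + a W.a₁ * T + a W.a₃ * (l * T + n * A)) :=
    isUnit_of_map_ne_zero (g := g) (by simp [hgA, hgT, hgl, hgn])
  have hfv : f (-(v : B)) ≠ 0 := (v.isUnit.neg.map f).ne_zero
  refine ⟨-(↑v⁻¹ * T), -(↑v⁻¹ * (l * T + n * A)), by simp [hgT], by simp [hgT, hgl, hgn], ?_, ?_⟩
  · refine IsProjRep.of_smul (u := f (-(v : B))) ?_ hfv
    have key := isProjRep_add_of_line (W := W.baseChange F) (l := f l) (n := f n) (A := f A) (T := f T)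
      hP hQ hP0 hQ0 hPQ ?_ ?_ ?_ ?_ ?_
    · convert key using 1
      have hv0 : f v ≠ 0 := (v.isUnit.map f).ne_zero
      ext i; fin_cases i
      · simp [hv0]
      · simp only [hv]
        simp [a, baseChange]; ring
      · simp [hv0]
    · have := (u.isUnit.map f).ne_zero
      rw [hu] at this
      simpa [a, baseChange] using this
    · have : l * (u : B) = V := by rw [hl, mul_assoc, Units.inv_mul, mul_one]
      rw [hu, hV] at this
      simpa [a, baseChange] using congrArg f this
    · rw [hn]; simp
    · rw [hA]; simp [a, baseChange]
    · rw [hT, hD]; simp [a, baseChange, map_ofNat f 2, map_ofNat f 3]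
  · have h1 : (↑v⁻¹ : B) * (A + a W.a₁ * T + a W.a₃ * (l * T + n * A)) = 1 := by
      rw [← hv, Units.inv_mul]
    have h2 : -(↑v⁻¹ * T) - z₁ - z₂ = (↑v⁻¹ : B) * (D -
        (a W.a₁ + a W.a₃ * l) * (T * (z₁ + z₂)) - a W.a₃ * A * (z₁ + z₂) * n) := by
      rw [hT] at h1 ⊢
      linear_combination (z₁ + z₂) * h1
    rw [h2]
    exact Ideal.mul_mem_left _ _ (sub_mem (sub_mem hDI (Ideal.mul_mem_left _ _
      (sq hTI (add_mem hI₁ hI₂)))) (Ideal.mul_mem_left _ _ hnI))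

lemma IsProjRep.eq_of_cross {W : WeierstrassCurve F} {P Q : W.toAffine.Point} {p q : Fin 3 → F}
    (hp : IsProjRep P p) (hq : IsProjRep Q q) (h : ∀ i j, p i * q j = p j * q i) : P = Q := by
  rcases hp with ⟨rfl, h0, h2, h1⟩ | ⟨x, y, n, rfl, h2, h0, h1⟩ <;>
  rcases hq with ⟨rfl, k0, k2, k1⟩ | ⟨x', y', n', rfl, k2, k0, k1⟩
  · rfl
  · have := h 1 2
    rw [h2, zero_mul] at this
    exact absurd this (mul_ne_zero h1 k2)
  · have := h 1 2
    rw [k2, mul_zero, eq_comm] at this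
    exact absurd this (mul_ne_zero h2 k1)
  · have e0 := h 0 2
    have e1 := h 1 2
    rw [h0, k0] at e0
    rw [h1, k1] at e1
    have hx : x = x' := mul_right_cancel₀ (mul_ne_zero h2 k2) (by linear_combination e0)
    have hy : y = y' := mul_right_cancel₀ (mul_ne_zero h2 k2) (by linear_combination e1)
    subst hx hy
    rfl

open scoped WeierstrassCurve.Projective in
lemma cross_of_equiv {p q : Fin 3 → F} (h : p ≈ q) (i j : Fin 3) : p i * q j = p j * q i := by
  obtain ⟨u, rfl⟩ := h
  simp [Units.smul_def]; ring

/-- For distinct reductions the polynomial addition law is valid over both fields at once. For equal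
reductions one uses the kernel formulas at O, and elsewhere the slope N/D or its inverse, one of
which lies in `B`. Nothing forces `B` to be a valuation ring. -/
lemma ReducesTo.add (hf : Function.Injective f) {P₁ P₂ : (W.baseChange F).toAffine.Point}
    {Q₁ Q₂ : (W.baseChange k).toAffine.Point}
    (h₁ : ReducesTo W f g P₁ Q₁) (h₂ : ReducesTo W f g P₂ Q₂) :
    ReducesTo W f g (P₁ + P₂) (Q₁ + Q₂) := by
  by_cases hQ : Q₁ = Q₂
  · subst hQ
    rcases h₁.cases with ⟨rfl, z₁, w₁, hz₁, hw₁, hP₁⟩ | ⟨x₁, y₁, n₁, m₁, rfl, rfl⟩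
    · rcases h₂.cases with ⟨-, z₂, w₂, hz₂, hw₂, hP₂⟩ | ⟨x, y, h, h', -, e⟩
      · obtain ⟨z, w, hz, hw, h, -⟩ :=
          exists_kernel_add hf hz₁ hw₁ hz₂ hw₂ hP₁ hP₂ ⊤ trivial trivial
        rw [add_zero]
        exact .of_kernel hz hw h
      · cases e
    · rcases h₂.cases with ⟨e, -⟩ | ⟨x₂, y₂, n₂, m₂, rfl, e⟩
      · cases e
      set a : R →+* B := algebraMap R B with ha
      rw [Affine.Point.some.injEq] at e
      have hxy : Affine.Point.some (g x₁) (g y₁) m₁ + .some (g x₁) (g y₁) m₁ =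
        Affine.Point.some (g x₁) (g y₁) m₁ + .some (g x₂) (g y₂) m₂ := by
        congr 1
        simpa using e
      rw [hxy]
      obtain ⟨D, hD⟩ : ∃ D, D = y₁ + y₂ + a W.a₁ * x₁ + a W.a₃ := ⟨_, rfl⟩
      obtain ⟨N, hN⟩ : ∃ N, N = x₁ ^ 2 + x₁ * x₂ + x₂ ^ 2 + a W.a₂ * (x₁ + x₂) + a W.a₄
        - a W.a₁ * y₂ := ⟨_, rfl⟩
      by_cases hgD : g D = 0
      -- At the common reduction, N and D become, up to sign, the partial derivatives of the
      -- equation, so smoothness forbids both to vanish.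
      · have hgN : g N ≠ 0 := by
          intro hgN
          have := (Affine.nonsingular_iff _ _).1 m₁
          rw [hD] at hgD
          rw [hN] at hgN
          simp [a, baseChange, ← e.1, ← e.2] at hgN hgD this
          rcases this.2 with h | h
          · apply h; linear_combination -hgN
          · apply h; linear_combination hgD
        obtain ⟨u, hu⟩ := isUnit_of_map_ne_zero hgN
        have hm : D * ↑u⁻¹ * N = D := by rw [← hu, mul_assoc, Units.inv_mul, mul_one]
        obtain ⟨m, hmm⟩ : ∃ m, m = D * ↑u⁻¹ := ⟨_, rfl⟩
        rw [← hmm] at hm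
        have hfN : f N ≠ 0 := hu ▸ (u.isUnit.map f).ne_zero
        rw [hD, hN] at hm
        rw [hN] at hfN hgN
        refine ⟨![m + a W.a₁ * m ^ 2 - (a W.a₂ + x₁ + x₂) * m ^ 3,
          -(1 + a W.a₁ * m - (a W.a₂ + x₁ + x₂) * m ^ 2 - x₁ * m ^ 2 + y₁ * m ^ 3)
          - a W.a₁ * (m + a W.a₁ * m ^ 2 - (a W.a₂ + x₁ + x₂) * m ^ 3) - a W.a₃ * m ^ 3, m ^ 3],
          ?_, ?_⟩
        · convert isProjRep_add_of_num (m := f m) n₁ n₂ ?_ ?_ using 1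
          · ext i; fin_cases i <;> simp [a, baseChange]
          · simpa [a, baseChange] using hfN
          · simpa [a, baseChange] using congrArg f hm
        · convert isProjRep_add_of_num (m := g m) m₁ m₂ ?_ ?_ using 1
          · ext i; fin_cases i <;> simp [a, baseChange]
          · simpa [a, baseChange] using hgN
          · simpa [a, baseChange] using congrArg g hm
      · obtain ⟨u, hu⟩ := isUnit_of_map_ne_zero hgD
        have hl : N * ↑u⁻¹ * D = N := by rw [← hu, mul_assoc, Units.inv_mul, mul_one]
        obtain ⟨l, hll⟩ : ∃ l, l = N * ↑u⁻¹ := ⟨_, rfl⟩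
        rw [← hll] at hl
        have hfD : f D ≠ 0 := hu ▸ (u.isUnit.map f).ne_zero
        rw [hD, hN] at hl
        rw [hD] at hfD hgD
        refine ⟨![l ^ 2 + a W.a₁ * l - a W.a₂ - x₁ - x₂,
          -(l * (l ^ 2 + a W.a₁ * l - a W.a₂ - x₁ - x₂ - x₁) + y₁)
          - a W.a₁ * (l ^ 2 + a W.a₁ * l - a W.a₂ - x₁ - x₂) - a W.a₃, 1], ?_, ?_⟩
        · convert isProjRep_add_of_den (l := f l) n₁ n₂ ?_ ?_ using 1
          · ext i; fin_cases i <;> simp [a, baseChange]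
          · simpa [a, baseChange] using hfD
          · simpa [a, baseChange] using congrArg f hl
        · convert isProjRep_add_of_den (l := g l) m₁ m₂ ?_ ?_ using 1
          · ext i; fin_cases i <;> simp [a, baseChange]
          · simpa [a, baseChange] using hgD
          · simpa [a, baseChange] using congrArg g hl
  · obtain ⟨p₁, hP₁, hQ₁⟩ := h₁
    obtain ⟨p₂, hP₂, hQ₂⟩ := h₂
    have hk := fun h => hQ (hQ₁.eq_of_cross hQ₂ (cross_of_equiv h))
    have hF := hP₁.add_of_not_equiv hP₂ fun h => hQ (hQ₁.eq_of_cross hQ₂ fun i j => by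
      have := cross_of_equiv h i j
      simp only [Function.comp_apply, ← map_mul] at this ⊢
      rw [hf this])
    refine ⟨(W.baseChange B).toProjective.addXYZ p₁ p₂, ?_, ?_⟩
    · rwa [← Projective.baseChange_addXYZ]
    · rw [← Projective.baseChange_addXYZ]
      exact hQ₁.add_of_not_equiv hQ₂ hk

end Reduction

end WeierstrassCurve

namespace WeierstrassCurve

/-! ### The parallelogram relation for x-coordinates. -/

section Parallelogram

variable {F : Type*} [Field F] [DecidableEq F] {W : WeierstrassCurve F}

open Affine.Point MvPolynomial in
lemma exists_addSubMap_self (P : W.toAffine.Point) :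
    ∃ u, ∀ i, (W.addSubMap i).eval (P.sym2x P) = u * (P + P).sym2x (P - P) i := by
  rw [sub_self]
  rcases P with _ | ⟨x, y, h⟩
  · refine ⟨1, fun i => ?_⟩
    rw [← zero_def]
    fin_cases i <;> simp [addSubMap]
  · have e := (Affine.equation_iff _ _).1 h.1
    by_cases hy : y = W.toAffine.negY x y
    · rw [add_self_of_Y_eq hy]
      rw [Affine.negY] at hy
      refine ⟨(W.addSubMap 0).eval ((some x y h).sym2x (some x y h)), fun i => ?_⟩
      fin_cases i
      · simp
      · simp [addSubMap, b₂, b₄, b₆]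
        linear_combination (2 * y + W.a₁ * x + W.a₃) * hy - 4 * e
      · simp [addSubMap]; ring
    · have hD : y - W.toAffine.negY x y ≠ 0 := sub_ne_zero.2 hy
      rw [add_self_of_Y_ne hy]
      refine ⟨(y - W.toAffine.negY x y) ^ 2, fun i => ?_⟩
      have hs : W.toAffine.slope x x y y * (y - W.toAffine.negY x y) =
          3 * x ^ 2 + 2 * W.a₂ * x + W.a₄ - W.a₁ * y := by
        rw [Affine.slope_of_Y_ne rfl hy, div_mul_cancel₀ _ hD]
      have hX : W.toAffine.addX x x (W.toAffine.slope x x y y) * (y - W.toAffine.negY x y) ^ 2 =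
          (3 * x ^ 2 + 2 * W.a₂ * x + W.a₄ - W.a₁ * y) ^ 2 +
          W.a₁ * (3 * x ^ 2 + 2 * W.a₂ * x + W.a₄ - W.a₁ * y) * (y - W.toAffine.negY x y) -
          (W.a₂ + 2 * x) * (y - W.toAffine.negY x y) ^ 2 := by
        rw [← hs, Affine.addX]; ring
      fin_cases i
      · simp [addSubMap]
        rw [Affine.addX] at hX
        rw [mul_comm ((y - _) ^ 2), ← Affine.negY, hX, Affine.negY]
        simp only [b₄, b₆, b₈]
        linear_combination (4 * W.a₂ + W.a₁ ^ 2 + 8 * x) * e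
      · simp [addSubMap, Affine.negY, b₂, b₄, b₆]
        linear_combination -4 * e
      · simp [addSubMap]; ring

-- The symmetric functions of x(P+Q) and x(P-Q) are quadratic forms in those of x(P) and x(Q). When
-- x(P) = x(Q), this reduces to the case P = Q up to sign; otherwise it is a computation with the
-- chord.
open Affine.Point MvPolynomial in
lemma exists_addSubMap (P Q : W.toAffine.Point) :
    ∃ u, ∀ i, (W.addSubMap i).eval (P.sym2x Q) = u * (P + Q).sym2x (P - Q) i := by
  by_cases hPQ : P.xRep = Q.xRep
  · rcases eq_or_eq_neg_of_xRep_eq_xRep hPQ with rfl | rfl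
    · exact exists_addSubMap_self P
    · obtain ⟨u, hu⟩ := exists_addSubMap_self Q
      refine ⟨u, fun i => ?_⟩
      rw [sym2x_neg_left, hu, sym2x_comm, neg_add_cancel, sub_self, ← neg_add', sym2x_neg_right]
  · rcases P with _ | ⟨x₁, y₁, h₁⟩
    · rcases Q with _ | ⟨x₂, y₂, h₂⟩
      · exact absurd rfl hPQ
      · refine ⟨1, fun i => ?_⟩
        rw [← zero_def, zero_add, zero_sub, sym2x_neg_right]
        fin_cases i <;> simp [addSubMap] <;> ring
    · rcases Q with _ | ⟨x₂, y₂, h₂⟩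
      · refine ⟨1, fun i => ?_⟩
        rw [← zero_def, add_zero, sub_zero]
        fin_cases i <;> simp [addSubMap] <;> ring
      · have hx : x₁ ≠ x₂ := by
          rintro rfl; exact hPQ rfl
        have hd : x₁ - x₂ ≠ 0 := sub_ne_zero.2 hx
        have e₁ := (Affine.equation_iff _ _).1 h₁.1
        have e₂ := (Affine.equation_iff _ _).1 h₂.1
        rw [sub_eq_add_neg, neg_some, add_of_X_ne hx, add_of_X_ne hx]
        refine ⟨(x₁ - x₂) ^ 2, fun i => ?_⟩
        fin_cases i
        · simp [addSubMap, Affine.addX, Affine.slope_of_X_ne hx, Affine.negY]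
          field_simp
          simp only [b₄, b₆, b₈]
          linear_combination
            -(y₁ ^ 2 + W.a₁ * x₁ * y₁ + W.a₃ * y₁ +
              (x₁ ^ 3 + W.a₂ * x₁ ^ 2 + W.a₄ * x₁ + W.a₆)
              - 2 * (y₂ ^ 2 + W.a₁ * x₂ * y₂ + W.a₃ * y₂)
              - 2 * (W.a₂ + x₁ + x₂) * (x₁ - x₂) ^ 2
              + (W.a₁ * x₁ + W.a₃) * (W.a₁ * x₂ + W.a₃) - (W.a₁ * x₂ + W.a₃) ^ 2) * e₁
            -(y₂ ^ 2 + W.a₁ * x₂ * y₂ + W.a₃ * y₂ +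
              (x₂ ^ 3 + W.a₂ * x₂ ^ 2 + W.a₄ * x₂ + W.a₆)
              - 2 * (x₁ ^ 3 + W.a₂ * x₁ ^ 2 + W.a₄ * x₁ + W.a₆)
              - 2 * (W.a₂ + x₁ + x₂) * (x₁ - x₂) ^ 2
              + (W.a₁ * x₁ + W.a₃) * (W.a₁ * x₂ + W.a₃) - (W.a₁ * x₁ + W.a₃) ^ 2) * e₂
        · simp [addSubMap, Affine.addX, Affine.slope_of_X_ne hx, Affine.negY]
          field_simp
          simp only [b₂, b₄, b₆]
          linear_combination -2 * e₁ - 2 * e₂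
        · simp [addSubMap]; ring

end Parallelogram

end WeierstrassCurve

/-! ### Primitive polynomial vectors and their degrees. -/

section PrimitiveVectors

open Polynomial

variable {k : Type*} [Field k]

/-- A vector whose entries generate the unit ideal. -/
def IsPrimitiveVec {A ι : Type*} [CommRing A] (v : ι → A) : Prop := Ideal.span (Set.range v) = ⊤

lemma isPrimitiveVec_iff {A ι : Type*} [CommRing A] {v : ι → A} :
    IsPrimitiveVec v ↔ ∀ M : Ideal A, M.IsMaximal → ∃ i, v i ∉ M := by
  constructor
  · intro h M hM
    by_contra! hv
    exact hM.ne_top (top_le_iff.1 (h ▸ Ideal.span_le.2 (Set.range_subset_iff.2 hv)))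
  · intro h
    by_contra hne
    obtain ⟨M, hM, hle⟩ := Ideal.exists_le_maximal _ hne
    obtain ⟨i, hi⟩ := h M hM
    exact hi (hle (Ideal.subset_span ⟨i, rfl⟩))

/-- The largest degree of the entries. -/
def maxDeg {n : ℕ} (v : Fin n → k[X]) : ℕ := Finset.univ.sup fun i => (v i).natDegree

lemma natDegree_le_maxDeg {n : ℕ} (v : Fin n → k[X]) (i : Fin n) : (v i).natDegree ≤ maxDeg v :=
  Finset.le_sup (f := fun i => (v i).natDegree) (Finset.mem_univ i)

lemma exists_coeff_maxDeg_ne_zero {n : ℕ} {v : Fin n → k[X]} (hv : v ≠ 0) :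
    ∃ i, (v i).coeff (maxDeg v) ≠ 0 := by
  obtain ⟨j, hj⟩ := Function.ne_iff.1 hv
  have hn : (Finset.univ : Finset (Fin n)).Nonempty := ⟨j, Finset.mem_univ _⟩
  obtain ⟨i, -, hi⟩ := Finset.exists_mem_eq_sup _ hn fun i => (v i).natDegree
  by_cases h0 : v i = 0
  · refine ⟨j, ?_⟩
    have h1 : maxDeg v = 0 := by rw [maxDeg, hi, h0, natDegree_zero]
    have h2 := natDegree_le_maxDeg v j
    rw [h1] at h2 ⊢
    rw [eq_C_of_natDegree_le_zero h2] at hj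
    intro h3
    rw [h3] at hj
    simp at hj
  · exact ⟨i, by rw [maxDeg, hi]; exact leadingCoeff_ne_zero.2 h0⟩

lemma le_maxDeg_of_coeff_ne_zero {n : ℕ} {v : Fin n → k[X]} {d : ℕ} {i : Fin n}
    (h : (v i).coeff d ≠ 0) : d ≤ maxDeg v :=
  (le_natDegree_of_ne_zero h).trans (natDegree_le_maxDeg v i)

lemma IsPrimitiveVec.ne_zero {n : ℕ} {v : Fin n → k[X]} (h : IsPrimitiveVec v) : v ≠ 0 := by
  rintro rfl
  have : Ideal.span (Set.range (0 : Fin n → k[X])) = ⊥ := by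
    rw [Ideal.span_eq_bot]; rintro _ ⟨i, rfl⟩; rfl
  rw [IsPrimitiveVec, this] at h
  exact bot_ne_top h

lemma IsPrimitiveVec.exists_unit {n : ℕ} {v w : Fin n → k[X]} (hv : IsPrimitiveVec v)
    (hw : IsPrimitiveVec w) (h : ∀ i j, v i * w j = v j * w i) :
    ∃ c : k, c ≠ 0 ∧ ∀ i, w i = C c * v i := by
  have h1 : (1 : k[X]) ∈ Ideal.span (Set.range v) := by rw [hv]; trivial
  obtain ⟨a, ha⟩ := (Ideal.mem_span_range_iff_exists_fun).1 h1
  have hc : ∀ j, w j = (∑ i, a i * w i) * v j := fun j => by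
    calc w j = (∑ i, a i * v i) * w j := by rw [ha, one_mul]
      _ = _ := by
        rw [Finset.sum_mul, Finset.sum_mul]
        refine Finset.sum_congr rfl fun i _ => ?_
        rw [mul_assoc, h i j]; ring
  have hu : IsUnit (∑ i, a i * w i) := by
    by_contra hu
    obtain ⟨M, hM, hle⟩ := Ideal.exists_le_maximal _ (mt Ideal.span_singleton_eq_top.1 hu)
    obtain ⟨i, hi⟩ := isPrimitiveVec_iff.1 hw M hM
    exact hi (hc i ▸ M.mul_mem_right _ (hle (Ideal.mem_span_singleton_self _)))
  obtain ⟨c, hc0, hcc⟩ := Polynomial.isUnit_iff.1 hu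
  exact ⟨c, hc0.ne_zero, fun i => by rw [hcc]; exact hc i⟩

lemma IsPrimitiveVec.maxDeg_eq {n : ℕ} {v w : Fin n → k[X]} (hv : IsPrimitiveVec v)
    (hw : IsPrimitiveVec w) (h : ∀ i j, v i * w j = v j * w i) : maxDeg v = maxDeg w := by
  obtain ⟨c, hc, h⟩ := hv.exists_unit hw h
  unfold maxDeg
  congr 1
  ext i
  rw [h, natDegree_C_mul hc]

/-- The coefficients of the product of two binary linear forms. -/
def symProd {A : Type*} [CommRing A] (a b : Fin 2 → A) : Fin 3 → A :=
  ![a 0 * b 0, a 0 * b 1 + a 1 * b 0, a 1 * b 1]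

lemma symProd_ne_zero {a b : Fin 2 → k} (ha : a ≠ 0) (hb : b ≠ 0) : symProd a b ≠ 0 := by
  intro h
  have h0 := congrFun h 0
  have h1 := congrFun h 1
  have h2 := congrFun h 2
  simp [symProd] at h0 h1 h2
  have ha' : ¬ (a 0 = 0 ∧ a 1 = 0) := fun h => ha (by ext i; fin_cases i; exacts [h.1, h.2])
  have hb' : ¬ (b 0 = 0 ∧ b 1 = 0) := fun h => hb (by ext i; fin_cases i; exacts [h.1, h.2])
  grind

lemma IsPrimitiveVec.symProd {A : Type*} [CommRing A] {a b : Fin 2 → A} (ha : IsPrimitiveVec a)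
    (hb : IsPrimitiveVec b) : IsPrimitiveVec (symProd a b) := by
  rw [isPrimitiveVec_iff] at *
  intro M hM
  by_contra! h
  have hp := hM.isPrime
  obtain ⟨i, hi⟩ := ha M hM
  obtain ⟨j, hj⟩ := hb M hM
  have h0 : a 0 * b 0 ∈ M := h 0
  have h1 : a 0 * b 1 + a 1 * b 0 ∈ M := h 1
  have h2 : a 1 * b 1 ∈ M := h 2
  rcases hp.mem_or_mem h0 with ha0 | hb0
  · have hb0 : b 0 ∈ M := by
      have := (M.add_mem_iff_right (M.mul_mem_right (b 1) ha0)).1 h1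
      refine (hp.mem_or_mem this).resolve_left fun ha1 => hi ?_
      fin_cases i
      exacts [ha0, ha1]
    refine (hp.mem_or_mem h2).elim (fun ha1 => hi ?_) fun hb1 => hj ?_
    · fin_cases i
      exacts [ha0, ha1]
    · fin_cases j
      exacts [hb0, hb1]
  · have ha0 : a 0 ∈ M := by
      have := (M.add_mem_iff_left (M.mul_mem_left (a 1) hb0)).1 h1
      refine (hp.mem_or_mem this).resolve_right fun hb1 => hj ?_
      fin_cases j
      exacts [hb0, hb1]
    refine (hp.mem_or_mem h2).elim (fun ha1 => hi ?_) fun hb1 => hj ?_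
    · fin_cases i
      exacts [ha0, ha1]
    · fin_cases j
      exacts [hb0, hb1]

/-- No cancellation in top degree: the top coefficients of the product form the product of two
nonzero linear forms. -/
lemma maxDeg_symProd {a b : Fin 2 → k[X]} (ha : a ≠ 0) (hb : b ≠ 0) :
    maxDeg (symProd a b) = maxDeg a + maxDeg b := by
  have ha' := natDegree_le_maxDeg a
  have hb' := natDegree_le_maxDeg b
  apply le_antisymm
  · refine Finset.sup_le fun i _ => ?_
    have hm : ∀ i j, (a i * b j).natDegree ≤ maxDeg a + maxDeg b := fun i j =>
      natDegree_mul_le.trans (add_le_add (ha' i) (hb' j))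
    fin_cases i
    · exact hm 0 0
    · exact (natDegree_add_le _ _).trans (max_le (hm 0 1) (hm 1 0))
    · exact hm 1 1
  · obtain ⟨i, hi⟩ := exists_coeff_maxDeg_ne_zero ha
    obtain ⟨j, hj⟩ := exists_coeff_maxDeg_ne_zero hb
    have := symProd_ne_zero (a := fun i => (a i).coeff (maxDeg a))
      (b := fun i => (b i).coeff (maxDeg b)) (fun h => hi (congrFun h i)) (fun h => hj (congrFun h j))
    obtain ⟨l, hl⟩ := Function.ne_iff.1 this
    have hc : (symProd a b l).coeff (maxDeg a + maxDeg b) =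
        symProd (fun i => (a i).coeff (maxDeg a)) (fun i => (b i).coeff (maxDeg b)) l := by
      have hm : ∀ i j, (a i * b j).coeff (maxDeg a + maxDeg b) =
        (a i).coeff (maxDeg a) * (b j).coeff (maxDeg b) := fun i j =>
          coeff_mul_add_eq_of_natDegree_le (ha' i) (hb' j)
      fin_cases l <;> simp [symProd, hm]
    exact le_maxDeg_of_coeff_ne_zero (hc ▸ hl)

-- On an elliptic curve the fourth power of each variable lies in the ideal generated by the three
-- quadratic forms, so they have no common zero modulo a maximal ideal unless all the variables
-- vanish there.
open WeierstrassCurve in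
lemma IsPrimitiveVec.addSubMap {A : Type*} [CommRing A] (W : WeierstrassCurve A) [W.IsElliptic]
    {v : Fin 3 → A} (hv : IsPrimitiveVec v) :
    IsPrimitiveVec fun i => (W.addSubMap i).eval v := by
  rw [isPrimitiveVec_iff] at *
  intro M hM
  by_contra! h
  obtain ⟨i, hi⟩ := hv M hM
  apply hi
  apply hM.isPrime.mem_of_pow_mem 4
  rw [← W.addSubMapCoeff_condition v i]
  exact sum_mem fun j _ => M.mul_mem_left _ (h j)

-- The top coefficients are the values of the quadratic forms at the top coefficients of `v`, and
-- these do not all vanish.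
open WeierstrassCurve in
lemma maxDeg_addSubMap (W : WeierstrassCurve k) [W.IsElliptic] {v : Fin 3 → k[X]} (hv : v ≠ 0) :
    maxDeg (fun i => ((W.map (C : k →+* k[X])).addSubMap i).eval v) = 2 * maxDeg v := by
  have hv' := natDegree_le_maxDeg v
  have hm : ∀ i j, (v i * v j).natDegree ≤ maxDeg v + maxDeg v := fun i j =>
    natDegree_mul_le.trans (add_le_add (hv' i) (hv' j))
  have hC : ∀ (c : k) i j, (C c * (v i * v j)).natDegree ≤ maxDeg v + maxDeg v := fun c i j =>
    (natDegree_C_mul_le _ _).trans (hm i j)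
  have e0 : ((W.map (C : k →+* k[X])).addSubMap 0).eval v = v 0 * v 0 - C W.b₄ * (v 0 * v 2)
      - C W.b₆ * (v 1 * v 2) - C W.b₈ * (v 2 * v 2) := by
    simp [WeierstrassCurve.addSubMap]; ring
  have e1 : ((W.map (C : k →+* k[X])).addSubMap 1).eval v = C 2 * (v 1 * v 0) + C W.b₂ * (v 0 * v 2)
      + C W.b₄ * (v 1 * v 2) + C W.b₆ * (v 2 * v 2) := by
    rw [map_ofNat]
    simp [WeierstrassCurve.addSubMap]; ring
  have e2 : ((W.map (C : k →+* k[X])).addSubMap 2).eval v = v 1 * v 1 - C 4 * (v 0 * v 2) := by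
    rw [map_ofNat]
    simp [WeierstrassCurve.addSubMap]; ring
  rw [two_mul]
  apply le_antisymm
  · refine Finset.sup_le fun i _ => ?_
    fin_cases i
    · simp only [Fin.zero_eta, e0]
      refine (natDegree_sub_le _ _).trans (max_le ?_ (hC _ _ _))
      refine (natDegree_sub_le _ _).trans (max_le ?_ (hC _ _ _))
      exact (natDegree_sub_le _ _).trans (max_le (hm _ _) (hC _ _ _))
    · simp only [Fin.mk_one, e1]
      refine (natDegree_add_le _ _).trans (max_le ?_ (hC _ _ _))
      refine (natDegree_add_le _ _).trans (max_le ?_ (hC _ _ _))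
      exact (natDegree_add_le _ _).trans (max_le (hC _ _ _) (hC _ _ _))
    · simp only [Fin.reduceFinMk, e2]
      exact (natDegree_sub_le _ _).trans (max_le (hm _ _) (hC _ _ _))
  · obtain ⟨i, hi⟩ := exists_coeff_maxDeg_ne_zero hv
    have := W.addSubMap_ne_zero (x := fun i => (v i).coeff (maxDeg v)) (fun h => hi (congrFun h i))
    obtain ⟨l, hl⟩ := Function.ne_iff.1 this
    have hc : (((W.map (C : k →+* k[X])).addSubMap l).eval v).coeff (maxDeg v + maxDeg v) =
        (W.addSubMap l).eval (fun i => (v i).coeff (maxDeg v)) := by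
      have hm : ∀ i j, (v i * v j).coeff (maxDeg v + maxDeg v) =
        (v i).coeff (maxDeg v) * (v j).coeff (maxDeg v) := fun i j =>
          coeff_mul_add_eq_of_natDegree_le (hv' i) (hv' j)
      fin_cases l
      · simp only [Fin.zero_eta, e0]
        simp only [coeff_sub, coeff_C_mul, hm]
        simp [WeierstrassCurve.addSubMap]; ring
      · simp only [Fin.mk_one, e1]
        simp only [coeff_add, coeff_C_mul, hm]
        simp [WeierstrassCurve.addSubMap]; ring
      · simp only [Fin.reduceFinMk, e2]
        simp only [coeff_sub, coeff_C_mul, hm]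
        simp [WeierstrassCurve.addSubMap]; ring
    exact le_maxDeg_of_coeff_ne_zero (i := l) (by rw [hc]; exact hl)

end PrimitiveVectors

namespace WeierstrassCurve

/-! ### Specialization and endomorphisms of the fields. -/

section Specialization

set_option linter.unusedSectionVars false

variable {R : Type*} [CommRing R] {W : WeierstrassCurve R}

section Map

variable {F F' : Type*} [Field F] [Field F'] [Algebra R F] [Algebra R F'] [DecidableEq F]
  [DecidableEq F']

lemma IsProjRep.map (s : F →ₐ[R] F') {P : (W.baseChange F).toAffine.Point} {p : Fin 3 → F}
    (h : IsProjRep P p) : IsProjRep (Affine.Point.map (W' := W) s P) (s ∘ p) := by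
  rcases h with ⟨rfl, h0, h2, h1⟩ | ⟨x, y, h, rfl, h2, h0, h1⟩
  · exact .inl ⟨rfl, by simp [h0], by simp [h2], by simpa using h1⟩
  · exact .inr ⟨_, _, _, rfl, by simpa using h2, by simp [h0], by simp [h1]⟩

variable (W) in
/-- The endomorphism of the group of points induced by an endomorphism of the field. -/
noncomputable def pointEnd (s : F →ₐ[R] F) : AddMonoid.End (W.baseChange F).toAffine.Point :=
  Affine.Point.map (W' := W) s

end Map

variable {B F k : Type*} [CommRing B] [IsLocalRing B] [Field F] [Field k]
  [Algebra R B] [Algebra R F] [Algebra R k] [DecidableEq F] [DecidableEq k]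
  {f : B →ₐ[R] F} {g : B →ₐ[R] k}

lemma ReducesTo.pointEnd {sB : B → B} {sF : F →ₐ[R] F} {sk : k →ₐ[R] k}
    (hF : ∀ b, f (sB b) = sF (f b)) (hk : ∀ b, g (sB b) = sk (g b))
    {P : (W.baseChange F).toAffine.Point} {Q : (W.baseChange k).toAffine.Point}
    (h : ReducesTo W f g P Q) : ReducesTo W f g (W.pointEnd sF P) (W.pointEnd sk Q) := by
  obtain ⟨p, hP, hQ⟩ := h
  refine ⟨sB ∘ p, ?_, ?_⟩
  · have e : f ∘ sB ∘ p = sF ∘ f ∘ p := funext fun i => hF _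
    exact e ▸ hP.map sF
  · have e : g ∘ sB ∘ p = sk ∘ g ∘ p := funext fun i => hk _
    exact e ▸ hQ.map sk

variable [hg : IsLocalHom g]

lemma ReducesTo.nsmul (hf : Function.Injective f)
    {P : (W.baseChange F).toAffine.Point} {Q : (W.baseChange k).toAffine.Point}
    (h : ReducesTo W f g P Q) (n : ℕ) : ReducesTo W f g (n • P) (n • Q) := by
  induction n with
  | zero => simpa using ReducesTo.zero
  | succ n ih => rw [succ_nsmul, succ_nsmul]; exact ih.add hf h

lemma ReducesTo.zsmul (hf : Function.Injective f)
    {P : (W.baseChange F).toAffine.Point} {Q : (W.baseChange k).toAffine.Point}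
    (h : ReducesTo W f g P Q) (n : ℤ) : ReducesTo W f g (n • P) (n • Q) := by
  rcases n with n | n
  · simpa using h.nsmul hf n
  · simpa using (h.nsmul hf (n + 1)).neg

-- `sB` is only a map of sets, applied to coordinates entry by entry; compatibility with the two
-- field endomorphisms suffices. It is used both for a power map and for the restriction of σ.
open Polynomial in
lemma ReducesTo.aeval (hf : Function.Injective f) {sB : B → B} {sF : F →ₐ[R] F} {sk : k →ₐ[R] k}
    (hF : ∀ b, f (sB b) = sF (f b)) (hk : ∀ b, g (sB b) = sk (g b)) (Φ : ℤ[X])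
    {P : (W.baseChange F).toAffine.Point} {Q : (W.baseChange k).toAffine.Point}
    (h : ReducesTo W f g P Q) :
    ReducesTo W f g (Polynomial.aeval (W.pointEnd sF) Φ P)
      (Polynomial.aeval (W.pointEnd sk) Φ Q) := by
  induction Φ using Polynomial.induction_on' with
  | add p q hp hq =>
    rw [map_add, map_add]
    exact hp.add hf hq
  | monomial n a =>
    have hn : ReducesTo W f g ((W.pointEnd sF ^ n) P) ((W.pointEnd sk ^ n) Q) := by
      induction n with
      | zero => simpa using h
      | succ n ih => rw [pow_succ', pow_succ']; exact ih.pointEnd hF hk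
    rw [aeval_monomial, aeval_monomial, ← Algebra.smul_def, ← Algebra.smul_def]
    exact hn.zsmul hf a

lemma ReducesTo.eq_zero {Q : (W.baseChange k).toAffine.Point}
    (h : ReducesTo W f g 0 Q) : Q = 0 := by
  rcases h.cases with ⟨rfl, -⟩ | ⟨x, y, h, h', e, -⟩
  · rfl
  · cases e

/-- A point with an integral `x`-coordinate does not reduce to zero. -/
lemma ReducesTo.ne_zero (hf : Function.Injective f) {a b : B}
    {x y : F} {h : (W.baseChange F).toAffine.Nonsingular x y} {Q : (W.baseChange k).toAffine.Point}
    (hQ : ReducesTo W f g (.some x y h) Q) (hb : g b ≠ 0) (hx : f b * x = f a) : Q ≠ 0 := by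
  rintro rfl
  rcases hQ.cases with ⟨-, z, w, hz, hw, hr⟩ | ⟨x, y, h, h', -, e⟩
  · obtain ⟨c, hc, rfl⟩ := exists_eq_cube_mul hf hz hw hr
    rcases hr with ⟨e, -⟩ | ⟨x', y', h', e, h2, h0, h1⟩
    · cases e
    · cases e
      simp only [Matrix.cons_val_zero, Matrix.cons_val_two, Matrix.tail_cons, Matrix.head_cons,
        map_mul, map_pow] at h2 h0
      have hz0 : f z ≠ 0 := by rintro e; simp [e] at h2
      have h3 : 1 = x * f z ^ 2 * f c := mul_left_cancel₀ hz0 (by linear_combination h0)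
      have h4 : f b = f (a * z ^ 2 * c) := by
        rw [map_mul, map_mul, map_pow, ← hx]; linear_combination f b * h3
      exact hb (by rw [hf h4]; simp [hz])
  · cases e

end Specialization

/-! ### The local ring at the kernel of an evaluation. -/

section LocalRing

variable {R A F k : Type*} [CommRing R] [CommRing A] [Field F] [Field k]
  [Algebra R A] [Algebra R F] [Algebra R k]

instance isPrime_ker_algHom (ev : A →ₐ[R] k) : (RingHom.ker ev).IsPrime := RingHom.ker_isPrime ev

/-- Evaluation on the local ring of a point with values in a field. -/
noncomputable def evalLocalization (ev : A →ₐ[R] k) :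
    Localization.AtPrime (RingHom.ker ev) →ₐ[R] k :=
  IsLocalization.liftAlgHom (M := (RingHom.ker ev).primeCompl) (f := ev) fun s =>
    isUnit_iff_ne_zero.2 s.2

/-- The embedding of the local ring of a point into a field containing the coordinate ring. -/
noncomputable def embLocalization (ev : A →ₐ[R] k) (a : A →ₐ[R] F) (ha : Function.Injective a) :
    Localization.AtPrime (RingHom.ker ev) →ₐ[R] F :=
  IsLocalization.liftAlgHom (M := (RingHom.ker ev).primeCompl) (f := a) fun s =>
    isUnit_iff_ne_zero.2 fun h => s.2 (by
      have : (s : A) = 0 := ha (by rw [h, map_zero])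
      rw [this]; exact zero_mem _)

lemma evalLocalization_algebraMap (ev : A →ₐ[R] k) (x : A) :
    evalLocalization ev (algebraMap A _ x) = ev x := by
  simp [evalLocalization, IsLocalization.liftAlgHom_apply]

lemma embLocalization_algebraMap (ev : A →ₐ[R] k) (a : A →ₐ[R] F) (ha : Function.Injective a)
    (x : A) : embLocalization ev a ha (algebraMap A _ x) = a x := by
  simp [embLocalization, IsLocalization.liftAlgHom_apply]

instance (ev : A →ₐ[R] k) : IsLocalHom (evalLocalization ev) := by
  refine ⟨fun b hb => ?_⟩
  obtain ⟨x, s, rfl⟩ := IsLocalization.exists_mk'_eq (RingHom.ker ev).primeCompl b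
  rw [IsLocalization.AtPrime.isUnit_mk'_iff _ (RingHom.ker ev)]
  intro hx
  have h1 := congrArg (evalLocalization ev)
    (IsLocalization.mk'_spec (Localization.AtPrime (RingHom.ker ev)) x s)
  rw [map_mul, evalLocalization_algebraMap, evalLocalization_algebraMap, show ev x = 0 from hx,
    mul_eq_zero] at h1
  exact h1.elim hb.ne_zero fun h => s.2 h

lemma embLocalization_injective (ev : A →ₐ[R] k) (a : A →ₐ[R] F) (ha : Function.Injective a) :
    Function.Injective (embLocalization ev a ha) := by
  rw [injective_iff_map_eq_zero]
  intro b hb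
  obtain ⟨x, s, rfl⟩ := IsLocalization.exists_mk'_eq (RingHom.ker ev).primeCompl b
  have h1 := congrArg (embLocalization ev a ha)
    (IsLocalization.mk'_spec (Localization.AtPrime (RingHom.ker ev)) x s)
  rw [map_mul, hb, zero_mul, embLocalization_algebraMap] at h1
  have : x = 0 := ha (by rw [← h1, map_zero])
  rw [this, IsLocalization.mk'_zero]

end LocalRing

end WeierstrassCurve

namespace WeierstrassCurve

/-! ### The coordinate ring and the generic point. -/

section GenericPoint

set_option linter.unusedSectionVars false

open Polynomial

lemma eval₂_polynomial {k S : Type*} [CommRing k] [CommRing S] (V : WeierstrassCurve k)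
    (i : k[X] →+* S) (y : S) :
    V.toAffine.polynomial.eval₂ i y = y ^ 2 + (i (C V.a₁) * i X + i (C V.a₃)) * y -
      (i X ^ 3 + i (C V.a₂) * i X ^ 2 + i (C V.a₄) * i X + i (C V.a₆)) := by
  rw [WeierstrassCurve.Affine.polynomial]
  simp only [eval₂_add, eval₂_sub, eval₂_mul, eval₂_pow, eval₂_X, eval₂_C, map_add, map_mul,
    map_pow]

variable {R k : Type*} [CommRing R] [Field k] [Algebra R k] (W : WeierstrassCurve R)

/-- The affine coordinate ring of the base change of `W` to the field `k`. -/
abbrev CoordRing (k : Type*) [Field k] [Algebra R k] : Type _ :=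
  (W.baseChange k).toAffine.CoordinateRing

lemma coordRing_equation :
    (W.baseChange (W.CoordRing k)).toAffine.Equation (AdjoinRoot.of _ X) (AdjoinRoot.root _) := by
  have h := AdjoinRoot.eval₂_root (W.baseChange k).toAffine.polynomial
  rw [eval₂_polynomial] at h
  rw [Affine.equation_iff']
  have e : ∀ r : R, algebraMap R (W.CoordRing k) r =
    AdjoinRoot.of (W.baseChange k).toAffine.polynomial (C (algebraMap R k r)) := fun r => rfl
  have e₁ : (W.baseChange (W.CoordRing k)).a₁ = AdjoinRoot.of _ (C (W.baseChange k).a₁) := e _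
  have e₂ : (W.baseChange (W.CoordRing k)).a₂ = AdjoinRoot.of _ (C (W.baseChange k).a₂) := e _
  have e₃ : (W.baseChange (W.CoordRing k)).a₃ = AdjoinRoot.of _ (C (W.baseChange k).a₃) := e _
  have e₄ : (W.baseChange (W.CoordRing k)).a₄ = AdjoinRoot.of _ (C (W.baseChange k).a₄) := e _
  have e₆ : (W.baseChange (W.CoordRing k)).a₆ = AdjoinRoot.of _ (C (W.baseChange k).a₆) := e _
  change AdjoinRoot.root _ ^ 2 + (W.baseChange (W.CoordRing k)).a₁ * AdjoinRoot.of _ X *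
    AdjoinRoot.root _ + (W.baseChange (W.CoordRing k)).a₃ * AdjoinRoot.root _ -
    (AdjoinRoot.of _ X ^ 3 + (W.baseChange (W.CoordRing k)).a₂ * AdjoinRoot.of _ X ^ 2 +
    (W.baseChange (W.CoordRing k)).a₄ * AdjoinRoot.of _ X + (W.baseChange (W.CoordRing k)).a₆) = 0
  rw [e₁, e₂, e₃, e₄, e₆, ← h]
  ring

variable {W} in
lemma isElliptic_baseChange {B S : Type*} [CommRing B] [CommRing S] [Algebra R B] [Algebra R S]
    [Algebra B S] [IsScalarTower R B S] (h : (W.baseChange B).IsElliptic) :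
    (W.baseChange S).IsElliptic := by
  rw [isElliptic_iff, baseChange, map_Δ, IsScalarTower.algebraMap_eq R B S, RingHom.comp_apply]
  rw [isElliptic_iff, baseChange, map_Δ] at h
  exact h.map _

variable {W} in
lemma nonsingular_of_equation {B S : Type*} [CommRing B] [CommRing S] [Nontrivial S] [Algebra R B]
    [Algebra R S] [Algebra B S] [IsScalarTower R B S] [(W.baseChange B).IsElliptic] {x y : B}
    (h : (W.baseChange B).toAffine.Equation x y) :
    (W.baseChange S).toAffine.Nonsingular (algebraMap B S x) (algebraMap B S y) := by
  have e : (W.baseChange B).map (algebraMap B S) = W.baseChange S := by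
    rw [baseChange, baseChange, map_map, ← IsScalarTower.algebraMap_eq]
  rw [← e]
  exact Affine.equation_iff_nonsingular.1 (h.map _)

instance [h : (W.baseChange k).IsElliptic] : (W.baseChange (W.CoordRing k)).IsElliptic :=
  isElliptic_baseChange h

variable (F : Type*) [Field F] [Algebra (W.CoordRing k) F] [IsFractionRing (W.CoordRing k) F]
  [Algebra R F] [IsScalarTower R (W.CoordRing k) F]

/-- The generic point. -/
noncomputable def genericPoint (k F : Type*) [Field k] [Algebra R k] [Field F]
    [Algebra (W.CoordRing k) F] [Algebra R F] [IsScalarTower R (W.CoordRing k) F]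
    [(W.baseChange k).IsElliptic] : (W.baseChange F).toAffine.Point :=
  .some _ _ (nonsingular_of_equation (S := F) (W.coordRing_equation (k := k)))

variable {W}

/-- Evaluation of regular functions at a point. -/
noncomputable def evalAt {x y : k} (h : (W.baseChange k).toAffine.Equation x y) :
    W.CoordRing k →ₐ[k] k :=
  AdjoinRoot.liftAlgHom _ (Polynomial.aeval x) y (by
    rw [Affine.Equation, evalEval] at h
    rw [← h, ← coe_evalRingHom, ← coe_evalRingHom, ← RingHom.comp_apply]
    rw [← coe_eval₂RingHom]
    congr 1
    ext <;> simp)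

lemma evalAt_of {x y : k} (h : (W.baseChange k).toAffine.Equation x y) (f : k[X]) :
    evalAt h (AdjoinRoot.of _ f) = f.eval x := by
  rw [evalAt, AdjoinRoot.liftAlgHom_of]
  simp [aeval_def, eval₂_eq_eval_map]

lemma evalAt_root {x y : k} (h : (W.baseChange k).toAffine.Equation x y) :
    evalAt h (AdjoinRoot.root _) = y := by
  simp [evalAt]

variable (W k) in
/-- The inclusion of the coordinate ring into the function field. -/
noncomputable def coordRingHom : W.CoordRing k →ₐ[R] F :=
  IsScalarTower.toAlgHom R (W.CoordRing k) F

lemma coordRingHom_injective : Function.Injective (coordRingHom k W F) :=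
  IsFractionRing.injective (W.CoordRing k) F

variable [DecidableEq k] [DecidableEq F]

/-- The generic point specializes to every affine point. -/
lemma reducesTo_genericPoint [(W.baseChange k).IsElliptic] {x y : k}
    (h : (W.baseChange k).toAffine.Nonsingular x y) :
    ReducesTo W (embLocalization ((evalAt h.1).restrictScalars R) (coordRingHom k W F)
      (coordRingHom_injective F)) (evalLocalization ((evalAt h.1).restrictScalars R))
      (W.genericPoint k F) (.some x y h) := by
  refine ⟨algebraMap (W.CoordRing k) (Localization.AtPrime
    (RingHom.ker ((evalAt h.1).restrictScalars R))) ∘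
      ![AdjoinRoot.of _ X, AdjoinRoot.root _, 1], ?_, ?_⟩
  · refine .inr ⟨_, _, _, rfl, ?_⟩
    simp only [Function.comp_apply, embLocalization_algebraMap]
    simp [coordRingHom]
  · refine .inr ⟨_, _, h, rfl, ?_⟩
    simp only [Function.comp_apply, evalLocalization_algebraMap]
    simp [evalAt_of, evalAt_root]

lemma finite_setOf_xRep_mem {V : WeierstrassCurve k} {S : Set (Fin 2 → k)} (hS : S.Finite) :
    {P : V.toAffine.Point | P.xRep ∈ S}.Finite := by
  refine hS.preimage' fun b _ => ?_
  by_cases hb : ∃ P : V.toAffine.Point, P.xRep = b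
  · obtain ⟨P, rfl⟩ := hb
    refine (Set.toFinite {P, -P}).subset fun Q hQ => ?_
    exact Affine.Point.eq_or_eq_neg_of_xRep_eq_xRep hQ
  · convert Set.finite_empty
    ext P
    simpa using fun h => hb ⟨P, h⟩

/-- A nonzero regular function has finitely many zeros. -/
lemma finite_setOf_evalAt_eq_zero {b : W.CoordRing k} (hb : b ≠ 0) :
    {P : (W.baseChange k).toAffine.Point | P = 0 ∨ ∃ x y h, P = .some x y h ∧
      evalAt h.1 b = 0}.Finite := by
  -- By integrality over k[x], `b` divides a nonzero polynomial n in x; zeros of `b` have their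
  -- abscissa among the roots of n.
  have : Module.Finite k[X] (W.CoordRing k) :=
    .of_basis (Affine.CoordinateRing.basis (W.baseChange k).toAffine)
  have hI := Ideal.comap_ne_bot_of_integral_mem hb (I := Ideal.span {b})
    (Ideal.mem_span_singleton_self b) (Algebra.IsIntegral.isIntegral (R := k[X]) b)
  obtain ⟨n, hn, hn0⟩ := Submodule.exists_mem_ne_zero_of_ne_bot hI
  obtain ⟨c, hc⟩ := Ideal.mem_span_singleton.1 (Ideal.mem_comap.1 hn)
  refine (finite_setOf_xRep_mem (V := W.baseChange k)
    ((Set.finite_singleton ![1, 0]).union ((n.rootSet_finite k).image fun x => ![x, 1]))).subset ?_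
  rintro P (rfl | ⟨x, y, h, rfl, e⟩)
  · left; simp
  · right
    refine ⟨x, ?_, by simp⟩
    rw [mem_rootSet]
    refine ⟨hn0, ?_⟩
    have := congrArg (evalAt h.1) hc
    rw [map_mul, e, zero_mul] at this
    rw [← this, aeval_def, eval₂_eq_eval_map]
    simp only [Algebra.algebraMap_self, Polynomial.map_id]
    exact (evalAt_of h.1 n).symm

end GenericPoint

/-! ### Combinations of powers of Frobenius with infinite kernel. -/

section Frobenius

set_option linter.unusedSectionVars false

open Polynomial

variable {R k : Type*} [CommRing R] [Field k] [Algebra R k] [DecidableEq k] {W : WeierstrassCurve R}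

/-- An integral combination of powers of Frobenius that kills infinitely many points is zero. -/
theorem aeval_pointEnd_eq_zero_of_infinite [(W.baseChange k).IsElliptic] (p n : ℕ) [ExpChar k p]
    (s : k →ₐ[R] k) (hs : ∀ x, s x = x ^ p ^ n) (Φ : ℤ[X])
    (hΦ : {P | aeval (W.pointEnd s) Φ P = 0}.Infinite) (P : (W.baseChange k).toAffine.Point) :
    aeval (W.pointEnd s) Φ P = 0 := by
  classical
  let F := FractionRing (W.CoordRing k)
  have : ExpChar F p := expChar_of_injective_algebraMap (algebraMap k F).injective p
  -- The same power map on the function field; it fixes the image of `R` because `s` does, and it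
  -- specializes to `s` at every point.
  let sF : F →ₐ[R] F :=
    { iterateFrobenius F p n with
      commutes' := fun r => by
        change (algebraMap R F r) ^ p ^ n = _
        rw [IsScalarTower.algebraMap_apply R k F, ← map_pow, ← hs, s.commutes] }
  have hsF : ∀ x, sF x = x ^ p ^ n := fun x => rfl
  have key : ∀ {x y : k} (h : (W.baseChange k).toAffine.Nonsingular x y),
      ReducesTo W (embLocalization ((evalAt h.1).restrictScalars R) (coordRingHom k W F)
        (coordRingHom_injective F)) (evalLocalization ((evalAt h.1).restrictScalars R))
        (aeval (W.pointEnd sF) Φ (W.genericPoint k F)) (aeval (W.pointEnd s) Φ (.some x y h)) :=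
    fun h => (reducesTo_genericPoint F h).aeval (embLocalization_injective _ _ _)
      (sB := fun b => b ^ p ^ n) (fun b => by rw [map_pow, hsF]) (fun b => by rw [map_pow, hs]) Φ
  rcases hG : aeval (W.pointEnd sF) Φ (W.genericPoint k F) with _ | ⟨X, Y, hXY⟩
  · rcases P with _ | ⟨x, y, h⟩
    · exact map_zero _
    · have := key h
      rw [hG] at this
      exact this.eq_zero
  · exfalso
    -- If the image of the generic point were affine with abscissa a/b, its specialization would be
    -- affine wherever b does not vanish, leaving only finitely many points in the kernel.
    obtain ⟨a, b, hb, e⟩ := IsFractionRing.div_surjective (A := W.CoordRing k) X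
    have hb0 : b ≠ 0 := nonZeroDivisors.ne_zero hb
    have hb1 : algebraMap (W.CoordRing k) F b ≠ 0 := by simpa using hb0
    refine hΦ ((finite_setOf_evalAt_eq_zero hb0).subset ?_)
    rintro (_ | ⟨x, y, h⟩) hP
    · exact .inl rfl
    · refine .inr ⟨x, y, h, rfl, ?_⟩
      by_contra hne
      have h1 := key h
      rw [hG] at h1
      refine h1.ne_zero (embLocalization_injective _ _ _) (b := algebraMap _ _ b)
        (a := algebraMap _ _ a) ?_ ?_ hP
      · rw [evalLocalization_algebraMap]; exact hne
      · rw [embLocalization_algebraMap, embLocalization_algebraMap, ← e]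
        exact mul_div_cancel₀ _ hb1

end Frobenius

end WeierstrassCurve

/-! ### Coprime pairs of polynomials. -/

section PrimitivePairs

open Polynomial

variable {k : Type*} [Field k]

lemma isPrimitiveVec_two {A : Type*} [CommRing A] {v : Fin 2 → A} :
    IsPrimitiveVec v ↔ IsCoprime (v 0) (v 1) := by
  rw [IsPrimitiveVec, Ideal.eq_top_iff_one, Ideal.mem_span_range_iff_exists_fun]
  simp only [Fin.sum_univ_two]
  exact ⟨fun ⟨c, hc⟩ => ⟨c 0, c 1, hc⟩, fun ⟨a, b, h⟩ => ⟨![a, b], h⟩⟩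

lemma exists_isPrimitiveVec {v : Fin 2 → k[X]} (hv : v ≠ 0) :
    ∃ t : Fin 2 → k[X], ∃ d : k[X], d ≠ 0 ∧ IsPrimitiveVec t ∧ ∀ i, v i = d * t i := by
  classical
  have hd : EuclideanDomain.gcd (v 0) (v 1) ≠ 0 := by
    rw [Ne, EuclideanDomain.gcd_eq_zero_iff]
    rintro ⟨h0, h1⟩
    exact hv (by ext i : 1; fin_cases i; exacts [h0, h1])
  refine ⟨![v 0 / EuclideanDomain.gcd (v 0) (v 1), v 1 / EuclideanDomain.gcd (v 0) (v 1)], _, hd,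
    ?_, ?_⟩
  · rw [isPrimitiveVec_two]
    have h := EuclideanDomain.gcd_eq_gcd_ab (v 0) (v 1)
    refine ⟨EuclideanDomain.gcdA (v 0) (v 1), EuclideanDomain.gcdB (v 0) (v 1), ?_⟩
    apply mul_left_cancel₀ hd
    have h0 := EuclideanDomain.mul_div_cancel' hd (EuclideanDomain.gcd_dvd_left (v 0) (v 1))
    have h1 := EuclideanDomain.mul_div_cancel' hd (EuclideanDomain.gcd_dvd_right (v 0) (v 1))
    generalize EuclideanDomain.gcdA (v 0) (v 1) = x at *
    generalize EuclideanDomain.gcdB (v 0) (v 1) = y at *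
    simp only [Matrix.cons_val_zero, Matrix.cons_val_one]
    rw [mul_add, mul_one, mul_left_comm, h0, mul_left_comm, h1]
    linear_combination -h
  · intro i
    fin_cases i
    · exact (EuclideanDomain.mul_div_cancel' hd (EuclideanDomain.gcd_dvd_left _ _)).symm
    · exact (EuclideanDomain.mul_div_cancel' hd (EuclideanDomain.gcd_dvd_right _ _)).symm

end PrimitivePairs

namespace WeierstrassCurve

/-! ### The degree of multiplication by n on x-coordinates. -/

section MultiplicationMap

set_option linter.unusedSectionVars false

open Polynomial

lemma eval_addSubMap_map {A B : Type*} [CommRing A] [CommRing B] (V : WeierstrassCurve A)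
    (φ : A →+* B) (v : Fin 3 → A) (i : Fin 3) :
    ((V.map φ).addSubMap i).eval (fun j => φ (v j)) = φ ((V.addSubMap i).eval v) := by
  have h2 : φ 2 = 2 := map_ofNat φ 2
  have h4 : φ 4 = 4 := map_ofNat φ 4
  fin_cases i <;> simp [addSubMap, h2, h4]

lemma eval_addSubMap_mul {A : Type*} [CommRing A] (V : WeierstrassCurve A)
    (c : A) (v : Fin 3 → A) (i : Fin 3) :
    (V.addSubMap i).eval (fun j => c * v j) = c ^ 2 * (V.addSubMap i).eval v := by
  fin_cases i <;> simp [addSubMap] <;> ring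

lemma sym2x_eq_symProd {F : Type*} [Field F] {V : WeierstrassCurve F} (P Q : V.toAffine.Point) :
    P.sym2x Q = symProd P.xRep Q.xRep := rfl

variable {R k : Type*} [CommRing R] [Field k] [Algebra R k] {W : WeierstrassCurve R}
  {F : Type*} [Field F] [Algebra (W.CoordRing k) F] [IsFractionRing (W.CoordRing k) F]
  [Algebra R F] [IsScalarTower R (W.CoordRing k) F]

variable (k W F) in
/-- The inclusion of polynomials in `x` into the function field. -/
noncomputable def polyHom : k[X] →+* F :=
  (algebraMap (W.CoordRing k) F).comp (AdjoinRoot.of _)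

lemma polyHom_injective : Function.Injective (polyHom k W F) :=
  (IsFractionRing.injective (W.CoordRing k) F).comp
    (FaithfulSMul.algebraMap_injective k[X] (W.CoordRing k))

lemma map_polyHom : ((W.baseChange k).map C).map (polyHom k W F) = W.baseChange F := by
  rw [baseChange, baseChange, map_map, map_map]
  congr 1
  ext r
  exact (IsScalarTower.algebraMap_apply R (W.CoordRing k) F r).symm

variable [DecidableEq F]

/-- The polynomials `v` form a reduced representative of the `x`-coordinate of `P`. -/
def IsXRep (P : (W.baseChange F).toAffine.Point) (v : Fin 2 → k[X]) : Prop :=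
  IsPrimitiveVec v ∧ ∃ c : F, c ≠ 0 ∧ ∀ i, polyHom k W F (v i) = c * P.xRep i

/-- The parallelogram law for degrees: the quadratic forms keep primitivity and double the degree,
so no common factor is lost in passing from x(P), x(Q) to x(P+Q), x(P-Q). -/
lemma IsXRep.exists_add [(W.baseChange k).IsElliptic] {P Q : (W.baseChange F).toAffine.Point}
    {v w u : Fin 2 → k[X]} (hP : IsXRep P v) (hQ : IsXRep Q w) (hPQ : IsXRep (P - Q) u) :
    ∃ t : Fin 2 → k[X], IsXRep (P + Q) t ∧ maxDeg t + maxDeg u = 2 * (maxDeg v + maxDeg w) := by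
  obtain ⟨hv, a, ha, hav⟩ := hP
  obtain ⟨hw, b, hb, hbw⟩ := hQ
  obtain ⟨hu, c, hc, hcu⟩ := hPQ
  set φ := polyHom k W F
  have hφ : ∀ {x : k[X]}, φ x = 0 → x = 0 := fun {x} h =>
    polyHom_injective (h.trans (map_zero φ).symm)
  set s : Fin 3 → k[X] := fun i =>
    (((W.baseChange k).map (C : k →+* k[X])).addSubMap i).eval (symProd v w) with hs
  have hsp : IsPrimitiveVec s := (hv.symProd hw).addSubMap _
  have hsd : maxDeg s = 2 * (maxDeg v + maxDeg w) := by
    rw [← maxDeg_symProd hv.ne_zero hw.ne_zero]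
    exact maxDeg_addSubMap _ (hv.symProd hw).ne_zero
  obtain ⟨l, hl⟩ := exists_addSubMap P Q
  have h1 : ∀ j, φ (symProd v w j) = a * b * P.sym2x Q j := fun j => by
    rw [sym2x_eq_symProd]
    fin_cases j <;> simp [symProd, hav, hbw] <;> ring
  have h2 : ∀ i, φ (s i) = (a * b) ^ 2 * l * symProd (P + Q).xRep (P - Q).xRep i := fun i => by
    rw [hs, ← eval_addSubMap_map, map_polyHom]
    simp only [h1]
    rw [eval_addSubMap_mul, hl, sym2x_eq_symProd]
    ring
  have hl0 : l ≠ 0 := by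
    rintro rfl
    refine hsp.ne_zero (funext fun i => hφ ?_)
    rw [h2]; ring
  set m := (a * b) ^ 2 * l / c
  have hm0 : m ≠ 0 := div_ne_zero (mul_ne_zero (pow_ne_zero _ (mul_ne_zero ha hb)) hl0) hc
  have h3 : ∀ i, φ (s i) = m * symProd (P + Q).xRep (fun j => φ (u j)) i := fun i => by
    have hm : (a * b) ^ 2 * l = m * c := (div_mul_cancel₀ _ hc).symm
    rw [h2, hm]
    fin_cases i <;> simp [symProd, hcu] <;> ring
  have h30 : φ (s 0) = m * ((P + Q).xRep 0 * φ (u 0)) := h3 0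
  have h31 : φ (s 1) = m * ((P + Q).xRep 0 * φ (u 1) + (P + Q).xRep 1 * φ (u 0)) := h3 1
  have h32 : φ (s 2) = m * ((P + Q).xRep 1 * φ (u 1)) := h3 2
  -- Over the function field `s` is proportional to the product of the linear forms of x(P+Q) and
  -- `u`; the first factor is recovered by division, according to whether u 0 vanishes.
  have h4 : ∃ t' : Fin 2 → k[X], ∃ d : F, d ≠ 0 ∧ ∀ i, φ (t' i) = d * (P + Q).xRep i := by
    by_cases hu0 : u 0 = 0
    · have hu1 : u 1 ≠ 0 := fun hu1 => hu.ne_zero (by ext i : 1; fin_cases i; exacts [hu0, hu1])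
      refine ⟨![s 1, s 2], m * φ (u 1), mul_ne_zero hm0 (fun h => hu1 (hφ h)),
        Fin.forall_fin_two.2 ⟨?_, ?_⟩⟩ <;> rw [hu0, map_zero, mul_zero, add_zero] at h31
      · exact h31.trans (by ring)
      · exact h32.trans (by ring)
    · refine ⟨![s 0 * u 0, s 1 * u 0 - s 0 * u 1], m * φ (u 0) ^ 2,
        mul_ne_zero hm0 (pow_ne_zero _ (fun h => hu0 (hφ h))),
          Fin.forall_fin_two.2 ⟨?_, ?_⟩⟩
      · change φ (s 0 * u 0) = _
        rw [map_mul, h30]; ring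
      · change φ (s 1 * u 0 - s 0 * u 1) = _
        rw [map_sub, map_mul, map_mul, h30, h31]; ring
  obtain ⟨t', d, hd, ht'⟩ := h4
  have ht0 : t' ≠ 0 := by
    rintro rfl
    refine (P + Q).xRep_ne_zero (funext fun i => ?_)
    simpa [hd] using (ht' i).symm
  obtain ⟨t, e, he, ht, hte⟩ := exists_isPrimitiveVec ht0
  have he' : φ e ≠ 0 := fun h => he (hφ h)
  have h5 : ∀ i, φ (t i) = d / φ e * (P + Q).xRep i := fun i => by
    have := ht' i
    rw [hte, map_mul] at this
    field_simp
    rw [mul_comm, this]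
  refine ⟨t, ⟨ht, _, div_ne_zero hd he', h5⟩, ?_⟩
  rw [← maxDeg_symProd ht.ne_zero hu.ne_zero, ← hsd]
  refine IsPrimitiveVec.maxDeg_eq (ht.symProd hu) hsp fun i j => polyHom_injective (W := W) (F := F) ?_
  have h6 : ∀ i, φ (symProd t u i) =
      d / φ e * symProd (P + Q).xRep (fun j => φ (u j)) i := fun i => by
    fin_cases i <;> simp [symProd, h5] <;> ring
  change φ _ = φ _
  rw [map_mul, map_mul, h3, h3, h6, h6]
  ring

lemma isXRep_zero : IsXRep (0 : (W.baseChange F).toAffine.Point) (![1, 0] : Fin 2 → k[X]) := by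
  refine ⟨isPrimitiveVec_two.2 isCoprime_one_left, 1, one_ne_zero, fun i => ?_⟩
  fin_cases i <;> simp

lemma isXRep_genericPoint [(W.baseChange k).IsElliptic] :
    IsXRep (W.genericPoint k F) (![X, 1] : Fin 2 → k[X]) := by
  refine ⟨isPrimitiveVec_two.2 isCoprime_one_right, 1, one_ne_zero, fun i => ?_⟩
  fin_cases i
  · simp [genericPoint, polyHom]
  · simp [genericPoint]

/-- Induction on two consecutive multiples, with the recursion d(n+2) + d(n) = 2 (d(n+1) + 1) solved
by squares. -/
lemma exists_isXRep_nsmul [(W.baseChange k).IsElliptic] (n : ℕ) :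
    ∃ v : Fin 2 → k[X], IsXRep (n • W.genericPoint k F) v ∧ maxDeg v = n ^ 2 := by
  have h1 : maxDeg (![X, 1] : Fin 2 → k[X]) = 1 := by
    simp [maxDeg, Fin.univ_succ]
  have key : ∀ n : ℕ, (∃ v : Fin 2 → k[X], IsXRep (n • W.genericPoint k F) v ∧ maxDeg v = n ^ 2) ∧
      ∃ v : Fin 2 → k[X], IsXRep ((n + 1) • W.genericPoint k F) v ∧ maxDeg v = (n + 1) ^ 2 := by
    intro n
    induction n with
    | zero =>
      refine ⟨⟨_, by rw [zero_smul]; exact isXRep_zero, ?_⟩, _, by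
        rw [zero_add, one_smul]; exact isXRep_genericPoint, by simpa using h1⟩
      simp [maxDeg, Fin.univ_succ]
    | succ n ih =>
      obtain ⟨⟨u, hu, du⟩, v, hv, dv⟩ := ih
      refine ⟨⟨v, hv, dv⟩, ?_⟩
      obtain ⟨t, ht, dt⟩ := hv.exists_add (isXRep_genericPoint (W := W) (k := k)) (u := u) (by
        rw [succ_nsmul, add_sub_cancel_right]; exact hu)
      refine ⟨t, by rw [succ_nsmul]; exact ht, ?_⟩
      rw [du, dv, h1] at dt
      have : (n + 1 + 1) ^ 2 + n ^ 2 = 2 * ((n + 1) ^ 2 + 1) := by ring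
      omega
  exact (key n).1

/-- A relation between the `x`-coordinate and elements of the local ring specializes. -/
lemma ReducesTo.xRep_cross {R B F k : Type*} [CommRing R] [CommRing B] [IsLocalRing B] [Field F]
    [Field k] [Algebra R B] [Algebra R F] [Algebra R k] [DecidableEq F] [DecidableEq k]
    {W : WeierstrassCurve R} {f : B →ₐ[R] F} {g : B →ₐ[R] k} [IsLocalHom g]
    (hf : Function.Injective f) {P : (W.baseChange F).toAffine.Point}
    {Q : (W.baseChange k).toAffine.Point} (h : ReducesTo W f g P Q) {a b : B}
    (hab : f a * P.xRep 1 = f b * P.xRep 0) : g a * Q.xRep 1 = g b * Q.xRep 0 := by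
  rcases h.cases with ⟨rfl, z, w, hz, hw, hr⟩ | ⟨x, y, h, h', rfl, rfl⟩
  · obtain ⟨c, hc, rfl⟩ := exists_eq_cube_mul hf hz hw hr
    suffices g b = 0 by simp [this]
    suffices b = a * z ^ 2 * c by simp [this, hz]
    apply hf
    rcases hr with ⟨rfl, h0, -⟩ | ⟨x', y', h', rfl, h2, h0, h1⟩
    · simp only [Affine.Point.xRep_zero, Matrix.cons_val_zero, Matrix.cons_val_one, mul_zero,
        mul_one] at hab
      have h0' : f z = 0 := h0
      rw [map_mul, map_mul, map_pow, h0', ← hab]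
      ring
    · simp only [Affine.Point.xRep_some, Matrix.cons_val_zero, Matrix.cons_val_one, mul_one] at hab
      have h2' : f (z ^ 3 * c) ≠ 0 := h2
      have h0' : f z = x' * f (z ^ 3 * c) := h0
      rw [map_mul, map_pow] at h2' h0'
      have hz0 : f z ≠ 0 := by rintro e; simp [e] at h2'
      have h3 : 1 = x' * f z ^ 2 * f c := mul_left_cancel₀ hz0 (by linear_combination h0')
      rw [map_mul, map_mul, map_pow, hab]
      linear_combination f b * h3
  · simp at hab ⊢
    rw [← map_mul] at hab
    rw [hf hab, map_mul]

end MultiplicationMap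

end WeierstrassCurve

/-! ### Fibres of a rational function on the line. -/

section Pencils

open Polynomial

variable {k : Type*} [Field k]

/-- The fibre over c drops in degree only if c is the ratio of the two top coefficients, which are
not both zero; this is the value at infinity. -/
lemma subsingleton_setOf_coeff_eq_zero {v : Fin 2 → k[X]} (hv : v ≠ 0) :
    {c | (v 0 - C c * v 1).coeff (maxDeg v) = 0}.Subsingleton := by
  obtain ⟨i, hi⟩ := exists_coeff_maxDeg_ne_zero hv
  intro c hc d hd
  simp only [Set.mem_ofPred_eq, coeff_sub, coeff_C_mul, sub_eq_zero] at hc hd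
  by_cases h1 : (v 1).coeff (maxDeg v) = 0
  · exfalso
    rw [h1, mul_zero] at hc
    fin_cases i
    exacts [hi hc, hi h1]
  · exact mul_right_cancel₀ h1 (hc.symm.trans hd)

lemma natDegree_pencil {v : Fin 2 → k[X]} {c : k}
    (hc : (v 0 - C c * v 1).coeff (maxDeg v) ≠ 0) : (v 0 - C c * v 1).natDegree = maxDeg v :=
  le_antisymm ((natDegree_sub_le _ _).trans (max_le (natDegree_le_maxDeg v 0)
    ((natDegree_C_mul_le _ _).trans (natDegree_le_maxDeg v 1)))) (le_natDegree_of_ne_zero hc)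

lemma exists_root_pencil [IsAlgClosed k] {v : Fin 2 → k[X]} (hd : maxDeg v ≠ 0) {c : k}
    (hc : (v 0 - C c * v 1).coeff (maxDeg v) ≠ 0) : ∃ x, (v 0).eval x = c * (v 1).eval x := by
  have h := natDegree_pencil hc
  obtain ⟨x, hx⟩ := IsAlgClosed.exists_root (v 0 - C c * v 1) (fun h0 => hd (by
    rw [← h, natDegree_eq_zero_iff_degree_le_zero, h0]))
  refine ⟨x, ?_⟩
  simpa [sub_eq_zero] using hx

lemma IsPrimitiveVec.not_isRoot {v : Fin 2 → k[X]} (hv : IsPrimitiveVec v) {x : k}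
    (h0 : (v 0).eval x = 0) : (v 1).eval x ≠ 0 := by
  intro h1
  obtain ⟨a, b, h⟩ := isPrimitiveVec_two.1 hv
  simpa [h0, h1] using congrArg (eval x) h

/-- A nonconstant rational function of degree at least two is not injective. -/
lemma exists_two_roots [IsAlgClosed k] [CharZero k] {v : Fin 2 → k[X]} (hv : IsPrimitiveVec v)
    (hd : 2 ≤ maxDeg v) : ∃ c x y : k, x ≠ y ∧ (v 0).eval x = c * (v 1).eval x ∧
      (v 0).eval y = c * (v 1).eval y := by
  by_contra! H
  -- The Wronskian. If all fibres were single points, each fibre of full degree would be a multiple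
  -- root and hence a zero of D. Infinitely many fibres force D = 0, and then coprimality and
  -- characteristic zero make both polynomials constant.
  set D : k[X] := derivative (v 0) * v 1 - v 0 * derivative (v 1) with hD
  have key : ∀ c, (v 0 - C c * v 1).coeff (maxDeg v) ≠ 0 →
      ∃ x, (v 0).eval x = c * (v 1).eval x ∧ D.eval x = 0 := by
    intro c hc
    obtain ⟨x, hx⟩ := exists_root_pencil (by omega) hc
    refine ⟨x, hx, ?_⟩
    obtain ⟨h, hh⟩ : X - C x ∣ v 0 - C c * v 1 := by
      rw [dvd_iff_isRoot]; simp [hx]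
    have hdeg := natDegree_pencil hc
    have h0 : h ≠ 0 := by
      rintro rfl
      rw [hh] at hdeg
      simp at hdeg
      omega
    rw [hh, natDegree_mul (X_sub_C_ne_zero x) h0, natDegree_X_sub_C] at hdeg
    obtain ⟨y, hy⟩ := IsAlgClosed.exists_root h (fun e => by
      have := natDegree_eq_zero_iff_degree_le_zero.2 e.le
      omega)
    have hxy : x = y := by
      by_contra hne
      refine H c x y hne hx ?_
      have := congrArg (eval y) hh
      rw [eval_mul, hy.eq_zero, mul_zero] at this
      simpa [sub_eq_zero] using this
    subst hxy
    have h1 := congrArg (fun q => eval x (derivative q)) hh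
    simp only [derivative_sub, derivative_mul, derivative_C, derivative_X, eval_add, eval_sub,
      eval_mul, eval_C, eval_X, hy.eq_zero, sub_self, zero_mul, zero_add, mul_zero,
      sub_zero, eval_one] at h1
    rw [hD, eval_sub, eval_mul, eval_mul, hx]
    linear_combination (v 1).eval x * h1
  have hD0 : D = 0 := by
    by_contra hD0
    choose! ξ hξ using key
    have hinf : ({c | (v 0 - C c * v 1).coeff (maxDeg v) = 0}ᶜ).Infinite :=
      (subsingleton_setOf_coeff_eq_zero hv.ne_zero).finite.infinite_compl
    refine hinf (Set.Finite.of_finite_image (f := ξ) ((D.rootSet_finite k).subset ?_) ?_)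
    · rintro _ ⟨c, hc, rfl⟩
      rw [mem_rootSet]
      exact ⟨hD0, by simpa [aeval_def, eval₂_eq_eval_map] using (hξ c hc).2⟩
    · intro c hc d hd e
      have h1 := (hξ c hc).1
      have h2 := (hξ d hd).1
      rw [← e] at h2
      refine mul_right_cancel₀ (fun h => ?_) (h1.symm.trans h2)
      rw [h, mul_zero] at h1
      exact hv.not_isRoot h1 h
  rw [hD, sub_eq_zero] at hD0
  have hco := isPrimitiveVec_two.1 hv
  have hg : derivative (v 1) = 0 := by
    by_contra hg
    have : v 1 ∣ derivative (v 1) := hco.symm.dvd_of_dvd_mul_left ⟨derivative (v 0), by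
      rw [← hD0]; ring⟩
    have h1 := natDegree_le_of_dvd this hg
    have h2 := natDegree_derivative_lt (p := v 1) (fun h => hg (by
      rw [eq_C_of_natDegree_eq_zero h, derivative_C]))
    omega
  have hf : derivative (v 0) = 0 := by
    by_contra hf
    have : v 0 ∣ derivative (v 0) := hco.dvd_of_dvd_mul_right ⟨derivative (v 1), hD0⟩
    have h1 := natDegree_le_of_dvd this hf
    have h2 := natDegree_derivative_lt (p := v 0) (fun h => hf (by
      rw [eq_C_of_natDegree_eq_zero h, derivative_C]))
    omega
  have hz : maxDeg v ≤ 0 := by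
    refine Finset.sup_le fun i _ => ?_
    fin_cases i
    · exact (derivative_eq_zero.1 hf).le
    · exact (derivative_eq_zero.1 hg).le
  omega

end Pencils

namespace WeierstrassCurve

/-! ### Torsion and divisibility in characteristic zero. -/

section Torsion

set_option linter.unusedSectionVars false

open Polynomial

variable {R k : Type*} [CommRing R] [Field k] [Algebra R k] [DecidableEq k] {W : WeierstrassCurve R}
  [(W.baseChange k).IsElliptic]

/-- Multiplication by `n` on `x`-coordinates is a rational function of degree `n ^ 2`. -/
lemma exists_nsmul_xRep (n : ℕ) : ∃ v : Fin 2 → k[X], IsPrimitiveVec v ∧ maxDeg v = n ^ 2 ∧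
    ∀ x y h, (v 0).eval x * (n • (.some x y h : (W.baseChange k).toAffine.Point)).xRep 1 =
      (v 1).eval x * (n • (.some x y h : (W.baseChange k).toAffine.Point)).xRep 0 := by
  classical
  let F := FractionRing (W.CoordRing k)
  obtain ⟨v, ⟨hv, c, hc, hcv⟩, hd⟩ := exists_isXRep_nsmul (W := W) (k := k) (F := F) n
  refine ⟨v, hv, hd, fun x y h => ?_⟩
  have h1 := ((reducesTo_genericPoint F h).nsmul (embLocalization_injective _ _ _) n).xRep_cross
    (embLocalization_injective _ _ _) (a := algebraMap (W.CoordRing k) _ (AdjoinRoot.of _ (v 0)))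
    (b := algebraMap (W.CoordRing k) _ (AdjoinRoot.of _ (v 1))) (by
      rw [embLocalization_algebraMap, embLocalization_algebraMap]
      change polyHom k W F (v 0) * _ = polyHom k W F (v 1) * _
      rw [hcv, hcv]; ring)
  rw [evalLocalization_algebraMap, evalLocalization_algebraMap] at h1
  change evalAt h.1 _ * _ = evalAt h.1 _ * _ at h1
  rw [evalAt_of, evalAt_of] at h1
  exact h1

lemma exists_point_of_x [IsAlgClosed k] (x : k) :
    ∃ y, (W.baseChange k).toAffine.Nonsingular x y := by
  set V := W.baseChange k
  obtain ⟨y, hy⟩ := IsAlgClosed.exists_root (X ^ 2 + C (V.a₁ * x + V.a₃) * X +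
    C (-(x ^ 3 + V.a₂ * x ^ 2 + V.a₄ * x + V.a₆))) (by
      have : (X ^ 2 + C (V.a₁ * x + V.a₃) * X +
        C (-(x ^ 3 + V.a₂ * x ^ 2 + V.a₄ * x + V.a₆)) : k[X]).degree = 2 := by
          have := degree_quadratic (R := k) (a := 1) (b := V.a₁ * x + V.a₃)
            (c := -(x ^ 3 + V.a₂ * x ^ 2 + V.a₄ * x + V.a₆)) one_ne_zero
          rwa [C_1, one_mul] at this
      rw [this]; decide)
  refine ⟨y, Affine.equation_iff_nonsingular.1 ((Affine.equation_iff' _ _).2 ?_)⟩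
  simp only [IsRoot, eval_add, eval_mul, eval_pow, eval_X, eval_C] at hy
  linear_combination hy

lemma xRep_eq_of_eval {v : Fin 2 → k[X]} (hv : IsPrimitiveVec v) {c x : k}
    {Q : (W.baseChange k).toAffine.Point} (hx : (v 0).eval x = c * (v 1).eval x)
    (h : (v 0).eval x * Q.xRep 1 = (v 1).eval x * Q.xRep 0) : Q.xRep = ![c, 1] := by
  have h1 : (v 1).eval x ≠ 0 := fun h1 => hv.not_isRoot (by rw [hx, h1, mul_zero]) h1
  rw [hx] at h
  have h2 : c * Q.xRep 1 = Q.xRep 0 := mul_left_cancel₀ h1 (by linear_combination h)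
  rcases Q with _ | ⟨X, Y, hXY⟩
  · change c * (0 : (W.baseChange k).toAffine.Point).xRep 1 =
      (0 : (W.baseChange k).toAffine.Point).xRep 0 at h2
    simp at h2
  · simpa using h2.symm

variable [IsAlgClosed k] [CharZero k]

/-- The degree n² is at least 2, so two points with different abscissas have n-multiples equal up to
sign; their difference or sum is the desired torsion point. -/
lemma exists_nsmul_eq_zero {n : ℕ} (hn : 2 ≤ n) :
    ∃ P : (W.baseChange k).toAffine.Point, P ≠ 0 ∧ n • P = 0 := by
  obtain ⟨v, hv, hd, h⟩ := exists_nsmul_xRep (W := W) (k := k) n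
  obtain ⟨c, x, y, hxy, hx, hy⟩ := exists_two_roots hv (by rw [hd]; nlinarith)
  obtain ⟨x', hx'⟩ := exists_point_of_x (W := W) x
  obtain ⟨y', hy'⟩ := exists_point_of_x (W := W) y
  have h1 := xRep_eq_of_eval hv hx (h x x' hx')
  have h2 := xRep_eq_of_eval hv hy (h y y' hy')
  rcases Affine.Point.eq_or_eq_neg_of_xRep_eq_xRep (h1.trans h2.symm) with e | e
  · refine ⟨.some x x' hx' - .some y y' hy', fun e' => hxy ?_, by rw [smul_sub, e, sub_self]⟩
    simpa using congrFun (congrArg Affine.Point.xRep (sub_eq_zero.1 e')) 0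
  · refine ⟨.some x x' hx' + .some y y' hy', fun e' => hxy ?_, by
      rw [smul_add, e, neg_add_cancel]⟩
    have := congrFun (congrArg Affine.Point.xRep (add_eq_zero_iff_eq_neg.1 e')) 0
    rw [Affine.Point.xRep_neg] at this
    simpa using this

/-- Multiplication by `n` has finite kernel. -/
lemma finite_setOf_nsmul_eq_zero {n : ℕ} {P : (W.baseChange k).toAffine.Point} (hP : n • P ≠ 0) :
    {Q : (W.baseChange k).toAffine.Point | n • Q = 0}.Finite := by
  by_contra hinf
  -- The identity is the Frobenius of exponent 1, and the polynomial is the constant n.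
  have := aeval_pointEnd_eq_zero_of_infinite (W := W) 1 0 (AlgHom.id R k) (by simp) (n : ℤ[X])
    (by simpa using hinf) P
  exact hP (by simpa using this)

/-- Multiplication by `n` is surjective. -/
lemma exists_nsmul_eq {n : ℕ} (hn : n ≠ 0) {P : (W.baseChange k).toAffine.Point}
    (hP : ∀ n, 0 < n → n • P ≠ 0) (Q : (W.baseChange k).toAffine.Point) : ∃ Q', n • Q' = Q := by
  obtain ⟨v, hv, hd, h⟩ := exists_nsmul_xRep (W := W) (k := k) n
  set H := (nsmulAddMonoidHom n : (W.baseChange k).toAffine.Point →+ _).range with hH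
  -- Only a point over the single abscissa where the fibre drops in degree can be missed.
  have hfin : ((H : Set (W.baseChange k).toAffine.Point)ᶜ).Finite := by
    refine (finite_setOf_xRep_mem (((subsingleton_setOf_coeff_eq_zero hv.ne_zero).finite.image
      fun c => ![c, 1]))).subset fun Q hQ => ?_
    rcases Q with _ | ⟨c, d, hcd⟩
    · exact absurd (zero_mem H) hQ
    · refine ⟨c, ?_, by simp⟩
      by_contra hc
      obtain ⟨x, hx⟩ := exists_root_pencil (by rw [hd]; positivity) hc
      obtain ⟨x', hx'⟩ := exists_point_of_x (W := W) x
      have h1 := xRep_eq_of_eval hv hx (h x x' hx')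
      rw [← Affine.Point.xRep_some hcd] at h1
      rcases Affine.Point.eq_or_eq_neg_of_xRep_eq_xRep h1 with e | e
      · exact hQ ⟨_, e⟩
      · exact hQ ⟨-.some x x' hx', by rw [map_neg]; exact neg_eq_iff_eq_neg.2 e⟩
  by_contra hQ
  -- If Q were missed, so would be its translates by n • (m • P), which are infinitely many as P is
  -- nontorsion.
  have hinj : Function.Injective fun m : ℕ => Q + n • (m • P) := by
    intro a b hab
    simp only [add_right_inj] at hab
    by_contra hne
    wlog hlt : a < b generalizing a b
    · exact this hab.symm (Ne.symm hne) (by omega)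
    obtain ⟨d, rfl⟩ := Nat.exists_eq_add_of_lt hlt
    refine hP (n * (d + 1)) (Nat.mul_pos (by omega) (by omega)) ?_
    rw [add_assoc, add_smul, smul_add] at hab
    rw [mul_smul]
    exact left_eq_add.1 hab
  refine Set.infinite_range_of_injective hinj (hfin.subset ?_)
  rintro _ ⟨m, rfl⟩ ⟨Q', hQ'⟩
  refine hQ ⟨Q' - m • P, ?_⟩
  rw [smul_sub, sub_eq_iff_eq_add]
  exact hQ'

end Torsion

end WeierstrassCurve

/-! ### Linear algebra on the Tate module. -/

section TateModule

variable {ℓ : ℕ} {A : Type*} [AddCommGroup A] [Fact ℓ.Prime]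

lemma TateModule.ext {s t : TateModule ℓ A} (h : ∀ n, s.1 n = t.1 n) : s = t :=
  Subtype.ext (funext h)

lemma TateModule.pow_smul_apply (t : TateModule ℓ A) (m n : ℕ) :
    ℓ ^ m • t.1 (n + m) = t.1 n := by
  induction m with
  | zero => simp
  | succ m ih => rw [pow_succ, mul_smul, ← add_assoc, t.2.2, ih]

lemma TateModule.natCast_smul_apply (c : ℕ) (t : TateModule ℓ A) (n : ℕ) :
    ((c : ℤ_[ℓ]) • t).1 n = c • t.1 n := by
  rw [Nat.cast_smul_eq_nsmul]; rfl

lemma TateModule.ker_apply_one (t : TateModule ℓ A) (h : t.1 1 = 0) :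
    ∃ s : TateModule ℓ A, (ℓ : ℤ_[ℓ]) • s = t := by
  refine ⟨⟨fun n => t.1 (n + 1), h, fun n => t.2.2 (n + 1)⟩, TateModule.ext fun n => ?_⟩
  rw [TateModule.natCast_smul_apply]
  exact t.2.2 n

/-- A nonzero scalar is a unit times ℓ^m, and the n-th entry of a sequence is ℓ^m times its (n+m)-th
entry, so ℓ^m kills only zero. -/
instance : Module.IsTorsionFree ℤ_[ℓ] (TateModule ℓ A) := by
  refine .of_smul_eq_zero fun c t h => ?_
  by_contra! hne
  obtain ⟨hc, ht⟩ := hne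
  rw [PadicInt.unitCoeff_spec hc, mul_smul] at h
  have h1 := congrArg (fun s => (↑(PadicInt.unitCoeff hc)⁻¹ : ℤ_[ℓ]) • s) h
  rw [smul_smul, Units.inv_mul, one_smul, smul_zero] at h1
  refine ht (TateModule.ext fun n => ?_)
  have h2 := congrArg (fun s : TateModule ℓ A => s.1 (n + c.valuation)) h1
  simp only [← Nat.cast_pow] at h2
  rw [TateModule.natCast_smul_apply, TateModule.pow_smul_apply] at h2
  exact h2

lemma TateModule.smul_apply_eq {c d : ℤ_[ℓ]} {n : ℕ}
    (h : c - d ∈ Ideal.span {(ℓ : ℤ_[ℓ]) ^ n}) (t : TateModule ℓ A) :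
    (c • t).1 n = (d • t).1 n := by
  obtain ⟨e, he⟩ := Ideal.mem_span_singleton.1 h
  rw [sub_eq_iff_eq_add.1 he, add_smul, mul_smul, ← Nat.cast_pow]
  change ((((ℓ ^ n : ℕ) : ℤ_[ℓ]) • e • t).1 n + (d • t).1 n) = _
  rw [TateModule.natCast_smul_apply, TateModule.pow_smul, zero_add]

lemma TateModule.coe_sum {ι : Type*} (s : Finset ι) (f : ι → TateModule ℓ A) (n : ℕ) :
    (∑ i ∈ s, f i).1 n = ∑ i ∈ s, (f i).1 n := by
  rw [AddSubgroup.val_finsetSum, Finset.sum_apply]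

/-- The Tate module is finitely generated when the `ℓ`-torsion is finite. -/
theorem TateModule.finite (hA : {a : A | ℓ • a = 0}.Finite) :
    Module.Finite ℤ_[ℓ] (TateModule ℓ A) := by
  classical
  set S := hA.toFinset with hS
  have hmem : ∀ t : TateModule ℓ A, t.1 1 ∈ S := fun t => by
    have := TateModule.pow_smul t 1
    rw [hS, Set.Finite.mem_toFinset]
    simpa using this
  -- Successive approximation: t minus the chosen lift of its first entry is divisible by ℓ. As the
  -- lift depends only on that entry, the resulting ℓ-adic expansion involves finitely many vectors.
  let L : A → TateModule ℓ A := fun a => if h : ∃ t : TateModule ℓ A, t.1 1 = a then h.choose else 0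
  have hL : ∀ t : TateModule ℓ A, (L (t.1 1)).1 1 = t.1 1 := fun t => by
    have h : ∃ s : TateModule ℓ A, s.1 1 = t.1 1 := ⟨t, rfl⟩
    simp only [L, dif_pos h]
    exact h.choose_spec
  have hD : ∀ t : TateModule ℓ A, ∃ s, t = L (t.1 1) + (ℓ : ℤ_[ℓ]) • s := fun t => by
    obtain ⟨s, hs⟩ := TateModule.ker_apply_one (t - L (t.1 1)) (by
      change t.1 1 - (L (t.1 1)).1 1 = 0
      rw [hL, sub_self])
    exact ⟨s, by rw [hs]; abel⟩
  choose D hD using hD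
  refine ⟨⟨S.image L, ?_⟩⟩
  rw [eq_top_iff]
  rintro t -
  set u : ℕ → TateModule ℓ A := fun j => D^[j] t with hu
  have hu1 : ∀ n, t = ∑ j ∈ Finset.range n, (ℓ : ℤ_[ℓ]) ^ j • L ((u j).1 1) +
      (ℓ : ℤ_[ℓ]) ^ n • u n := by
    intro n
    induction n with
    | zero => simp [hu]
    | succ n ih =>
      rw [Finset.sum_range_succ, add_assoc, pow_succ, mul_smul, ← smul_add]
      have : u (n + 1) = D (u n) := Function.iterate_succ_apply' D n t
      rw [this, ← hD]
      exact ih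
  -- The coefficient of L a collects the powers ℓ^j for which the j-th digit is a; these partial
  -- sums converge in ℤ_ℓ.
  set c : A → ℕ → ℤ_[ℓ] := fun a n =>
    ∑ j ∈ Finset.range n, if (u j).1 1 = a then (ℓ : ℤ_[ℓ]) ^ j else 0 with hc
  have hprec : ∀ a, ∃ x : ℤ_[ℓ], ∀ n, c a n - x ∈ Ideal.span {(ℓ : ℤ_[ℓ]) ^ n} := by
    intro a
    have := IsPrecomplete.prec' (I := IsLocalRing.maximalIdeal ℤ_[ℓ]) (M := ℤ_[ℓ]) (c a) (by
      intro m n hmn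
      rw [PadicInt.maximalIdeal_eq_span_p, Ideal.span_singleton_pow, smul_eq_mul, Ideal.mul_top,
        SModEq.comm, SModEq.sub_mem]
      simp only [hc]
      rw [← Finset.sum_range_add_sum_Ico _ hmn, add_sub_cancel_left]
      refine sum_mem fun j hj => ?_
      split_ifs
      · exact Ideal.mem_span_singleton.2 (pow_dvd_pow _ (Finset.mem_Ico.1 hj).1)
      · exact zero_mem _)
    obtain ⟨x, hx⟩ := this
    refine ⟨x, fun n => ?_⟩
    have := hx n
    rwa [PadicInt.maximalIdeal_eq_span_p, Ideal.span_singleton_pow, smul_eq_mul, Ideal.mul_top,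
      SModEq.sub_mem] at this
  choose x hx using hprec
  have ht : t = ∑ a ∈ S, x a • L a := by
    refine TateModule.ext fun n => ?_
    rw [TateModule.coe_sum]
    rw [Finset.sum_congr rfl fun a _ => (TateModule.smul_apply_eq (hx a n) (L a)).symm]
    conv_lhs => rw [hu1 n]
    rw [← TateModule.coe_sum]
    change (∑ j ∈ Finset.range n, (ℓ : ℤ_[ℓ]) ^ j • L ((u j).1 1)).1 n +
      ((ℓ : ℤ_[ℓ]) ^ n • u n).1 n = _
    rw [← Nat.cast_pow, TateModule.natCast_smul_apply, TateModule.pow_smul, add_zero]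
    refine congrArg (fun s : TateModule ℓ A => s.1 n) ?_
    simp only [hc, Finset.sum_smul, ite_smul, zero_smul]
    rw [Finset.sum_comm]
    refine Finset.sum_congr rfl fun j _ => ?_
    rw [Finset.sum_ite_eq, if_pos (hmem _)]
  rw [ht]
  exact sum_mem fun a ha => Submodule.smul_mem _ _ (Submodule.subset_span
    (Finset.mem_coe.2 (Finset.mem_image_of_mem L ha)))

-- Extending the basis to ℤ_ℓ[X] turns X - f into the characteristic matrix, which makes
-- Cayley–Hamilton and eigenvectors available.
open TensorProduct in
lemma TateModule.charpoly_eq [Module.Finite ℤ_[ℓ] (TateModule ℓ A)] {ι : Type*} [Fintype ι]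
    [DecidableEq ι] (b : Module.Basis ι ℤ_[ℓ] (TateModule ℓ A)) (f : AddMonoid.End A) :
    TateModule.charpoly ℓ f = (LinearMap.toMatrix b b (TateModule.map ℓ f)).charpoly := by
  set B := Algebra.TensorProduct.basis ℤ_[ℓ][X] b
  rw [TateModule.charpoly, ← LinearMap.det_toMatrix B, Matrix.charpoly]
  congr 1
  have h1 : LinearMap.toMatrix B B ((Polynomial.X : ℤ_[ℓ][X]) • LinearMap.id -
      (TateModule.map ℓ f).baseChange ℤ_[ℓ][X]) = (Polynomial.X : ℤ_[ℓ][X]) • 1 -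
      LinearMap.toMatrix B B ((TateModule.map ℓ f).baseChange ℤ_[ℓ][X]) := by
    rw [← LinearMap.toMatrix_id B]
    ext1 i j
    simp only [LinearMap.toMatrix_apply, LinearMap.sub_apply, LinearMap.smul_apply, map_sub,
      map_smul, Matrix.sub_apply, Matrix.smul_apply, Finsupp.coe_sub, Finsupp.coe_smul,
      Pi.sub_apply, Pi.smul_apply]
  rw [h1, LinearMap.toMatrix_baseChange, Matrix.charmatrix]
  congr 1
  ext i j
  simp [Matrix.diagonal_apply, Matrix.one_apply]

lemma TateModule.aeval_map_apply (f : AddMonoid.End A) (Φ : ℤ[X]) (t : TateModule ℓ A) (n : ℕ) :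
    (Polynomial.aeval (TateModule.map ℓ f) Φ t).1 n = Polynomial.aeval f Φ (t.1 n) := by
  induction Φ using Polynomial.induction_on' with
  | add p q hp hq =>
    rw [map_add, map_add]
    exact congrArg₂ (· + ·) hp hq
  | monomial m a =>
    have hm : ∀ m, ((TateModule.map ℓ f ^ m) t).1 n = (f ^ m) (t.1 n) := by
      intro m
      induction m with
      | zero => rfl
      | succ m ih =>
        rw [pow_succ', pow_succ']
        change f (((TateModule.map ℓ f ^ m) t).1 n) = f ((f ^ m) (t.1 n))
        rw [ih]
    rw [Polynomial.aeval_monomial, Polynomial.aeval_monomial, ← Algebra.smul_def,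
      ← Algebra.smul_def]
    change a • ((TateModule.map ℓ f ^ m) t).1 n = a • (f ^ m) (t.1 n)
    rw [hm]

variable [Module.Finite ℤ_[ℓ] (TateModule ℓ A)] {f : AddMonoid.End A} {Φ : ℤ[X]}

/-- The Cayley–Hamilton theorem on the Tate module. -/
lemma TateModule.aeval_eq_zero (hΦ : Φ.map (Int.castRingHom ℤ_[ℓ]) = TateModule.charpoly ℓ f)
    (t : TateModule ℓ A) (n : ℕ) : Polynomial.aeval f Φ (t.1 n) = 0 := by
  let b := Module.Free.chooseBasis ℤ_[ℓ] (TateModule ℓ A)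
  rw [TateModule.charpoly_eq b, LinearMap.charpoly_toMatrix] at hΦ
  rw [← TateModule.aeval_map_apply]
  have h := LinearMap.aeval_self_charpoly (TateModule.map ℓ f)
  rw [← hΦ] at h
  have h2 : Polynomial.aeval (TateModule.map ℓ f) Φ = 0 := by
    rw [← h, ← algebraMap_int_eq, Polynomial.aeval_map_algebraMap]
  rw [h2]
  rfl

/-- If the characteristic polynomial has a common factor with `X ^ N - 1`, then the `N`-th power
of the endomorphism has a nonzero fixed vector. -/
lemma TateModule.exists_fixed {N : ℕ}
    (hΦ : Φ.map (Int.castRingHom ℤ_[ℓ]) = TateModule.charpoly ℓ f)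
    (h : ¬ IsCoprime (Φ.map (Int.castRingHom ℚ)) (Polynomial.X ^ N - 1)) :
    ∃ t : TateModule ℓ A, t ≠ 0 ∧ ∀ n, (f ^ N) (t.1 n) = t.1 n := by
  -- A common root z is an eigenvalue with z^N = 1, so the matrix of f^N - 1 is singular over Ω. Its
  -- determinant then vanishes in ℤ_ℓ already, which yields a kernel vector there.
  let Ω := AlgebraicClosure ℚ_[ℓ]
  replace h := mt (Polynomial.isCoprime_iff_aeval_ne_zero_of_isAlgClosed ℚ Ω _ _).2 h
  push Not at h
  obtain ⟨z, hz1, hz2⟩ := h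
  let b := Module.Free.chooseBasis ℤ_[ℓ] (TateModule ℓ A)
  set M := LinearMap.toMatrix b b (TateModule.map ℓ f) with hM
  have hinj : Function.Injective (algebraMap ℤ_[ℓ] Ω) := by
    rw [IsScalarTower.algebraMap_eq ℤ_[ℓ] ℚ_[ℓ] Ω]
    exact (algebraMap ℚ_[ℓ] Ω).injective.comp (IsFractionRing.injective ℤ_[ℓ] ℚ_[ℓ])
  have hroot : (M.map (algebraMap ℤ_[ℓ] Ω)).charpoly.eval z = 0 := by
    have e := Matrix.charpoly_map M (algebraMap ℤ_[ℓ] Ω)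
    rw [e, hM, ← TateModule.charpoly_eq, ← hΦ, Polynomial.map_map]
    rw [Polynomial.aeval_def, Polynomial.eval₂_map] at hz1
    rw [Polynomial.eval_map, ← hz1]
    congr 1
  rw [Matrix.eval_charpoly] at hroot
  obtain ⟨w, hw0, hw⟩ := Matrix.exists_mulVec_eq_zero_iff.2 hroot
  rw [Matrix.sub_mulVec, sub_eq_zero] at hw
  set M' := M.map (algebraMap ℤ_[ℓ] Ω) with hM'
  have hw1 : ∀ n, (M' ^ n).mulVec w = z ^ n • w := by
    intro n
    induction n with
    | zero => simp
    | succ n ih =>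
      rw [pow_succ, ← Matrix.mulVec_mulVec, ← hw, Matrix.scalar_apply, ← Matrix.smul_one_eq_diagonal,
        Matrix.smul_mulVec, Matrix.one_mulVec, Matrix.mulVec_smul, ih, smul_smul, pow_succ']
  have hzN : z ^ N = 1 := by
    simpa [sub_eq_zero] using hz2
  have hdet : (M ^ N - 1).det = 0 := by
    apply hinj
    rw [map_zero, RingHom.map_det]
    refine Matrix.exists_mulVec_eq_zero_iff.1 ⟨w, hw0, ?_⟩
    rw [map_sub, map_pow, map_one, RingHom.mapMatrix_apply, Matrix.sub_mulVec, Matrix.one_mulVec,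
      hw1, hzN, one_smul, sub_self]
  obtain ⟨y, hy0, hy⟩ := Matrix.exists_mulVec_eq_zero_iff.2 hdet
  rw [Matrix.sub_mulVec, Matrix.one_mulVec, sub_eq_zero] at hy
  refine ⟨b.equivFun.symm y, (LinearEquiv.map_ne_zero_iff _).2 hy0, fun n => ?_⟩
  have h1 : (TateModule.map ℓ f ^ N) (b.equivFun.symm y) = b.equivFun.symm y := by
    apply b.equivFun.injective
    have h2 := LinearMap.toMatrix_mulVec_repr b b (TateModule.map ℓ f ^ N) (b.equivFun.symm y)
    rw [← LinearMap.toMatrix_pow] at h2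
    have h3 : (⇑(b.repr (b.equivFun.symm y)) : _ → ℤ_[ℓ]) = y := by
      rw [← b.equivFun_apply, LinearEquiv.apply_symm_apply]
    rw [h3, hy] at h2
    rw [LinearEquiv.apply_symm_apply, b.equivFun_apply]
    exact h2.symm
  have h4 := TateModule.aeval_map_apply f (Polynomial.X ^ N) (b.equivFun.symm y) n
  simp only [map_pow, Polynomial.aeval_X] at h4
  rw [← h4, h1]

end TateModule

section TateModule

variable {ℓ : ℕ} {A : Type*} [AddCommGroup A]

/-- If entries n < m agreed, ℓ^n would kill the m-th entry, hence so would ℓ^(m-1), and ℓ^(m-1)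
times that entry is the first one. -/
lemma TateModule.injective_of_apply_one_ne_zero {t : ℕ → A} (ht : t ∈ TateModule ℓ A)
    (h : t 1 ≠ 0) : Function.Injective t := by
  intro n m hnm
  by_contra hne
  wlog hlt : n < m generalizing n m
  · exact this hnm.symm (Ne.symm hne) (by omega)
  obtain ⟨d, rfl⟩ := Nat.exists_eq_add_of_lt hlt
  have hpow : ∀ j i, ℓ ^ j • t (i + j) = t i := by
    intro j
    induction j with
    | zero => simp
    | succ j ih => intro i; rw [pow_succ, mul_smul, ← add_assoc, ht.2, ih]
  refine h ?_
  have h1 := hpow (n + d) 1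
  have h2 := TateModule.pow_smul ⟨t, ht⟩ n
  rw [← h1, show 1 + (n + d) = n + d + 1 by ring, ← hnm, add_comm n d, pow_add, mul_smul]
  exact (congrArg (ℓ ^ d • ·) h2).trans (smul_zero _)

lemma TateModule.exists_of_divisible (hA : ∀ a : A, ∃ b, ℓ • b = a) {a : A} (ha : ℓ • a = 0) :
    ∃ t ∈ TateModule ℓ A, t 1 = a := by
  choose d hd using hA
  refine ⟨fun n => Nat.rec 0 (fun n _ => d^[n] a) n, ⟨rfl, fun n => ?_⟩, rfl⟩
  cases n with
  | zero => exact ha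
  | succ n =>
    change ℓ • d^[n + 1] a = d^[n] a
    rw [Function.iterate_succ_apply', hd]

lemma TateModule.exists_shift {t : ℕ → A} (ht : t ∈ TateModule ℓ A) (h : t ≠ 0) :
    ∃ m, (fun n => t (m + n)) ∈ TateModule ℓ A ∧ t (m + 1) ≠ 0 := by
  classical
  have hex : ∃ n, t (n + 1) ≠ 0 := by
    by_contra! hn
    refine h (funext fun n => ?_)
    cases n with
    | zero => exact ht.1
    | succ n => exact hn n
  refine ⟨Nat.find hex, ⟨?_, fun n => ht.2 _⟩, Nat.find_spec hex⟩
  cases hm : Nat.find hex with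
  | zero => exact ht.1
  | succ m =>
    by_contra hne
    exact Nat.find_min hex (m := m) (by omega) hne

end TateModule

namespace WeierstrassCurve

/-! ### Reduction of torsion and the action of Frobenius. -/

section ReductionOfTorsion

set_option linter.unusedSectionVars false

open Polynomial

variable {R B F k : Type*} [CommRing R] [CommRing B] [IsLocalRing B] [Field F] [Field k]
  [Algebra R B] [Algebra R F] [Algebra R k] [DecidableEq F] [DecidableEq k]
  {W : WeierstrassCurve R} {f : B →ₐ[R] F} {g : B →ₐ[R] k} [hg : IsLocalHom g]

lemma ReducesTo.unique (hf : Function.Injective f) {P : (W.baseChange F).toAffine.Point}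
    {Q Q' : (W.baseChange k).toAffine.Point} (h : ReducesTo W f g P Q)
    (h' : ReducesTo W f g P Q') : Q = Q' := by
  have := h.add hf h'.neg
  rw [add_neg_cancel] at this
  exact sub_eq_zero.1 (by rw [sub_eq_add_neg]; exact this.eq_zero)

/-- The kernel of reduction has no torsion prime to the residue characteristic. -/
lemma ReducesTo.eq_zero_of_nsmul (hf : Function.Injective f) {n : ℕ} (hn : (n : k) ≠ 0)
    {P : (W.baseChange F).toAffine.Point} (h : ReducesTo W f g P 0) (hP : n • P = 0) : P = 0 := by
  rcases h.cases with ⟨-, z, w, hz, hw, hr⟩ | ⟨x, y, h, h', -, e⟩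
  swap
  · cases e
  -- The parameter of mP is m z modulo z². For nP = O this gives nz ∈ (z²), so z ≠ 0 would make n a
  -- multiple of z and hence zero in `k`.
  have key : ∀ m : ℕ, ∃ z' w' : B, g z' = 0 ∧ g w' = 0 ∧ IsProjRep (m • P) ![f z', 1, f w'] ∧
      z' - m * z ∈ (Ideal.span {z}) ^ 2 := by
    intro m
    induction m with
    | zero => exact ⟨0, 0, map_zero g, map_zero g, .inl (by simp), by simp⟩
    | succ m ih =>
      obtain ⟨z', w', hz', hw', hr', hI⟩ := ih
      have hzI : z ∈ Ideal.span {z} := Ideal.mem_span_singleton_self z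
      have hz'I : z' ∈ Ideal.span {z} := by
        have := Ideal.pow_le_self two_ne_zero hI
        simpa using add_mem this (Ideal.mul_mem_left _ (m : B) hzI)
      obtain ⟨z'', w'', hz'', hw'', hr'', hI'⟩ :=
        exists_kernel_add hf hz' hw' hz hw hr' hr _ hz'I hzI
      refine ⟨z'', w'', hz'', hw'', by rw [succ_nsmul]; exact hr'', ?_⟩
      have := add_mem hI' hI
      convert this using 1
      push_cast
      ring
  obtain ⟨z', w', -, -, hr', hI⟩ := key n
  rw [hP] at hr'
  have hz' : z' = 0 := by
    apply hf
    rw [map_zero]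
    rcases hr' with ⟨-, h0, -⟩ | ⟨x, y, h, e, -⟩
    · exact h0
    · cases e
  rw [hz', Ideal.span_singleton_pow, Ideal.mem_span_singleton] at hI
  obtain ⟨b, hb⟩ := hI
  have hz0 : z = 0 := by
    by_contra hz0
    have hfz : f z ≠ 0 := fun h => hz0 (hf (h.trans (map_zero f).symm))
    have h1 : (n : B) = -(z * b) := by
      apply hf
      have := congrArg f hb
      simp only [map_sub, map_mul, map_pow, map_zero, map_natCast, map_neg] at this ⊢
      apply mul_left_cancel₀ hfz
      linear_combination -this
    have h2 := congrArg g h1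
    rw [map_natCast, map_neg, map_mul, hz, zero_mul, neg_zero] at h2
    exact hn h2
  obtain ⟨c, -, hc⟩ := exists_eq_cube_mul hf hz hw hr
  rw [hz0] at hc
  rcases hr with ⟨e, -⟩ | ⟨x, y, h, e, h2, -⟩
  · exact e
  · simp [hc] at h2

/-- Every point with coordinates in a subfield whose valuation ring is contained in `B` reduces. -/
lemma exists_reducesTo_of_mem [(W.baseChange k).IsElliptic] (hf : Function.Injective f)
    (v : AbsoluteValue F ℝ) (hv : IsNonarchimedean v) (M : Subfield F)
    (hB : ∀ x ∈ M, v x ≤ 1 → ∃ b, f b = x) (hB' : ∀ b, v (f b) ≤ 1)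
    (hgv : ∀ b, v (f b) < 1 → g b = 0) {x y : F} (h : (W.baseChange F).toAffine.Nonsingular x y)
    (hxM : x ∈ M) (hyM : y ∈ M) : ∃ Q, ReducesTo W f g (.some x y h) Q := by
  have heq := (Affine.equation_iff _ _).1 h.1
  have ha : ∀ r : R, v (algebraMap R F r) ≤ 1 := fun r => by
    rw [← f.commutes]; exact hB' _
  simp only [baseChange, toAffine, map_a₁, map_a₂, map_a₃, map_a₄, map_a₆] at heq
  have hadd : ∀ {a b : F} {M : ℝ}, v a ≤ M → v b ≤ M → v (a + b) ≤ M := fun ha hb =>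
    (hv _ _).trans (max_le ha hb)
  have hsub : ∀ {a b : F} {M : ℝ}, v a ≤ M → v b ≤ M → v (a - b) ≤ M := fun {a b M} ha hb => by
    rw [sub_eq_add_neg]; exact hadd ha (by rwa [v.map_neg])
  have hmul : ∀ (r : R) {a : F} {M : ℝ}, v a ≤ M → v (algebraMap R F r * a) ≤ M := fun r a M h => by
    rw [map_mul]
    exact (mul_le_of_le_one_left (v.nonneg _) (ha r)).trans h
  rcases le_or_gt (v x) 1 with hx | hx
  · have hy : v y ≤ 1 := by
      by_contra! hy
      have e : y ^ 2 = x ^ 3 + algebraMap R F W.a₂ * x ^ 2 + algebraMap R F W.a₄ * x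
          + algebraMap R F W.a₆ - algebraMap R F W.a₁ * (x * y) - algebraMap R F W.a₃ * y := by
        linear_combination heq
      have h1 : v (y ^ 2) ≤ v y := by
        rw [e]
        have hxn : ∀ n, v (x ^ n) ≤ v y := fun n => by
          rw [map_pow]; exact (pow_le_one₀ (v.nonneg _) hx).trans hy.le
        refine hsub (hsub (hadd (hadd (hadd (hxn 3) (hmul _ (hxn 2))) (hmul _ ?_)) ?_) (hmul _ ?_))
          (hmul _ le_rfl)
        · simpa using hxn 1
        · exact (ha _).trans hy.le
        · rw [map_mul]; exact mul_le_of_le_one_left (v.nonneg _) hx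
      rw [map_pow] at h1
      nlinarith
    obtain ⟨a, rfl⟩ := hB x hxM hx
    obtain ⟨b, rfl⟩ := hB y hyM hy
    have hk : (W.baseChange k).toAffine.Equation (g a) (g b) := by
      rw [Affine.equation_iff]
      simp only [baseChange, toAffine, map_a₁, map_a₂, map_a₃, map_a₄, map_a₆]
      have e : b ^ 2 + algebraMap R B W.a₁ * a * b + algebraMap R B W.a₃ * b = a ^ 3 +
          algebraMap R B W.a₂ * a ^ 2 + algebraMap R B W.a₄ * a + algebraMap R B W.a₆ := by
        apply hf
        simpa using heq
      simpa using congrArg g e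
    exact ⟨_, ReducesTo.some h (Affine.equation_iff_nonsingular.1 hk)⟩
  -- When x is not integral the equation forces |x| < |y|, so z = x/y and w = 1/y have absolute
  -- value below 1 and the point reduces to O.
  · have hxy : v x < v y := by
      by_contra! hy
      have e : x ^ 3 = y ^ 2 + algebraMap R F W.a₁ * (x * y) + algebraMap R F W.a₃ * y
          - algebraMap R F W.a₂ * x ^ 2 - algebraMap R F W.a₄ * x - algebraMap R F W.a₆ := by
        linear_combination -heq
      have h2 : v x ≤ v (x ^ 2) := by rw [map_pow]; nlinarith
      have h1 : v (x ^ 3) ≤ v (x ^ 2) := by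
        rw [e]
        refine hsub (hsub (hsub (hadd (hadd ?_ (hmul _ ?_)) (hmul _ (hy.trans h2)))
          (hmul _ le_rfl)) (hmul _ h2)) ((ha _).trans (hx.le.trans h2))
        · rw [map_pow, map_pow]; gcongr
        · rw [map_mul, map_pow, sq]; gcongr
      rw [map_pow, map_pow] at h1
      nlinarith [pow_pos (zero_lt_one.trans hx) 2]
    have hy1 : 1 < v y := hx.trans hxy
    have hy0 : y ≠ 0 := by rintro rfl; rw [map_zero] at hy1; linarith
    have hz1 : v (x / y) < 1 := by rw [map_div₀, div_lt_one (by linarith)]; exact hxy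
    have hw1 : v (1 / y) < 1 := by rw [map_div₀, map_one, div_lt_one (by linarith)]; exact hy1
    obtain ⟨z, hz⟩ := hB _ (div_mem hxM hyM) hz1.le
    obtain ⟨w, hw⟩ := hB _ (div_mem (one_mem M) hyM) hw1.le
    refine ⟨0, ReducesTo.of_kernel (z := z) (w := w) (hgv _ (by rwa [hz])) (hgv _ (by rwa [hw]))
      (.inr ⟨x, y, h, rfl, ?_, ?_, ?_⟩)⟩
    · simpa [hw] using hy0
    · simp [hz, hw]; field_simp
    · simp [hw, hy0]

/-- Every point reduces with respect to a nonarchimedean absolute value. -/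
lemma exists_reducesTo [(W.baseChange k).IsElliptic] (hf : Function.Injective f)
    (v : AbsoluteValue F ℝ) (hv : IsNonarchimedean v)
    (hB : ∀ x, v x ≤ 1 → ∃ b, f b = x) (hB' : ∀ b, v (f b) ≤ 1) (hgv : ∀ b, v (f b) < 1 → g b = 0)
    (P : (W.baseChange F).toAffine.Point) : ∃ Q, ReducesTo W f g P Q := by
  rcases P with _ | ⟨x, y, h⟩
  · exact ⟨0, ReducesTo.zero⟩
  · exact exists_reducesTo_of_mem hf v hv ⊤ (fun x _ => hB x) hB' hgv h trivial trivial

variable {ℓ : ℕ} {sB : B → B} {sF : F →ₐ[R] F} {sk : k →ₐ[R] k}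

/-- Reduction of a sequence in the Tate module. -/
lemma exists_tateModule_reduction (hf : Function.Injective f) (hℓ : (ℓ : k) ≠ 0)
    (hred : ∀ P : (W.baseChange F).toAffine.Point, ∃ Q, ReducesTo W f g P Q)
    {t : ℕ → (W.baseChange F).toAffine.Point} (ht : t ∈ TateModule ℓ _) (h1 : t 1 ≠ 0) :
    ∃ t' : ℕ → (W.baseChange k).toAffine.Point, Function.Injective t' ∧
      ∀ n, ReducesTo W f g (t n) (t' n) := by
  choose r hr using hred
  have hmem : (fun n => r (t n)) ∈ TateModule ℓ (W.baseChange k).toAffine.Point := by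
    refine ⟨?_, fun n => ?_⟩
    · have := hr (t 0)
      rw [ht.1] at this
      change r (t 0) = 0
      rw [ht.1]
      exact this.eq_zero
    · have := (hr (t (n + 1))).nsmul hf ℓ
      rw [ht.2] at this
      exact this.unique hf (hr _)
  refine ⟨_, TateModule.injective_of_apply_one_ne_zero hmem fun h0 => h1 ?_, fun n => hr _⟩
  have := hr (t 1)
  rw [h0] at this
  have h2 := TateModule.pow_smul ⟨t, ht⟩ 1
  rw [pow_one] at h2
  exact this.eq_zero_of_nsmul hf hℓ h2

variable [Fact ℓ.Prime] [IsAlgClosed F] [CharZero F] [(W.baseChange F).IsElliptic]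
  [(W.baseChange k).IsElliptic] {p n : ℕ}

/-- The characteristic polynomial of a lift of Frobenius annihilates the reduced curve. -/
theorem aeval_pointEnd_eq_zero_of_charpoly [ExpChar k p] (hf : Function.Injective f)
    (hℓ : (ℓ : k) ≠ 0) (hred : ∀ P : (W.baseChange F).toAffine.Point, ∃ Q, ReducesTo W f g P Q)
    (hsF : ∀ b, f (sB b) = sF (f b)) (hsk : ∀ b, g (sB b) = sk (g b)) (hs : ∀ x, sk x = x ^ p ^ n)
    {Φ : ℤ[X]} (hΦ : ∀ t ∈ TateModule ℓ (W.baseChange F).toAffine.Point,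
      ∀ n, Polynomial.aeval (W.pointEnd sF) Φ (t n) = 0)
    {P : (W.baseChange F).toAffine.Point} (hP : ∀ n, 0 < n → n • P ≠ 0)
    (Q : (W.baseChange k).toAffine.Point) : Polynomial.aeval (W.pointEnd sk) Φ Q = 0 := by
  have hpr : ℓ.Prime := Fact.out
  -- One nonzero ℓ-torsion point, divided repeatedly by ℓ, gives a Tate sequence whose reductions
  -- are pairwise distinct.
  obtain ⟨a, ha0, ha⟩ := exists_nsmul_eq_zero (W := W) (k := F) hpr.two_le
  obtain ⟨t, ht, rfl⟩ := TateModule.exists_of_divisible (ℓ := ℓ)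
    (exists_nsmul_eq hpr.ne_zero hP) ha
  obtain ⟨t', hinj, ht'⟩ := exists_tateModule_reduction hf hℓ hred ht ha0
  refine aeval_pointEnd_eq_zero_of_infinite p n sk hs Φ
    ((Set.infinite_range_of_injective hinj).mono ?_) Q
  rintro _ ⟨n, rfl⟩
  have := (ht' n).aeval hf hsF hsk Φ
  rw [hΦ t ht n] at this
  exact this.eq_zero

/-- A lift of Frobenius has no nonzero periodic vector in the Tate module. -/
theorem tateModule_eq_zero_of_fixed (hp : 1 < p ^ n) (hf : Function.Injective f)
    (hℓ : (ℓ : k) ≠ 0) (hred : ∀ P : (W.baseChange F).toAffine.Point, ∃ Q, ReducesTo W f g P Q)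
    (hsF : ∀ b, f (sB b) = sF (f b)) (hsk : ∀ b, g (sB b) = sk (g b)) (hs : ∀ x, sk x = x ^ p ^ n)
    {N : ℕ} (hN : 0 < N) {t : ℕ → (W.baseChange F).toAffine.Point} (ht : t ∈ TateModule ℓ _)
    (hfix : ∀ n, (W.pointEnd sF ^ N) (t n) = t n) : t = 0 := by
  by_contra ht0
  obtain ⟨m, hm, hm1⟩ := TateModule.exists_shift ht ht0
  obtain ⟨t', hinj, ht'⟩ := exists_tateModule_reduction hf hℓ hred hm hm1
  refine Set.infinite_range_of_injective hinj ?_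
  -- Points fixed by the N-th power of Frobenius have abscissa at infinity or among the roots of
  -- this polynomial, so there are finitely many of them.
  have hpol : (X ^ (p ^ n) ^ N - X : k[X]) ≠ 0 :=
    FiniteField.X_pow_card_sub_X_ne_zero k (Nat.one_lt_pow hN.ne' hp)
  refine (finite_setOf_xRep_mem ((Set.finite_singleton ![1, 0]).union
    (((X ^ (p ^ n) ^ N - X : k[X]).rootSet_finite k).image fun x => ![x, 1]))).subset ?_
  rintro _ ⟨i, rfl⟩
  have h1 := (ht' i).aeval hf hsF hsk (X ^ N)
  simp only [map_pow, aeval_X, hfix] at h1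
  have h2 := h1.unique hf (ht' i)
  have hxs : ∀ (N : ℕ) x y h, ∃ y' h', (W.pointEnd sk ^ N) (.some x y h) =
      .some (x ^ (p ^ n) ^ N) y' h' := by
    intro N x y h
    induction N with
    | zero => exact ⟨y, by simpa using h, by simp⟩
    | succ N ih =>
      obtain ⟨y', h', e⟩ := ih
      refine ⟨sk y', ?_, ?_⟩
      · have := (Affine.baseChange_nonsingular W (f := sk) (sk : k →+* k).injective _ _).2 h'
        rwa [hs (x ^ _), ← pow_mul, ← pow_succ] at this
      · rw [pow_succ']
        change W.pointEnd sk ((W.pointEnd sk ^ N) _) = _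
        rw [e]
        change Affine.Point.some _ _ _ = _
        congr 1
        rw [hs, ← pow_mul, ← pow_succ]
  rcases h3 : t' i with _ | ⟨x, y, h⟩
  · left; simp; rfl
  · right
    rw [h3] at h2
    obtain ⟨y', h', e⟩ := hxs N x y h
    rw [e] at h2
    refine ⟨x, ?_, by simp⟩
    rw [mem_rootSet]
    refine ⟨hpol, ?_⟩
    simp only [map_sub, map_pow, aeval_X, sub_eq_zero]
    simpa using (Affine.Point.some.inj h2).1

end ReductionOfTorsion

end WeierstrassCurve

namespace WeierstrassCurve

/-! ### Changes of Weierstrass coordinates. -/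

section VariableChange

variable {F : Type*} [Field F] [DecidableEq F]

/-- `V'` is obtained from `V` by the change of variables `x = u²X + r`, `y = u³Y + u²sX + t`. -/
structure IsVariableChange (V V' : WeierstrassCurve F) (u r s t : F) : Prop where
  u_ne_zero : u ≠ 0
  a₁ : u * V'.a₁ = V.a₁ + 2 * s
  a₂ : u ^ 2 * V'.a₂ = V.a₂ - s * V.a₁ + 3 * r - s ^ 2
  a₃ : u ^ 3 * V'.a₃ = V.a₃ + r * V.a₁ + 2 * t
  a₄ : u ^ 4 * V'.a₄ = V.a₄ - s * V.a₃ + 2 * r * V.a₂ - (t + r * s) * V.a₁ + 3 * r ^ 2 - 2 * s * t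
  a₆ : u ^ 6 * V'.a₆ = V.a₆ + r * V.a₄ + r ^ 2 * V.a₂ + r ^ 3 - t * V.a₃ - t ^ 2 - r * t * V.a₁

lemma isVariableChange_smul (C : VariableChange F) (V : WeierstrassCurve F) :
    IsVariableChange V (C • V) C.u C.r C.s C.t where
  u_ne_zero := C.u.ne_zero
  a₁ := by rw [variableChange_a₁, ← mul_assoc, Units.mul_inv, one_mul]
  a₂ := by rw [variableChange_a₂, ← mul_assoc, ← mul_pow, Units.mul_inv, one_pow, one_mul]
  a₃ := by rw [variableChange_a₃, ← mul_assoc, ← mul_pow, Units.mul_inv, one_pow, one_mul]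
  a₄ := by rw [variableChange_a₄, ← mul_assoc, ← mul_pow, Units.mul_inv, one_pow, one_mul]
  a₆ := by rw [variableChange_a₆, ← mul_assoc, ← mul_pow, Units.mul_inv, one_pow, one_mul]

namespace IsVariableChange

variable {V V' : WeierstrassCurve F} {u r s t : F} (h : IsVariableChange V V' u r s t)
include h

lemma equation_iff (X Y : F) : V.toAffine.Equation (u ^ 2 * X + r) (u ^ 3 * Y + u ^ 2 * s * X + t) ↔
    V'.toAffine.Equation X Y := by
  rw [Affine.equation_iff', Affine.equation_iff']
  have e : (u ^ 3 * Y + u ^ 2 * s * X + t) ^ 2 + V.a₁ * (u ^ 2 * X + r) *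
      (u ^ 3 * Y + u ^ 2 * s * X + t) + V.a₃ * (u ^ 3 * Y + u ^ 2 * s * X + t) -
      ((u ^ 2 * X + r) ^ 3 + V.a₂ * (u ^ 2 * X + r) ^ 2 + V.a₄ * (u ^ 2 * X + r) + V.a₆) =
      u ^ 6 * (Y ^ 2 + V'.a₁ * X * Y + V'.a₃ * Y - (X ^ 3 + V'.a₂ * X ^ 2 + V'.a₄ * X + V'.a₆)) := by
    linear_combination -u ^ 5 * X * Y * h.a₁ + u ^ 4 * X ^ 2 * h.a₂ - u ^ 3 * Y * h.a₃ +
      u ^ 2 * X * h.a₄ + h.a₆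
  refine ⟨fun h1 => ?_, fun h1 => ?_⟩
  · exact (mul_eq_zero.1 (e.symm.trans h1)).resolve_left (pow_ne_zero 6 h.u_ne_zero)
  · exact e.trans (by rw [h1, mul_zero])

lemma negY (X Y : F) : V.toAffine.negY (u ^ 2 * X + r) (u ^ 3 * Y + u ^ 2 * s * X + t) =
    u ^ 3 * V'.toAffine.negY X Y + u ^ 2 * s * X + t := by
  simp only [Affine.negY]
  linear_combination u ^ 2 * X * h.a₁ + h.a₃

lemma slope {X₁ X₂ Y₁ Y₂ : F} (h₁ : V'.toAffine.Equation X₁ Y₁)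
    (h₂ : V'.toAffine.Equation X₂ Y₂) (hxy : ¬ (X₁ = X₂ ∧ Y₁ = V'.toAffine.negY X₂ Y₂)) :
    V.toAffine.slope (u ^ 2 * X₁ + r) (u ^ 2 * X₂ + r) (u ^ 3 * Y₁ + u ^ 2 * s * X₁ + t)
      (u ^ 3 * Y₂ + u ^ 2 * s * X₂ + t) = u * V'.toAffine.slope X₁ X₂ Y₁ Y₂ + s := by
  have hu := h.u_ne_zero
  by_cases hX : X₁ = X₂
  · subst hX
    have hY : Y₁ ≠ V'.toAffine.negY X₁ Y₂ := fun e => hxy ⟨rfl, e⟩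
    obtain rfl := Affine.Y_eq_of_Y_ne h₁ h₂ rfl hY
    have hY' : u ^ 3 * Y₁ + u ^ 2 * s * X₁ + t ≠
        V.toAffine.negY (u ^ 2 * X₁ + r) (u ^ 3 * Y₁ + u ^ 2 * s * X₁ + t) := by
      rw [h.negY]
      intro e
      exact hY (mul_left_cancel₀ (pow_ne_zero 3 hu) (by linear_combination e))
    rw [Affine.slope_of_Y_ne rfl hY, Affine.slope_of_Y_ne rfl hY', h.negY]
    have hd : Y₁ - V'.toAffine.negY X₁ Y₁ ≠ 0 := sub_ne_zero.2 hY
    have e : u ^ 3 * Y₁ + u ^ 2 * s * X₁ + t - (u ^ 3 * V'.toAffine.negY X₁ Y₁ + u ^ 2 * s * X₁ + t)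
      = u ^ 3 * (Y₁ - V'.toAffine.negY X₁ Y₁) := by ring
    rw [e, div_eq_iff (mul_ne_zero (pow_ne_zero 3 hu) hd)]
    have e2 : (u * ((3 * X₁ ^ 2 + 2 * V'.a₂ * X₁ + V'.a₄ - V'.a₁ * Y₁) /
        (Y₁ - V'.toAffine.negY X₁ Y₁)) + s) * (u ^ 3 * (Y₁ - V'.toAffine.negY X₁ Y₁)) =
        u ^ 4 * (3 * X₁ ^ 2 + 2 * V'.a₂ * X₁ + V'.a₄ - V'.a₁ * Y₁) +
        s * u ^ 3 * (Y₁ - V'.toAffine.negY X₁ Y₁) := by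
      field_simp
    rw [e2]
    simp only [Affine.negY]
    linear_combination (u ^ 3 * Y₁ - s * u ^ 2 * X₁) * h.a₁ - 2 * u ^ 2 * X₁ * h.a₂ - h.a₄ - s * h.a₃
  · have hX' : u ^ 2 * X₁ + r ≠ u ^ 2 * X₂ + r := fun e =>
      hX (mul_left_cancel₀ (pow_ne_zero 2 hu) (by linear_combination e))
    rw [Affine.slope_of_X_ne hX, Affine.slope_of_X_ne hX']
    have hd : X₁ - X₂ ≠ 0 := sub_ne_zero.2 hX
    have e : u ^ 2 * X₁ + r - (u ^ 2 * X₂ + r) = u ^ 2 * (X₁ - X₂) := by ring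
    rw [e, div_eq_iff (mul_ne_zero (pow_ne_zero 2 hu) hd)]
    field_simp
    ring

lemma Δ_eq : V.Δ = u ^ 12 * V'.Δ := by
  have hu := h.u_ne_zero
  have e : V' = (⟨Units.mk0 u hu, r, s, t⟩ : VariableChange F) • V := by
    ext
    · rw [variableChange_a₁, ← h.a₁]; simp [hu]
    · rw [variableChange_a₂, ← h.a₂]; simp [hu]
    · rw [variableChange_a₃, ← h.a₃]; simp [hu]
    · rw [variableChange_a₄, ← h.a₄]; simp [hu]
    · rw [variableChange_a₆, ← h.a₆]; simp [hu]
  rw [e, variableChange_Δ, ← mul_assoc, Units.val_inv_eq_inv_val, Units.val_mk0, ← mul_pow,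
    mul_inv_cancel₀ hu, one_pow, one_mul]

variable [V.IsElliptic] [V'.IsElliptic]

/-- The isomorphism on points induced by a change of variables. -/
noncomputable def pointHom : V'.toAffine.Point →+ V.toAffine.Point where
  toFun P := match P with
    | 0 => 0
    | .some X Y hXY => .some (u ^ 2 * X + r) (u ^ 3 * Y + u ^ 2 * s * X + t)
      (Affine.equation_iff_nonsingular.1 ((h.equation_iff X Y).2 hXY.1))
  map_zero' := rfl
  map_add' := by
    rintro (_ | ⟨X₁, Y₁, h₁⟩) (_ | ⟨X₂, Y₂, h₂⟩)
    any_goals rfl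
    by_cases hxy : X₁ = X₂ ∧ Y₁ = V'.toAffine.negY X₂ Y₂
    · obtain ⟨rfl, hY⟩ := hxy
      rw [Affine.Point.add_of_Y_eq rfl hY]
      exact (Affine.Point.add_of_Y_eq rfl (by rw [h.negY, hY])).symm
    · rw [Affine.Point.add_some hxy]
      have hxy' : ¬ (u ^ 2 * X₁ + r = u ^ 2 * X₂ + r ∧ u ^ 3 * Y₁ + u ^ 2 * s * X₁ + t =
          V.toAffine.negY (u ^ 2 * X₂ + r) (u ^ 3 * Y₂ + u ^ 2 * s * X₂ + t)) := by
        rintro ⟨e1, e2⟩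
        have e3 : X₁ = X₂ := mul_left_cancel₀ (pow_ne_zero 2 h.u_ne_zero) (by linear_combination e1)
        subst e3
        rw [h.negY] at e2
        exact hxy ⟨rfl, mul_left_cancel₀ (pow_ne_zero 3 h.u_ne_zero) (by linear_combination e2)⟩
      refine Eq.trans ?_ (Affine.Point.add_some hxy').symm
      have hX : u ^ 2 * V'.toAffine.addX X₁ X₂ (V'.toAffine.slope X₁ X₂ Y₁ Y₂) + r =
          V.toAffine.addX (u ^ 2 * X₁ + r) (u ^ 2 * X₂ + r)
          (V.toAffine.slope (u ^ 2 * X₁ + r) (u ^ 2 * X₂ + r) (u ^ 3 * Y₁ + u ^ 2 * s * X₁ + t)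
            (u ^ 3 * Y₂ + u ^ 2 * s * X₂ + t)) := by
        rw [h.slope h₁.1 h₂.1 hxy, Affine.addX, Affine.addX]
        linear_combination u * V'.toAffine.slope X₁ X₂ Y₁ Y₂ * h.a₁ - h.a₂
      refine (Affine.Point.some.injEq ..).mpr ⟨hX, ?_⟩
      rw [Affine.addY, Affine.addY, ← h.negY, ← hX]
      congr 1
      rw [Affine.negAddY, Affine.negAddY, ← hX, h.slope h₁.1 h₂.1 hxy]
      ring

lemma pointHom_some {X Y : F} (hXY : V'.toAffine.Nonsingular X Y) :
    h.pointHom (.some X Y hXY) = .some (u ^ 2 * X + r) (u ^ 3 * Y + u ^ 2 * s * X + t)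
      (Affine.equation_iff_nonsingular.1 ((h.equation_iff X Y).2 hXY.1)) := rfl

lemma pointHom_injective : Function.Injective h.pointHom := by
  rw [injective_iff_map_eq_zero]
  rintro (_ | ⟨X, Y, hXY⟩) e
  · rfl
  · cases e

lemma pointHom_surjective : Function.Surjective h.pointHom := by
  have hu := h.u_ne_zero
  rintro (_ | ⟨x, y, hxy⟩)
  · exact ⟨0, rfl⟩
  · have hx : x = u ^ 2 * ((x - r) / u ^ 2) + r := by field_simp; ring
    have hy : y = u ^ 3 * ((y - s * (x - r) - t) / u ^ 3) + u ^ 2 * s * ((x - r) / u ^ 2) + t := by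
      field_simp; ring
    have hXY := hxy.1
    rw [hx, hy] at hXY
    generalize (x - r) / u ^ 2 = X at *
    generalize (y - s * (x - r) - t) / u ^ 3 = Y at *
    refine ⟨.some X Y (Affine.equation_iff_nonsingular.1 ((h.equation_iff X Y).1 ?_)), ?_⟩
    · exact hXY
    · rw [pointHom_some]
      congr 1
      · exact hx.symm
      · exact hy.symm

end IsVariableChange

end VariableChange

end WeierstrassCurve

namespace WeierstrassCurve

/-! ### The Néron function under good reduction. -/

section Neron

variable {F : Type*} [Field F] [DecidableEq F] {v : AbsoluteValue F ℝ} {E : WeierstrassCurve F}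

/-- The difference of two Néron functions is bounded away from O, by boundedness and the limits at
O, and duplication multiplies it by 4. Requiring all 2^n P ≠ O permits indefinite iteration. -/
lemma IsNeronFunction.eq_of_forall_two_pow {h₁ h₂ : E.toAffine.Point → ℝ}
    (H₁ : IsNeronFunction v E h₁) (H₂ : IsNeronFunction v E h₂) {P : E.toAffine.Point}
    (hP : ∀ n : ℕ, 2 ^ n • P ≠ 0) : h₁ P = h₂ P := by
  have hb : ∃ B : ℝ, ∀ Q : E.toAffine.Point, Q ≠ 0 → |h₁ Q - h₂ Q| ≤ B := by
    obtain ⟨c₁, hc₁⟩ := H₁.limit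
    obtain ⟨c₂, hc₂⟩ := H₂.limit
    obtain ⟨R₁, hR₁⟩ := hc₁ 1 one_pos
    obtain ⟨R₂, hR₂⟩ := hc₂ 1 one_pos
    obtain ⟨B₁, hB₁⟩ := H₁.bounded (max R₁ R₂)
    obtain ⟨B₂, hB₂⟩ := H₂.bounded (max R₁ R₂)
    refine ⟨max (B₁ + B₂) (2 + |c₁ - c₂|), ?_⟩
    rintro (_ | ⟨x, y, hxy⟩) hQ
    · exact absurd rfl hQ
    · rcases le_or_gt (v x) (max R₁ R₂) with hx | hx
      · refine le_max_of_le_left ((abs_sub _ _).trans (add_le_add (hB₁ x y hxy hx) (hB₂ x y hxy hx)))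
      · refine le_max_of_le_right ?_
        have e₁ := hR₁ x y hxy ((le_max_left _ _).trans_lt hx)
        have e₂ := hR₂ x y hxy ((le_max_right _ _).trans_lt hx)
        rw [abs_lt] at e₁ e₂
        rw [abs_le]
        have := le_abs_self (c₁ - c₂)
        have := neg_abs_le (c₁ - c₂)
        constructor <;> linarith
  obtain ⟨B, hB⟩ := hb
  have hd : ∀ n : ℕ, h₁ (2 ^ n • P) - h₂ (2 ^ n • P) = 4 ^ n * (h₁ P - h₂ P) := by
    intro n
    induction n with
    | zero => simp
    | succ n ih =>
      have h0 := hP n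
      have h1 := hP (n + 1)
      rw [pow_succ', mul_smul] at h1 ⊢
      rcases hQ : 2 ^ n • P with _ | ⟨x, y, hxy⟩
      · exact absurd hQ h0
      · rw [hQ] at h1 ih
        rw [H₁.duplication x y hxy h1, H₂.duplication x y hxy h1, pow_succ]
        linear_combination 4 * ih
  by_contra hne
  have hpos : 0 < |h₁ P - h₂ P| := abs_pos.2 (sub_ne_zero.2 hne)
  obtain ⟨n, hn⟩ := pow_unbounded_of_one_lt (B / |h₁ P - h₂ P|) (by norm_num : (1 : ℝ) < 4)
  have h1 := hB _ (hP n)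
  rw [hd, abs_mul, abs_of_pos (by positivity : (0 : ℝ) < 4 ^ n)] at h1
  rw [div_lt_iff₀ hpos] at hn
  linarith

lemma localHeight_eq {h : E.toAffine.Point → ℝ} (H : IsNeronFunction v E h)
    {P : E.toAffine.Point} (hP : ∀ n : ℕ, 2 ^ n • P ≠ 0) : E.localHeight v P = (h P : ℝ) := by
  have h0 : P ≠ 0 := by simpa using hP 0
  have hex : ∃ f, IsNeronFunction v E f := ⟨h, H⟩
  rw [localHeight, if_neg h0, dif_pos hex, hex.choose_spec.eq_of_forall_two_pow H hP]

/-- The local height of a curve that becomes a smooth integral model after the change of variables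
`x = u²X + r`. -/
noncomputable def goodHeight (v : AbsoluteValue F ℝ) (E : WeierstrassCurve F) (u r : F) :
    E.toAffine.Point → ℝ
  | 0 => 0
  | .some x _ _ => 1 / 2 * Real.log (max 1 (v ((x - r) / u ^ 2)))

section Duplication

variable {O : Type*} [CommRing O] [IsLocalRing O] {i : O →+* F}

/-- Some entry is a unit because `O` is local, and it and its inverse both have absolute value at
most 1. -/
lemma exists_eq_one_of_isPrimitiveVec (hi : ∀ a, v (i a) ≤ 1) {n : ℕ} {w : Fin n → O}
    (hw : IsPrimitiveVec w) : ∃ j, v (i (w j)) = 1 := by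
  obtain ⟨j, hj⟩ := isPrimitiveVec_iff.1 hw (IsLocalRing.maximalIdeal O) inferInstance
  refine ⟨j, le_antisymm (hi _) ?_⟩
  obtain ⟨b, hb⟩ := (IsLocalRing.notMem_maximalIdeal.1 hj).exists_right_inv
  have := congrArg (fun a => v (i a)) hb
  simp only [map_mul, map_one] at this
  nlinarith [hi b, hi (w j), v.nonneg (i b), v.nonneg (i (w j))]

/-- For a smooth integral model, duplication on `x`-coordinates has no cancellation. -/
lemma max_duplication (hi : ∀ a, v (i a) ≤ 1) (hi' : ∀ x, v x ≤ 1 → ∃ a, i a = x)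
    (W : WeierstrassCurve O) [W.IsElliptic] (X : F) :
    max (v (X ^ 4 - (W.map i).b₄ * X ^ 2 - 2 * (W.map i).b₆ * X - (W.map i).b₈))
      (v (4 * X ^ 3 + (W.map i).b₂ * X ^ 2 + 2 * (W.map i).b₄ * X + (W.map i).b₆)) =
      max 1 (v X) ^ 4 := by
  have h2 : i 2 = 2 := map_ofNat i 2
  have h4 : i 4 = 4 := map_ofNat i 4
  rcases le_or_gt (v X) 1 with hX | hX
  · obtain ⟨a, rfl⟩ := hi' X hX
    rw [max_eq_left hX, one_pow]
    -- Duplication is the parallelogram relation with P = Q; (a², 2a, 1) encodes the pair (x(P),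
    -- x(P)), and the third form vanishes since P - P = O. For |X| > 1 the same is done with 1/X.
    have hp : IsPrimitiveVec (![a ^ 2, 2 * a, 1] : Fin 3 → O) := by
      rw [isPrimitiveVec_iff]
      exact fun M hM => ⟨2, fun h => hM.ne_top ((Ideal.eq_top_iff_one _).2 h)⟩
    obtain ⟨j, hj⟩ := exists_eq_one_of_isPrimitiveVec hi (hp.addSubMap W)
    have e0 : i ((W.addSubMap 0).eval (![a ^ 2, 2 * a, 1] : Fin 3 → O)) =
        i a ^ 4 - (W.map i).b₄ * i a ^ 2 - 2 * (W.map i).b₆ * i a - (W.map i).b₈ := by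
      simp [addSubMap, h2]; ring
    have e1 : i ((W.addSubMap 1).eval (![a ^ 2, 2 * a, 1] : Fin 3 → O)) =
        4 * i a ^ 3 + (W.map i).b₂ * i a ^ 2 + 2 * (W.map i).b₄ * i a + (W.map i).b₆ := by
      simp [addSubMap, h2]; ring
    have e2 : i ((W.addSubMap 2).eval (![a ^ 2, 2 * a, 1] : Fin 3 → O)) = 0 := by
      simp [addSubMap, h2, h4]; ring
    rw [← e0, ← e1]
    refine le_antisymm (max_le (hi _) (hi _)) ?_
    fin_cases j
    · exact le_max_of_le_left hj.ge
    · exact le_max_of_le_right hj.ge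
    · simp only [Fin.reduceFinMk, e2, map_zero, zero_ne_one] at hj
  · have hX0 : X ≠ 0 := by rintro rfl; rw [map_zero] at hX; linarith
    obtain ⟨a, ha⟩ := hi' X⁻¹ (by rw [map_inv₀]; exact inv_le_one_of_one_le₀ hX.le)
    rw [max_eq_right hX.le]
    have hp : IsPrimitiveVec (![1, 2 * a, a ^ 2] : Fin 3 → O) := by
      rw [isPrimitiveVec_iff]
      exact fun M hM => ⟨0, fun h => hM.ne_top ((Ideal.eq_top_iff_one _).2 h)⟩
    obtain ⟨j, hj⟩ := exists_eq_one_of_isPrimitiveVec hi (hp.addSubMap W)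
    have e0 : i ((W.addSubMap 0).eval (![1, 2 * a, a ^ 2] : Fin 3 → O)) * X ^ 4 =
        X ^ 4 - (W.map i).b₄ * X ^ 2 - 2 * (W.map i).b₆ * X - (W.map i).b₈ := by
      simp [addSubMap, h2, ha]; field_simp
    have e1 : i ((W.addSubMap 1).eval (![1, 2 * a, a ^ 2] : Fin 3 → O)) * X ^ 4 =
        4 * X ^ 3 + (W.map i).b₂ * X ^ 2 + 2 * (W.map i).b₄ * X + (W.map i).b₆ := by
      simp [addSubMap, h2, ha]; field_simp; ring
    have e2 : i ((W.addSubMap 2).eval (![1, 2 * a, a ^ 2] : Fin 3 → O)) = 0 := by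
      simp [addSubMap, h2, h4]; ring
    rw [← e0, ← e1, map_mul, map_mul, map_pow]
    have hX4 : 0 ≤ v X ^ 4 := by positivity
    refine le_antisymm (max_le ?_ ?_) ?_
    · exact mul_le_of_le_one_left hX4 (hi _)
    · exact mul_le_of_le_one_left hX4 (hi _)
    · fin_cases j
      · refine le_max_of_le_left ?_
        simp only [Fin.zero_eta] at hj
        rw [hj, one_mul]
      · refine le_max_of_le_right ?_
        simp only [Fin.mk_one] at hj
        rw [hj, one_mul]
      · simp only [Fin.reduceFinMk, e2, map_zero, zero_ne_one] at hj

lemma duplication_eq {V : WeierstrassCurve F} {X Y : F} (h : V.toAffine.Nonsingular X Y)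
    (h2 : 2 • (.some X Y h : V.toAffine.Point) ≠ 0) : ∃ X' Y' h',
      2 • (.some X Y h : V.toAffine.Point) = .some X' Y' h' ∧ 2 * Y + V.a₁ * X + V.a₃ ≠ 0 ∧
      X' * (2 * Y + V.a₁ * X + V.a₃) ^ 2 = X ^ 4 - V.b₄ * X ^ 2 - 2 * V.b₆ * X - V.b₈ ∧
      (2 * Y + V.a₁ * X + V.a₃) ^ 2 = 4 * X ^ 3 + V.b₂ * X ^ 2 + 2 * V.b₄ * X + V.b₆ := by
  have heq := (Affine.equation_iff _ _).1 h.1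
  have hψ : (2 * Y + V.a₁ * X + V.a₃) ^ 2 = 4 * X ^ 3 + V.b₂ * X ^ 2 + 2 * V.b₄ * X + V.b₆ := by
    rw [b₂, b₄, b₆]
    linear_combination 4 * heq
  have hne : 2 * Y + V.a₁ * X + V.a₃ ≠ 0 := by
    intro e
    refine h2 ?_
    rw [two_smul]
    refine Affine.Point.add_of_Y_eq rfl ?_
    rw [Affine.negY]
    linear_combination e
  obtain ⟨c, hc⟩ := exists_addSubMap_self (.some X Y h : V.toAffine.Point)
  rw [sub_self, ← two_smul ℕ] at hc
  rcases hP : 2 • (.some X Y h : V.toAffine.Point) with _ | ⟨X', Y', h'⟩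
  · exact absurd hP h2
  · refine ⟨X', Y', h', rfl, hne, ?_, hψ⟩
    rw [hP, Affine.Point.sym2x_some_zero] at hc
    have h0 := hc 0
    have h1 := hc 1
    simp [addSubMap] at h0 h1
    rw [hψ]
    linear_combination -h0 + X' * h1

end Duplication

variable {O : Type*} [CommRing O] [IsLocalRing O] {i : O →+* F}

/-- The Néron function of a curve with good reduction. -/
theorem isNeronFunction_goodHeight (hv : IsNonarchimedean v) (hi : ∀ a, v (i a) ≤ 1)
    (hi' : ∀ x, v x ≤ 1 → ∃ a, i a = x) (W : WeierstrassCurve O) [W.IsElliptic] [E.IsElliptic]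
    {u r s t : F} (h : IsVariableChange E (W.map i) u r s t) :
    IsNeronFunction v E (goodHeight v E u r) := by
  have hu : 0 < v u := v.pos h.u_ne_zero
  have hsub : ∀ a b : F, v (a - b) ≤ max (v a) (v b) := fun a b => by
    have := hv a (-b)
    rwa [v.map_neg, ← sub_eq_add_neg] at this
  refine ⟨fun x y hxy ε hε => ⟨v u ^ 2, by positivity, fun x' y' hxy' hx _ => ?_⟩,
    fun R => ⟨1 / 2 * Real.log (max 1 (max R (v r) / v u ^ 2)), fun x y hxy hx => ?_⟩,
    ⟨-Real.log (v u), fun ε hε => ⟨max (v r) (v u ^ 2), fun x y hxy hx => ?_⟩⟩,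
    fun x y hxy h2 => ?_⟩
  -- Continuity holds in a strong form: moving the integral coordinate by less than 1 does not
  -- change max(1, |X|).
  · have h1 : v ((x' - r) / u ^ 2 - (x - r) / u ^ 2) < 1 := by
      rw [← sub_div, sub_sub_sub_cancel_right, map_div₀, map_pow, div_lt_one (by positivity)]
      exact hx
    have e : max 1 (v ((x' - r) / u ^ 2)) = max 1 (v ((x - r) / u ^ 2)) := by
      refine le_antisymm (max_le (le_max_left _ _) ?_) (max_le (le_max_left _ _) ?_)
      · have := hv ((x' - r) / u ^ 2 - (x - r) / u ^ 2) ((x - r) / u ^ 2)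
        rw [sub_add_cancel] at this
        exact this.trans (max_le_max_right _ h1.le)
      · have := hsub ((x' - r) / u ^ 2) ((x' - r) / u ^ 2 - (x - r) / u ^ 2)
        rw [sub_sub_cancel] at this
        exact this.trans (max_le (le_max_right _ _) (h1.le.trans (le_max_left _ _)))
    simp only [goodHeight, e, sub_self, abs_zero]
    exact hε
  · have h0 : 0 ≤ Real.log (max 1 (v ((x - r) / u ^ 2))) := Real.log_nonneg (le_max_left _ _)
    simp only [goodHeight]
    rw [abs_of_nonneg (by positivity)]
    gcongr
    rw [map_div₀, map_pow]
    gcongr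
    exact (hsub _ _).trans (max_le_max_right _ hx)
  · have hx1 : v r < v x := (le_max_left _ _).trans_lt hx
    have hx2 : v u ^ 2 < v x := (le_max_right _ _).trans_lt hx
    have hx0 : 0 < v x := (v.nonneg _).trans_lt hx1
    have hxr : v (x - r) = v x := by
      refine le_antisymm ((hsub _ _).trans (max_le le_rfl hx1.le)) ?_
      by_contra! hlt
      have := hv (x - r) r
      rw [sub_add_cancel] at this
      exact absurd this (not_le.2 (max_lt hlt hx1))
    have h1 : 1 ≤ v x / v u ^ 2 := by rw [one_le_div (by positivity)]; exact hx2.le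
    simp only [goodHeight]
    rw [map_div₀, map_pow, hxr, max_eq_right h1, Real.log_div hx0.ne' (by positivity), Real.log_pow]
    convert hε using 1
    rw [abs_eq_zero]
    push_cast
    ring
  · obtain ⟨⟨⟩ | ⟨X, Y, hXY⟩, hP⟩ := h.pointHom_surjective (.some x y hxy)
    · cases hP
    rw [h.pointHom_some] at hP
    obtain ⟨hx, hy⟩ := Affine.Point.some.inj hP
    subst hx hy
    have hP2 : h.pointHom (2 • .some X Y hXY) = 2 • .some _ _ hxy := by
      rw [map_nsmul, h.pointHom_some]
    have h2' : 2 • (.some X Y hXY : (W.map i).toAffine.Point) ≠ 0 := by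
      intro e
      rw [e, map_zero] at hP2
      exact h2 hP2.symm
    obtain ⟨X', Y', hXY', e, hne, h3, h4⟩ := duplication_eq hXY h2'
    rw [e, h.pointHom_some] at hP2
    rw [← hP2]
    simp only [goodHeight]
    have hu2 : u ^ 2 ≠ 0 := pow_ne_zero 2 h.u_ne_zero
    have hψ : 2 * (u ^ 3 * Y + u ^ 2 * s * X + t) + E.a₁ * (u ^ 2 * X + r) + E.a₃ =
        u ^ 3 * (2 * Y + (W.map i).a₁ * X + (W.map i).a₃) := by
      linear_combination -u ^ 2 * X * h.a₁ - h.a₃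
    have hΔ : E.Δ = u ^ 12 * (W.map i).Δ := h.Δ_eq
    have hΔ1 : v (W.map i).Δ = 1 := by
      obtain ⟨b, hb⟩ := W.isUnit_Δ.exists_right_inv
      have := congrArg (fun a => v (i a)) hb
      simp only [map_mul, map_one] at this
      rw [map_Δ]
      refine le_antisymm (hi _) ?_
      nlinarith [hi b, hi W.Δ, v.nonneg (i b), v.nonneg (i W.Δ)]
    have hmax := max_duplication hi hi' W X
    set ψ := 2 * Y + (W.map i).a₁ * X + (W.map i).a₃
    have hvψ : 0 < v ψ := v.pos hne
    rw [← h3, ← h4, map_mul, map_pow] at hmax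
    -- The duplication formula in multiplicative form. The discriminant contributes |u|^12 and ψ
    -- contributes |u|³, and these cancel.
    have hm : max 1 (v X') * v ψ ^ 2 = max 1 (v X) ^ 4 := by
      rw [← hmax, max_mul_of_nonneg _ _ (by positivity), one_mul, max_comm]
    have hm1 : 0 < max 1 (v X') := lt_max_of_lt_left one_pos
    have hlog := congrArg Real.log hm
    rw [Real.log_mul hm1.ne' (by positivity), Real.log_pow, Real.log_pow] at hlog
    rw [hψ, hΔ, map_mul, map_mul, map_pow, map_pow, hΔ1, mul_one, Real.log_mul (by positivity)
      hvψ.ne', Real.log_pow, Real.log_pow, add_sub_cancel_right, add_sub_cancel_right,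
      mul_div_cancel_left₀ _ hu2, mul_div_cancel_left₀ _ hu2]
    push_cast at hlog ⊢
    linear_combination 1 / 2 * hlog

end Neron

end WeierstrassCurve

/-! ### Nonarchimedean estimates and lifts of Frobenius. -/

section Nonarchimedean

variable {F : Type*} [Field F] {v : AbsoluteValue F ℝ} {p : ℕ}

lemma IsNonarchimedean.sub_le (hv : IsNonarchimedean v) {a b : F} {M : ℝ} (ha : v a ≤ M)
    (hb : v b ≤ M) : v (a - b) ≤ M := by
  rw [sub_eq_add_neg]
  exact (hv _ _).trans (max_le ha (by rwa [v.map_neg]))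

/-- The closed unit ball of a nonarchimedean absolute value. -/
def IsNonarchimedean.unitBall (hv : IsNonarchimedean v) : Subring F where
  carrier := {x | v x ≤ 1}
  zero_mem' := by simp
  one_mem' := by simp
  add_mem' := fun ha hb => (hv _ _).trans (max_le ha hb)
  mul_mem' := fun {a b} ha hb => by
    simp only [Set.mem_ofPred_eq, map_mul] at *
    exact mul_le_one₀ ha (v.nonneg _) hb
  neg_mem' := fun {a} ha => by simpa using ha

/-- The error is kept divisible by p x y: the factor p makes the congruence ring closed under
addition, and the factors x y make p-th powers contracting. -/
lemma IsNonarchimedean.exists_add_pow (hv : IsNonarchimedean v) (hp : p.Prime) (n : ℕ) {x y : F}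
    (hx : v x ≤ 1) (hy : v y ≤ 1) :
    ∃ r, v r ≤ 1 ∧ (x + y) ^ p ^ n = x ^ p ^ n + y ^ p ^ n + p * x * y * r := by
  obtain ⟨⟨r, hr⟩, e⟩ := exists_add_pow_prime_pow_eq hp
    (⟨x, hx⟩ : hv.unitBall) (⟨y, hy⟩ : hv.unitBall) n
  exact ⟨r, hr, by simpa using congrArg Subtype.val e⟩

/-- The difference of p-th powers is (a - b)^p plus a multiple of p (a - b), and both terms gain the
factor θ. -/
lemma IsNonarchimedean.sub_pow_le (hv : IsNonarchimedean v) (hp : p.Prime) {a b : F} {ρ θ : ℝ}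
    (hb : v b ≤ 1) (hρ : v (a - b) ≤ ρ) (hρθ : ρ ≤ θ) (hθ : θ ≤ 1) (hpθ : v p ≤ θ) :
    v (a ^ p - b ^ p) ≤ ρ * θ := by
  have hρ0 : 0 ≤ ρ := (v.nonneg _).trans hρ
  have hab := hρ.trans hρθ
  obtain ⟨r, hr, e⟩ := hv.exists_add_pow hp 1 hb (hρ.trans (hρθ.trans hθ))
  rw [pow_one, add_sub_cancel] at e
  have e' : a ^ p - b ^ p = (a - b) ^ p + p * (a - b) * (b * r) := by rw [e]; ring
  rw [e']
  refine (hv _ _).trans (max_le ?_ ?_)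
  · obtain ⟨m, hm⟩ := Nat.exists_eq_add_of_le hp.two_le
    rw [map_pow, hm, pow_add, sq]
    exact (mul_le_of_le_one_right (mul_nonneg (v.nonneg _) (v.nonneg _))
      (pow_le_one₀ (v.nonneg _) (hab.trans hθ))).trans (mul_le_mul hρ hab (v.nonneg _) hρ0)
  · rw [map_mul, map_mul, map_mul v b, mul_comm ρ θ]
    exact (mul_le_of_le_one_right (mul_nonneg (v.nonneg _) (v.nonneg _))
      (mul_le_one₀ hb (v.nonneg _) hr)).trans
        (mul_le_mul hpθ hρ (v.nonneg _) ((v.nonneg _).trans hpθ))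

lemma IsNonarchimedean.sub_pow_pow_le (hv : IsNonarchimedean v) (hp : p.Prime) {a b : F} {θ : ℝ}
    (hb : v b ≤ 1) (hρ : v (a - b) ≤ θ) (hθ : θ ≤ 1) (hpθ : v p ≤ θ) (n : ℕ) :
    v (a ^ p ^ n - b ^ p ^ n) ≤ θ * θ ^ n := by
  have hθ0 : 0 ≤ θ := (v.nonneg _).trans hρ
  induction n with
  | zero => simpa using hρ
  | succ n ih =>
    have hle : θ * θ ^ n ≤ θ := mul_le_of_le_one_right hθ0 (pow_le_one₀ hθ0 hθ)
    have := hv.sub_pow_le hp (by rw [map_pow]; exact pow_le_one₀ (v.nonneg _) hb) ih hle hθ hpθ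
    rw [← pow_mul, ← pow_mul, ← pow_succ, mul_assoc, ← pow_succ] at this
    exact this

end Nonarchimedean

/-- `σ` is an isometry for the absolute value `v`, extending the `p`-adic one, and induces the
`p ^ n`-power map on the residue field. -/
structure IsFrobeniusLift {R F : Type*} [CommRing R] [Field F] [Algebra R F]
    (v : AbsoluteValue F ℝ) (p n : ℕ) (σ : F →ₐ[R] F) : Prop where
  nonarch : IsNonarchimedean v
  prime : p.Prime
  map_prime : v p = (p : ℝ)⁻¹
  map_base : ∀ r, v (algebraMap R F r) ≤ 1
  isometry : ∀ x, v (σ x) = v x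
  sub_lt : ∀ x, v x ≤ 1 → v (σ x - x ^ p ^ n) < 1

namespace IsFrobeniusLift

variable {R F : Type*} [CommRing R] [Field F] [Algebra R F] {v : AbsoluteValue F ℝ} {p n : ℕ}
  {σ : F →ₐ[R] F} (h : IsFrobeniusLift v p n σ)

include h

lemma map_prime_lt : v p < 1 := by
  rw [h.map_prime]
  exact inv_lt_one_of_one_lt₀ (by exact_mod_cast h.prime.one_lt)

/-- Elements of a subfield with discrete value group and finite residue field satisfy the Frobenius
congruence up to the absolute value of a uniformizer. -/
lemma sub_le {c : ℝ} (hc : 0 < c) (hpc : (p : ℝ)⁻¹ ≤ c) {M : Subfield F}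
    (hM : ∀ x ∈ M, v x < 1 → v x ≤ c) {m : ℕ} (hm : 0 < m)
    (hMm : ∀ x ∈ M, v x ≤ 1 → v (x ^ p ^ m - x) < 1) {x : F} (hx : x ∈ M) (hx1 : v x ≤ 1) :
    v (σ x - x ^ p ^ n) ≤ c := by
  have hpow : ∀ i, v (x ^ i) ≤ 1 := fun i => by
    rw [map_pow]; exact pow_le_one₀ (v.nonneg _) hx1
  -- Inside M discreteness improves every bound < 1 to ≤ c.
  have h1 : ∀ N, v (x ^ (p ^ m) ^ N - x) ≤ c := by
    intro N
    induction N with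
    | zero => simpa using hc.le
    | succ N ih =>
      rw [pow_succ, pow_mul, ← sub_add_sub_cancel _ (x ^ (p ^ m) ^ N) x]
      refine (h.nonarch _ _).trans (max_le ?_ ih)
      exact hM _ (sub_mem (pow_mem (pow_mem hx _) _) (pow_mem hx _))
        (hMm _ (pow_mem hx _) (hpow _))
  -- A priori σx and x^q agree only up to some θ < 1, as σx need not lie in M. High p-power
  -- exponents contract this below c, and up to c neither σx nor x^q changes under the powers
  -- (p^m)^N, by the previous step and isometry.
  obtain ⟨θ, hθ1, hxθ, hpθ⟩ : ∃ θ : ℝ, θ < 1 ∧ v (σ x - x ^ p ^ n) ≤ θ ∧ v p ≤ θ :=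
    ⟨max (v (σ x - x ^ p ^ n)) (v p), max_lt (h.sub_lt x hx1) h.map_prime_lt, le_max_left _ _,
      le_max_right _ _⟩
  have hθ0 : 0 ≤ θ := (v.nonneg _).trans hpθ
  obtain ⟨N, hN⟩ := exists_pow_lt_of_lt_one hc hθ1
  have h2 : v ((σ x) ^ (p ^ m) ^ N - (x ^ p ^ n) ^ (p ^ m) ^ N) ≤ c := by
    rw [← pow_mul p]
    refine (h.nonarch.sub_pow_pow_le h.prime (hpow _) hxθ hθ1.le hpθ _).trans ?_
    refine (mul_le_of_le_one_left (pow_nonneg hθ0 _) hθ1.le).trans (le_trans ?_ hN.le)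
    exact pow_le_pow_of_le_one hθ0 hθ1.le (Nat.le_mul_of_pos_left _ hm)
  have h3 : v (σ x - (σ x) ^ (p ^ m) ^ N) ≤ c := by
    rw [← map_pow, ← map_sub, h.isometry, v.map_sub]
    exact h1 N
  have h4 : v ((x ^ p ^ n) ^ (p ^ m) ^ N - x ^ p ^ n) ≤ c := by
    rw [pow_right_comm]
    rcases le_or_gt c 1 with hc1 | hc1
    · refine (h.nonarch.sub_pow_pow_le h.prime hx1 (h1 N) hc1 ?_ n).trans
        (mul_le_of_le_one_right hc.le (pow_le_one₀ hc.le hc1))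
      rwa [h.map_prime]
    · exact h.nonarch.sub_le (by rw [← pow_mul]; exact (hpow _).trans hc1.le)
        ((hpow _).trans hc1.le)
  have e : σ x - x ^ p ^ n = (σ x - (σ x) ^ (p ^ m) ^ N) +
      (((σ x) ^ (p ^ m) ^ N - (x ^ p ^ n) ^ (p ^ m) ^ N) +
        ((x ^ p ^ n) ^ (p ^ m) ^ N - x ^ p ^ n)) := by ring
  rw [e]
  exact (h.nonarch _ _).trans (max_le h3 ((h.nonarch _ _).trans (max_le h2 h4)))

/-- The elements of the unit ball that satisfy the Frobenius congruence up to `c`. -/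
def congruenceSubalgebra {c : ℝ} (hpc : (p : ℝ)⁻¹ ≤ c)
    (hR : ∀ r : R, v (algebraMap R F r - algebraMap R F r ^ p ^ n) ≤ c) : Subalgebra R F where
  carrier := {x | v x ≤ 1 ∧ v (σ x - x ^ p ^ n) ≤ c}
  add_mem' := by
    rintro a b ⟨ha, ha'⟩ ⟨hb, hb'⟩
    refine ⟨(h.nonarch _ _).trans (max_le ha hb), ?_⟩
    -- The cross term of the q-th power has size at most 1/p; this is where 1/p ≤ c enters.
    obtain ⟨r, hr, e⟩ := h.nonarch.exists_add_pow h.prime n ha hb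
    rw [e, map_add, show σ a + σ b - (a ^ p ^ n + b ^ p ^ n + p * a * b * r) =
      (σ a - a ^ p ^ n) + (σ b - b ^ p ^ n) - p * a * b * r by ring]
    refine h.nonarch.sub_le ((h.nonarch _ _).trans (max_le ha' hb')) ?_
    rw [map_mul, map_mul, map_mul, h.map_prime, mul_assoc, mul_assoc]
    refine (mul_le_of_le_one_right (by positivity) ?_).trans hpc
    exact mul_le_one₀ ha (mul_nonneg (v.nonneg _) (v.nonneg _)) (mul_le_one₀ hb (v.nonneg _) hr)
  mul_mem' := by
    rintro a b ⟨ha, ha'⟩ ⟨hb, hb'⟩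
    refine ⟨by rw [map_mul]; exact mul_le_one₀ ha (v.nonneg _) hb, ?_⟩
    rw [map_mul, mul_pow, show σ a * σ b - a ^ p ^ n * b ^ p ^ n =
      (σ a - a ^ p ^ n) * σ b + a ^ p ^ n * (σ b - b ^ p ^ n) by ring]
    refine (h.nonarch _ _).trans (max_le ?_ ?_)
    · rw [map_mul, h.isometry]
      exact (mul_le_of_le_one_right (v.nonneg _) hb).trans ha'
    · rw [map_mul, map_pow]
      exact (mul_le_of_le_one_left (v.nonneg _) (pow_le_one₀ (v.nonneg _) ha)).trans hb'
  algebraMap_mem' := fun r => ⟨h.map_base r, by rw [σ.commutes]; exact hR r⟩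

/-- The closed unit ball as an algebra over the base. -/
def integers : Subalgebra R F where
  __ := h.nonarch.unitBall
  algebraMap_mem' := h.map_base

lemma mem_integers {x : F} : x ∈ h.integers ↔ v x ≤ 1 := Iff.rfl

lemma isUnit_integers_iff {x : h.integers} : IsUnit x ↔ v (x : F) = 1 := by
  refine ⟨fun hx => ?_, fun hx => ?_⟩
  · obtain ⟨y, hy⟩ := hx.exists_right_inv
    have e : v (x : F) * v (y : F) = 1 := by 
      rw [← map_mul, ← map_one v]; exact congrArg v (congrArg Subtype.val hy)
    have hx1 : v (x : F) ≤ 1 := x.2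
    have hy1 : v (y : F) ≤ 1 := y.2
    refine le_antisymm hx1 ?_
    rw [← e]
    exact mul_le_of_le_one_right (v.nonneg _) hy1
  · have h0 : (x : F) ≠ 0 := fun h0 => by rw [h0, map_zero] at hx; exact zero_ne_one hx
    refine IsUnit.of_mul_eq_one ⟨(x : F)⁻¹, ?_⟩ (Subtype.ext ?_)
    · change v (x : F)⁻¹ ≤ 1
      rw [map_inv₀, hx, inv_one]
    · exact mul_inv_cancel₀ h0

lemma isLocalRing_integers : IsLocalRing h.integers := by
  refine IsLocalRing.of_nonunits_add fun a b ha hb => ?_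
  simp only [mem_nonunits_iff, h.isUnit_integers_iff] at *
  have ha' : v (a : F) < 1 := lt_of_le_of_ne a.2 ha
  have hb' : v (b : F) < 1 := lt_of_le_of_ne b.2 hb
  exact ((h.nonarch _ _).trans_lt (max_lt ha' hb')).ne

section

variable {c : ℝ} (hpc : (p : ℝ)⁻¹ ≤ c)
    (hR : ∀ r : R, v (algebraMap R F r - algebraMap R F r ^ p ^ n) ≤ c)

/-- For |x| = 1 the Frobenius defect of x⁻¹ is minus that of x divided by σx · x^q, which has
absolute value 1. So B is local with maximal ideal |x| < 1. -/
lemma isUnit_congruenceSubalgebra_iff {x : h.congruenceSubalgebra hpc hR} :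
    IsUnit x ↔ v (x : F) = 1 := by
  refine ⟨fun hx => ?_, fun hx => ?_⟩
  · obtain ⟨y, hy⟩ := hx.exists_right_inv
    have e : v (x : F) * v (y : F) = 1 := by 
      rw [← map_mul, ← map_one v]; exact congrArg v (congrArg Subtype.val hy)
    refine le_antisymm x.2.1 ?_
    rw [← e]
    exact mul_le_of_le_one_right (v.nonneg _) y.2.1
  · have h0 : (x : F) ≠ 0 := fun h0 => by rw [h0, map_zero] at hx; exact zero_ne_one hx
    have h0' : σ (x : F) ≠ 0 := fun e => h0 ((map_eq_zero_iff σ σ.injective).1 e)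
    refine IsUnit.of_mul_eq_one ⟨(x : F)⁻¹, ?_, ?_⟩ (Subtype.ext ?_)
    · rw [map_inv₀, hx, inv_one]
    · have e : σ (x : F)⁻¹ - (x : F)⁻¹ ^ p ^ n =
          (σ (x : F))⁻¹ * ((x : F) ^ p ^ n)⁻¹ * -(σ (x : F) - (x : F) ^ p ^ n) := by
        rw [map_inv₀, inv_pow]
        field_simp
        ring
      rw [e, map_mul, map_mul, map_inv₀, map_inv₀, h.isometry, map_pow, hx, v.map_neg]
      simpa using x.2.2
    · exact mul_inv_cancel₀ h0

lemma isLocalRing_congruenceSubalgebra : IsLocalRing (h.congruenceSubalgebra hpc hR) := by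
  refine IsLocalRing.of_nonunits_add fun a b ha hb => ?_
  simp only [mem_nonunits_iff, h.isUnit_congruenceSubalgebra_iff hpc hR] at *
  have ha' : v (a : F) < 1 := lt_of_le_of_ne a.2.1 ha
  have hb' : v (b : F) < 1 := lt_of_le_of_ne b.2.1 hb
  exact ((h.nonarch _ _).trans_lt (max_lt ha' hb')).ne

lemma map_mem_congruenceSubalgebra {x : F} (hx : x ∈ h.congruenceSubalgebra hpc hR) :
    σ x ∈ h.congruenceSubalgebra hpc hR := by
  refine ⟨by rw [h.isometry]; exact hx.1, ?_⟩
  rw [← map_pow, ← map_sub, h.isometry]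
  exact hx.2

end

/-- Nonunits that satisfy the Frobenius congruence up to `c` have absolute value at most `c`. -/
lemma le_of_sub_le {c : ℝ} (hn : n ≠ 0) {x : F} (hx : v x < 1)
    (hσ : v (σ x - x ^ p ^ n) ≤ c) : v x ≤ c := by
  by_contra! hxc
  have h1 : v (x ^ p ^ n) < v x := by
    rw [map_pow]
    have h0 : 0 < v x := ((v.nonneg _).trans hσ).trans_lt hxc
    exact pow_lt_self_of_lt_one₀ h0 hx (Nat.one_lt_pow hn h.prime.one_lt)
  -- By isometry |x| = |σx| ≤ max(|σx - x^q|, |x^q|), and both entries would be smaller than |x|.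
  have h2 := h.nonarch (σ x - x ^ p ^ n) (x ^ p ^ n)
  rw [sub_add_cancel, h.isometry] at h2
  exact absurd h2 (not_le.2 (max_lt (hσ.trans_lt hxc) h1))

end IsFrobeniusLift

/-! ### The residue field and the depth of Φ(σ)P in the kernel of reduction. -/

namespace IsFrobeniusLift

variable {R F : Type*} [CommRing R] [Field F] [Algebra R F] {v : AbsoluteValue F ℝ} {p n : ℕ}
  {σ : F →ₐ[R] F} (h : IsFrobeniusLift v p n σ)

instance : IsLocalRing h.integers := h.isLocalRing_integers

/-- The residue field of a Frobenius lift. -/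
abbrev Residue : Type _ := IsLocalRing.ResidueField h.integers

/-- Reduction to the residue field. -/
noncomputable def residueHom : h.integers →ₐ[R] h.Residue := IsScalarTower.toAlgHom R _ _

lemma residueHom_apply (x : h.integers) : h.residueHom x = IsLocalRing.residue _ x := rfl

lemma residueHom_eq_zero_iff {x : h.integers} : h.residueHom x = 0 ↔ v (x : F) < 1 := by
  rw [residueHom_apply, IsLocalRing.residue_eq_zero_iff, IsLocalRing.mem_maximalIdeal,
    mem_nonunits_iff, h.isUnit_integers_iff]
  exact ⟨fun hx => lt_of_le_of_ne x.2 hx, fun hx => hx.ne⟩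

instance : IsLocalHom h.residueHom :=
  ⟨fun x hx => h.isUnit_integers_iff.2 (le_antisymm x.2 (not_lt.1 fun hlt =>
    hx.ne_zero (h.residueHom_eq_zero_iff.2 hlt)))⟩

lemma natCast_residue_eq_zero_iff {m : ℕ} : (m : h.Residue) = 0 ↔ v (m : F) < 1 := by
  rw [← map_natCast h.residueHom, residueHom_eq_zero_iff]
  rfl

lemma charP_residue : CharP h.Residue p :=
  (CharP.charP_iff_prime_eq_zero h.prime).2 (h.natCast_residue_eq_zero_iff.2 h.map_prime_lt)

lemma natCast_residue_ne_zero {ℓ : ℕ} (hℓ : ℓ.Prime) (hℓp : ℓ ≠ p) : (ℓ : h.Residue) ≠ 0 := by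
  have := h.charP_residue
  rw [Ne, CharP.cast_eq_zero_iff _ p, Nat.prime_dvd_prime_iff_eq h.prime hℓ]
  exact hℓp.symm

/-- The restriction of a Frobenius lift to the unit ball. -/
def mapIntegers (x : h.integers) : h.integers := ⟨σ x, by rw [mem_integers, h.isometry]; exact x.2⟩

lemma residueHom_mapIntegers (x : h.integers) :
    h.residueHom (h.mapIntegers x) = h.residueHom x ^ p ^ n := by
  rw [← sub_eq_zero, ← map_pow, ← map_sub, residueHom_eq_zero_iff]
  exact h.sub_lt _ x.2

/-- The Frobenius map on the residue field. -/
noncomputable def residueFrob : h.Residue →ₐ[R] h.Residue where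
  __ := haveI := h.charP_residue; haveI : Fact p.Prime := ⟨h.prime⟩; iterateFrobenius h.Residue p n
  commutes' := fun r => by
    have := h.charP_residue
    have : Fact p.Prime := ⟨h.prime⟩
    change algebraMap R h.Residue r ^ p ^ n = _
    rw [← h.residueHom.commutes, ← h.residueHom_mapIntegers]
    congr 1
    exact Subtype.ext (σ.commutes r)

lemma residueFrob_apply (x : h.Residue) : h.residueFrob x = x ^ p ^ n := rfl

section Curve

open WeierstrassCurve

variable [IsAlgClosed F] [CharZero F] [DecidableEq F] {W : WeierstrassCurve R} [W.IsElliptic]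
  {ℓ : ℕ} [Fact ℓ.Prime]

instance {S : Type*} [CommRing S] [Algebra R S] : (W.baseChange S).IsElliptic :=
  inferInstanceAs (W.map (algebraMap R S)).IsElliptic

lemma exists_reducesTo [DecidableEq h.Residue] (P : (W.baseChange F).toAffine.Point) :
    ∃ Q, ReducesTo W h.integers.val h.residueHom P Q :=
  WeierstrassCurve.exists_reducesTo Subtype.val_injective v h.nonarch (fun x hx => ⟨⟨x, hx⟩, rfl⟩)
    (fun x => x.2) (fun _ hx => h.residueHom_eq_zero_iff.2 hx) P

include h in
lemma tateModule_eq_zero (hn : n ≠ 0) (hℓp : ℓ ≠ p) {N : ℕ} (hN : 0 < N)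
    {t : ℕ → (W.baseChange F).toAffine.Point} (ht : t ∈ TateModule ℓ _)
    (hfix : ∀ m, (W.pointEnd σ ^ N) (t m) = t m) : t = 0 := by
  classical
  exact tateModule_eq_zero_of_fixed (p := p) (n := n) (sB := h.mapIntegers)
    (sk := h.residueFrob) (Nat.one_lt_pow hn h.prime.one_lt) Subtype.val_injective
    (h.natCast_residue_ne_zero Fact.out hℓp) h.exists_reducesTo (fun _ => rfl)
    h.residueHom_mapIntegers h.residueFrob_apply hN ht hfix

variable {Φ : ℤ[X]} (hΦ : ∀ t ∈ TateModule ℓ (W.baseChange F).toAffine.Point,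
      ∀ n, Polynomial.aeval (W.pointEnd σ) Φ (t n) = 0)

include hΦ in
lemma aeval_residue_eq_zero [DecidableEq h.Residue] (hℓp : ℓ ≠ p)
    {P : (W.baseChange F).toAffine.Point} (hP : ∀ n, 0 < n → n • P ≠ 0)
    (Q : (W.baseChange h.Residue).toAffine.Point) :
    Polynomial.aeval (W.pointEnd h.residueFrob) Φ Q = 0 := by
  have := h.charP_residue
  have : Fact p.Prime := ⟨h.prime⟩
  have : ExpChar h.Residue p := expChar_of_injective_algebraMap (R := h.Residue) Function.injective_id p
  exact aeval_pointEnd_eq_zero_of_charpoly (p := p) (n := n) (sB := h.mapIntegers)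
    Subtype.val_injective (h.natCast_residue_ne_zero Fact.out hℓp) h.exists_reducesTo (fun _ => rfl)
    h.residueHom_mapIntegers h.residueFrob_apply hΦ hP Q

include h hΦ in
/-- If `Φ(σ)` annihilates the Tate module, then `Φ(σ)P` lies deep in the kernel of reduction. -/
theorem aeval_eq_zero_or_one_le (hn : n ≠ 0) (hℓp : ℓ ≠ p) {c : ℝ} (hpc : (p : ℝ)⁻¹ ≤ c)
    (hR : ∀ r : R, v (algebraMap R F r - algebraMap R F r ^ p ^ n) ≤ c) {M : Subfield F}
    (hM : ∀ x ∈ M, v x ≤ 1 → v (σ x - x ^ p ^ n) ≤ c) {x y : F}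
    (hxy : (W.baseChange F).toAffine.Nonsingular x y) (hx : x ∈ M) (hy : y ∈ M)
    (hP : ∀ n : ℕ, 0 < n → n • (.some x y hxy : (W.baseChange F).toAffine.Point) ≠ 0) :
    Polynomial.aeval (W.pointEnd σ) Φ (.some x y hxy) = 0 ∨ ∃ X Y h',
      Polynomial.aeval (W.pointEnd σ) Φ (.some x y hxy) = .some X Y h' ∧ 1 ≤ c ^ 2 * v X := by
  classical
  have := h.isLocalRing_congruenceSubalgebra hpc hR
  let B := h.congruenceSubalgebra hpc hR
  let i : B →ₐ[R] h.integers := Subalgebra.inclusion fun x hx => hx.1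
  let g : B →ₐ[R] h.Residue := h.residueHom.comp i
  have hg : ∀ b : B, g b = 0 ↔ v (b : F) < 1 := fun b => h.residueHom_eq_zero_iff
  have hgl : IsLocalHom g := ⟨fun b hb => (h.isUnit_congruenceSubalgebra_iff hpc hR).2
    (le_antisymm b.2.1 (not_lt.1 fun hlt => hb.ne_zero ((hg b).2 hlt)))⟩
  have hf : Function.Injective B.val := Subtype.val_injective
  let s : B → B := fun b => ⟨σ b, h.map_mem_congruenceSubalgebra hpc hR b.2⟩
  -- P reduces through the small ring B, and not only through the full valuation ring, because its
  -- coordinates lie in M. As B is σ-stable, Φ(σ)P then reduces through B as well.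
  obtain ⟨Q, hQ⟩ := exists_reducesTo_of_mem (W := W) (f := B.val) (g := g) hf v h.nonarch M
    (fun x hxM hx => ⟨⟨x, hx, hM x hxM hx⟩, rfl⟩) (fun b => b.2.1) (fun b hb => (hg b).2 hb)
    hxy hx hy
  have hred := hQ.aeval hf (sB := s) (sF := σ) (sk := h.residueFrob) (fun _ => rfl)
    (fun b => h.residueHom_mapIntegers (i b)) Φ
  rw [h.aeval_residue_eq_zero hΦ hℓp hP] at hred
  rcases hred.cases with ⟨-, z, w, hz, hw, hr⟩ | ⟨_, _, _, _, _, e⟩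
  swap
  · cases e
  obtain ⟨u, hu, rfl⟩ := exists_eq_cube_mul hf hz hw hr
  rcases hr with ⟨e, -⟩ | ⟨X, Y, h', e, h2, h0, -⟩
  · exact .inl e
  refine .inr ⟨X, Y, h', e, ?_⟩
  -- The parameter is a nonunit of B, so it has size at most c; with w = z³u and u a unit, X = z/w =
  -- 1/(z²u).
  have hzc : v (z : F) ≤ c := h.le_of_sub_le hn ((hg z).1 hz) z.2.2
  have hu1 : v (u : F) = 1 := (h.isUnit_congruenceSubalgebra_iff hpc hR).1 hu
  have hz0 : (z : F) ≠ 0 := fun h0 => h2 (by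
    change ((z ^ 3 * u : B) : F) = 0
    push_cast
    rw [h0]; ring)
  have e1 : X * z ^ 2 * u = 1 := by
    have h0' : (z : F) = X * ((z : F) ^ 3 * u) := h0
    apply mul_left_cancel₀ hz0
    linear_combination -h0'
  have e2 : v X * v (z : F) ^ 2 = 1 := by
    have := congrArg v e1
    rwa [map_mul, map_mul, hu1, mul_one, map_pow, map_one] at this
  rw [← e2, mul_comm]
  gcongr

end Curve

end IsFrobeniusLift

/-! ### Coprime polynomials in an endomorphism and nontorsion elements. -/

section Torsion

open Polynomial

lemma Polynomial.exists_natCast_eq_of_isCoprime_map {Φ Ψ : ℤ[X]}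
    (h : IsCoprime (Φ.map (Int.castRingHom ℚ)) (Ψ.map (Int.castRingHom ℚ))) :
    ∃ m : ℕ, 0 < m ∧ ∃ A B : ℤ[X], A * Φ + B * Ψ = m := by
  obtain ⟨a, b, e⟩ := h
  obtain ⟨c, hcm, hc⟩ := IsLocalization.integerNormalization_spec (nonZeroDivisors ℤ) a
  obtain ⟨d, hdm, hd⟩ := IsLocalization.integerNormalization_spec (nonZeroDivisors ℤ) b
  set A := IsLocalization.integerNormalization (nonZeroDivisors ℤ) a
  set B := IsLocalization.integerNormalization (nonZeroDivisors ℤ) b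
  have key : (C d * A) * Φ + (C c * B) * Ψ = C (c * d) := by
    apply Polynomial.map_injective (Int.castRingHom ℚ) Int.cast_injective
    have hc' : A.map (Int.castRingHom ℚ) = C (c : ℚ) * a := by
      rw [← Polynomial.smul_eq_C_mul, Int.cast_smul_eq_zsmul]; exact hc
    have hd' : B.map (Int.castRingHom ℚ) = C (d : ℚ) * b := by
      rw [← Polynomial.smul_eq_C_mul, Int.cast_smul_eq_zsmul]; exact hd
    simp only [Polynomial.map_add, Polynomial.map_mul, Polynomial.map_C, hc', hd', map_mul]
    simp only [eq_intCast, map_intCast]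
    linear_combination (c : ℚ[X]) * (d : ℚ[X]) * e
  have hcd : c * d ≠ 0 := mul_ne_zero (nonZeroDivisors.ne_zero hcm) (nonZeroDivisors.ne_zero hdm)
  refine ⟨(c * d).natAbs, Int.natAbs_pos.2 hcd, C (c * d).sign * (C d * A),
    C (c * d).sign * (C c * B), ?_⟩
  rw [mul_assoc, mul_assoc (C (c * d).sign), ← mul_add, key, ← C_mul, Int.sign_mul_self_eq_natAbs]
  simp

/-- If `Φ(f)` and `f ^ N - 1` are coprime and `f ^ N` fixes a nontorsion element, then `Φ(f)` maps
it to a nontorsion element. -/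
lemma nsmul_aeval_ne_zero {A : Type*} [AddCommGroup A] {f : AddMonoid.End A} {Φ : ℤ[X]} {N : ℕ}
    (h : IsCoprime (Φ.map (Int.castRingHom ℚ)) (X ^ N - 1)) {a : A} (hfa : (f ^ N) a = a)
    (ha : ∀ n : ℕ, 0 < n → n • a ≠ 0) {n : ℕ} (hn : 0 < n) : n • aeval f Φ a ≠ 0 := by
  intro h0
  obtain ⟨m, hm, U, V, e⟩ := Polynomial.exists_natCast_eq_of_isCoprime_map (Φ := Φ) (Ψ := X ^ N - 1)
    (by simpa using h)
  -- At f the integral Bézout relation reads U(f)Φ(f)a = m a, since f^N - 1 kills a; if n kills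
  -- Φ(f)a then n m kills a.
  refine ha (n * m) (by positivity) ?_
  have e' := congrArg (fun Ψ : ℤ[X] => aeval f Ψ a) e
  simp only [map_add, map_mul, map_sub, map_pow, aeval_X, map_one, map_natCast] at e'
  have hVa : (aeval f V * (f ^ N - 1)) a = 0 := by
    change aeval f V ((f ^ N) a - a) = 0
    rw [hfa, sub_self, map_zero]
  rw [show ∀ g g' : AddMonoid.End A, (g + g') a = g a + g' a from fun _ _ => rfl, hVa, add_zero] at e'
  have e2 : (m : AddMonoid.End A) a = m • a := by simp
  rw [e2] at e'
  rw [mul_smul, ← e']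
  change n • aeval f U (aeval f Φ a) = 0
  rw [← map_nsmul, h0, map_zero]

end Torsion

/-! ### Rings of integers and the primes below a place. -/

section Integers

variable {K L : Type*} [Field K] [Field L] [Algebra K L] {v : AbsoluteValue L ℝ}
  (hv : IsNonarchimedean v)

lemma mem_primeIdealOf {F : Type*} [Field F] {v : AbsoluteValue F ℝ} (hv : IsNonarchimedean v)
    {x : 𝓞 F} : x ∈ primeIdealOf v hv ↔ v (x : F) < 1 := Iff.rfl

lemma mem_under_primeIdealOf {x : 𝓞 K} :
    x ∈ (primeIdealOf v hv).under (𝓞 K) ↔ v (algebraMap K L x) < 1 := Iff.rfl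

instance : (primeIdealOf v hv).IsPrime where
  ne_top' := by
    rw [Ne, Ideal.eq_top_iff_one, mem_primeIdealOf]
    simp
  mem_or_mem' := fun {x y} hxy => by
    simp only [mem_primeIdealOf] at *
    by_contra! h
    have e : v ((x * y : 𝓞 L) : L) = v (x : L) * v (y : L) := map_mul v _ _
    nlinarith [h.1, h.2]

end Integers

section NumberField

variable {M L : Type*} [Field M] [NumberField M] [Field L] [CharZero L] [Algebra M L]
  {v : AbsoluteValue L ℝ} {p : ℕ}

lemma IsPlaceOver.apply_prime [Fact p.Prime] (hv : IsPlaceOver p v) : v (p : L) = (p : ℝ)⁻¹ := by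
  have := hv.extends_padic p
  simpa using this

/-- The prime of a number field below a place over `p`. -/
noncomputable def IsPlaceOver.heightOneSpectrum [Fact p.Prime] (hv : IsPlaceOver p v) :
    IsDedekindDomain.HeightOneSpectrum (𝓞 M) where
  asIdeal := (primeIdealOf v hv.nonarch).under (𝓞 M)
  isPrime := inferInstance
  ne_bot := by
    have hp : p.Prime := Fact.out
    intro h
    have h1 : (p : 𝓞 M) ∈ (primeIdealOf v hv.nonarch).under (𝓞 M) := by
      rw [mem_under_primeIdealOf]
      simp only [map_natCast, hv.apply_prime]
      exact inv_lt_one_of_one_lt₀ (by exact_mod_cast hp.one_lt)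
    rw [h, Ideal.mem_bot, Nat.cast_eq_zero] at h1
    exact hp.ne_zero h1

variable [Fact p.Prime] (hv : IsPlaceOver p v)

include hv in
lemma IsPlaceOver.map_integer_le (x : 𝓞 M) : v (algebraMap M L x) ≤ 1 :=
  hv.nonarch.le_one_of_isIntegral (x.2.map (algebraMap M L).toIntAlgHom)

include hv in
/-- Elements of absolute value at most one are fractions of integers with a denominator of absolute
value one. -/
lemma IsPlaceOver.exists_mul_eq {x : M} (hx : v (algebraMap M L x) ≤ 1) :
    ∃ a b : 𝓞 M, v (algebraMap M L b) = 1 ∧ x * b = a := by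
  have hd : ∀ d : (hv.heightOneSpectrum (M := M)).asIdeal.primeCompl,
      v (algebraMap M L (d : 𝓞 M)) = 1 := fun d =>
    le_antisymm (hv.map_integer_le _) (not_lt.1 fun h => d.2 h)
  obtain ⟨a, d, h | h⟩ :=
    (hv.heightOneSpectrum (M := M)).exists_primeCompl_mul_eq_or_mul_eq (K := M) x
  · exact ⟨a, d, hd d, h⟩
  · refine ⟨d, a, le_antisymm (hv.map_integer_le _) ?_, h⟩
    have e := congrArg (fun y => v (algebraMap M L y)) h
    simp only [map_mul] at e
    have hd' := hd d
    have e' : v (algebraMap M L x) * v (algebraMap M L (a : M)) = 1 := e.trans hd'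
    rw [← e']
    exact mul_le_of_le_one_left (v.nonneg _) hx

/-- Absolute values at most one are detected on powers of a uniformizer. -/
lemma IsPlaceOver.pow_ramificationIdx_le {x : M} (hx : v (algebraMap M L x) < 1) :
    v (algebraMap M L x) ^ (((primeIdealOf v hv.nonarch).under (𝓞 M)).ramificationIdx ℤ) ≤
      (p : ℝ)⁻¹ := by
  have hp : p.Prime := Fact.out
  set q := (primeIdealOf v hv.nonarch).under (𝓞 M) with hq
  have hqp : q.IsPrime := inferInstance
  have hqb : q ≠ ⊥ := (hv.heightOneSpectrum (M := M)).ne_bot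
  obtain ⟨a, b, hb, e⟩ := hv.exists_mul_eq hx.le
  have hva : v (algebraMap M L a) = v (algebraMap M L x) := by
    rw [← e, map_mul, map_mul, hb, mul_one]
  have haq : a ∈ q := by rw [hq, mem_under_primeIdealOf, hva]; exact hx
  have hpq : (p : 𝓞 M) ∈ q := by
    rw [hq, mem_under_primeIdealOf]
    simp only [map_natCast, hv.apply_prime]
    exact inv_lt_one_of_one_lt₀ (by exact_mod_cast hp.one_lt)
  have hmap : (Ideal.span {(p : ℤ)}).map (algebraMap ℤ (𝓞 M)) = Ideal.span {(p : 𝓞 M)} := by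
    rw [Ideal.map_span, Set.image_singleton]; simp
  have hbot : (Ideal.span {(p : ℤ)}).map (algebraMap ℤ (𝓞 M)) ≠ ⊥ := by
    rw [hmap, Ne, Ideal.span_singleton_eq_bot]
    exact_mod_cast hp.ne_zero
  have hlies : q.LiesOver (Ideal.span {(p : ℤ)}) := by
    have hmax : (Ideal.span {(p : ℤ)}).IsMaximal :=
      PrincipalIdealRing.isMaximal_of_irreducible (Nat.prime_iff_prime_int.1 hp).irreducible
    refine ⟨hmax.eq_of_le (Ideal.IsPrime.ne_top inferInstance) ?_⟩
    rw [Ideal.span_singleton_le_iff_mem, Ideal.under_def, Ideal.mem_comap]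
    simpa using hpq
  have hmul := Ideal.IsDedekindDomain.ramificationIdx_eq_multiplicity (Ideal.span {(p : ℤ)}) q hbot
  rw [hmap] at hmul hbot
  have hfin : FiniteMultiplicity q (Ideal.span {(p : 𝓞 M)}) :=
    FiniteMultiplicity.of_prime_left (Ideal.prime_of_isPrime hqb hqp) hbot
  -- Write (p) = q^e J with J not inside q. For d in J outside q, the product a^e d is a multiple of
  -- p and |d| = 1, so |a|^e ≤ 1/p.
  obtain ⟨J, hJ, hJq⟩ := hfin.exists_eq_pow_mul_and_not_dvd
  rw [← hmul] at hJ
  have hnle : ¬ J ≤ q := fun hle => hJq (Ideal.dvd_iff_le.2 hle)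
  obtain ⟨d, hdJ, hdq⟩ := SetLike.not_le_iff_exists.1 hnle
  have hmem : a ^ q.ramificationIdx ℤ * d ∈ Ideal.span {(p : 𝓞 M)} := by
    rw [hJ]
    exact Ideal.mul_mem_mul (Ideal.pow_mem_pow haq _) hdJ
  obtain ⟨g, hg⟩ := Ideal.mem_span_singleton.1 hmem
  have hvd : v (algebraMap M L d) = 1 :=
    le_antisymm (hv.map_integer_le _) (not_lt.1 fun h => hdq h)
  have e2 := congrArg (fun y : 𝓞 M => v (algebraMap M L y)) hg
  simp only [map_mul, map_pow, hvd, mul_one, hva] at e2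
  rw [e2]
  simp only [map_natCast, hv.apply_prime]
  exact mul_le_of_le_one_right (by positivity) (hv.map_integer_le _)

/-- The residue field of a number field at a place over `p` is finite of characteristic `p`. -/
lemma IsPlaceOver.exists_card_quotient :
    ∃ m, 0 < m ∧ Nat.card (𝓞 M ⧸ (primeIdealOf v hv.nonarch).under (𝓞 M)) = p ^ m ∧
      ∀ a : 𝓞 M, a ^ p ^ m - a ∈ (primeIdealOf v hv.nonarch).under (𝓞 M) := by
  have hp : p.Prime := Fact.out
  let P := hv.heightOneSpectrum (M := M)
  have hmax : P.asIdeal.IsMaximal := P.isMaximal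
  let := Ideal.Quotient.field P.asIdeal
  have : Finite (𝓞 M ⧸ P.asIdeal) := Ideal.finiteQuotientOfFreeOfNeBot _ P.ne_bot
  let := Fintype.ofFinite (𝓞 M ⧸ P.asIdeal)
  have hp0 : (p : 𝓞 M ⧸ P.asIdeal) = 0 := by
    rw [← map_natCast (Ideal.Quotient.mk P.asIdeal), Ideal.Quotient.eq_zero_iff_mem]
    change v (algebraMap M L ((p : 𝓞 M) : M)) < 1
    simp only [map_natCast, hv.apply_prime]
    exact inv_lt_one_of_one_lt₀ (by exact_mod_cast hp.one_lt)
  have : CharP (𝓞 M ⧸ P.asIdeal) p := (CharP.charP_iff_prime_eq_zero hp).2 hp0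
  obtain ⟨m, -, hm⟩ := FiniteField.card (𝓞 M ⧸ P.asIdeal) p
  refine ⟨m, m.pos, ?_, fun a => ?_⟩
  · rw [← hm]; exact Nat.card_eq_fintype_card (α := 𝓞 M ⧸ P.asIdeal)
  change _ ∈ P.asIdeal
  rw [← Ideal.Quotient.eq_zero_iff_mem (I := P.asIdeal), map_sub, map_pow, ← hm,
    FiniteField.pow_card, sub_self]

include hv in
/-- The Frobenius congruence for integers extends to the valuation ring. -/
lemma IsPlaceOver.exists_pow_sub_lt : ∃ m, 0 < m ∧
    ∀ x : M, v (algebraMap M L x) ≤ 1 → v (algebraMap M L (x ^ p ^ m - x)) < 1 := by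
  obtain ⟨m, hm, -, h⟩ := hv.exists_card_quotient (M := M)
  refine ⟨m, hm, fun x hx => ?_⟩
  obtain ⟨a, b, hb, e⟩ := hv.exists_mul_eq hx
  have key : (x ^ p ^ m - x) * (b ^ p ^ m * b) =
      ((a ^ p ^ m - a : 𝓞 M) : M) * b - a * ((b ^ p ^ m - b : 𝓞 M) : M) := by
    change _ = ((a : M) ^ p ^ m - a) * b - a * ((b : M) ^ p ^ m - b)
    rw [← e]
    ring
  have h1 := congrArg (fun y => v (algebraMap M L y)) key
  simp only [map_mul, map_pow, hb, one_pow, mul_one] at h1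
  rw [h1, map_sub, map_mul, map_mul]
  have hlt : ∀ {y z : L}, v y < 1 → v z < 1 → v (y - z) < 1 := fun hy hz => by
    rw [sub_eq_add_neg]
    exact (hv.nonarch _ _).trans_lt (max_lt hy (by rwa [v.map_neg]))
  refine hlt ?_ ?_
  · rw [map_mul, hb, mul_one]; exact h a
  · rw [map_mul]
    exact (mul_le_of_le_one_left (v.nonneg _) (hv.map_integer_le a)).trans_lt (h b)

end NumberField

/-! ### Frobenius elements as isometries. -/

section Frobenius

variable {K L : Type*} [Field K] [NumberField K] [Field L] [CharZero L] [Algebra K L]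
  [Algebra.IsAlgebraic K L] {v : AbsoluteValue L ℝ} {p : ℕ} [Fact p.Prime] (hv : IsPlaceOver p v)

include K hv in
lemma IsPlaceOver.exists_integers_mul_eq {x : L} (hx : v x ≤ 1) :
    ∃ a b : 𝓞 L, v (b : L) = 1 ∧ x * b = a := by
  let M := IntermediateField.adjoin K {x}
  have : FiniteDimensional K M :=
    IntermediateField.adjoin.finiteDimensional (Algebra.IsIntegral.isIntegral x)
  have : NumberField M := NumberField.of_module_finite K M
  obtain ⟨a, b, hb, e⟩ := hv.exists_mul_eq (M := M)
    (x := ⟨x, IntermediateField.mem_adjoin_simple_self K x⟩) hx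
  exact ⟨algebraMap (𝓞 M) (𝓞 L) a, algebraMap (𝓞 M) (𝓞 L) b, hb,
    congrArg (algebraMap M L) e⟩

variable {σ : L ≃ₐ[K] L} {n : ℕ}

include hv in
lemma IsPlaceOver.sub_pow_lt_one (hσ : ∀ a : 𝓞 L, v (σ a - (a : L) ^ p ^ n) < 1) {x : L}
    (hx : v x ≤ 1) : v (σ x - x ^ p ^ n) < 1 := by
  obtain ⟨a, b, hb, e⟩ := hv.exists_integers_mul_eq (K := K) hx
  have hlt : ∀ {y z : L}, v y < 1 → v z < 1 → v (y - z) < 1 := fun hy hz => by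
    rw [sub_eq_add_neg]
    exact (hv.nonarch _ _).trans_lt (max_lt hy (by rwa [v.map_neg]))
  have ha1 : v (a : L) ≤ 1 := hv.nonarch.le_one_of_isIntegral a.2
  have hσb : v (σ b) = 1 := by
    refine le_antisymm (hv.nonarch.le_one_of_isIntegral (b.2.map σ.toAlgHom.toRingHom.toIntAlgHom))
      (not_lt.1 fun h => ?_)
    have := hlt h (hσ b)
    rw [sub_sub_cancel, map_pow, hb, one_pow] at this
    exact lt_irrefl _ this
  have key : (σ x - x ^ p ^ n) * (σ b * (b : L) ^ p ^ n) =
      (σ a - (a : L) ^ p ^ n) * (b : L) ^ p ^ n - (a : L) ^ p ^ n * (σ b - (b : L) ^ p ^ n) := by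
    rw [← e, map_mul]
    ring
  have h1 := congrArg v key
  simp only [map_mul, map_pow, hb, hσb, one_pow, mul_one] at h1
  rw [h1]
  refine hlt ?_ ?_
  · rw [map_mul, map_pow, hb, one_pow, mul_one]; exact hσ a
  · rw [map_mul, map_pow]
    exact (mul_le_of_le_one_left (v.nonneg _) (pow_le_one₀ (v.nonneg _) ha1)).trans_lt (hσ b)

include hv in
/-- A Frobenius element is an isometry. -/
lemma IsPlaceOver.isFrobeniusLift {R : Type*} [CommRing R] [Algebra R L] [Algebra R K]
    [IsScalarTower R K L] (hR : ∀ r, v (algebraMap R L r) ≤ 1)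
    (hσ : ∀ a : 𝓞 L, v (σ a - (a : L) ^ p ^ n) < 1) :
    IsFrobeniusLift v p n ((σ : L →ₐ[K] L).restrictScalars R) where
  nonarch := hv.nonarch
  prime := Fact.out
  map_prime := hv.apply_prime
  map_base := hR
  sub_lt := fun x hx => hv.sub_pow_lt_one hσ hx
  isometry := fun x => by
    have hp : p.Prime := Fact.out
    have h2 : ∀ x, v x < 1 → v (σ x) < 1 := fun x hx => by
      have := hv.nonarch (σ x - x ^ p ^ n) (x ^ p ^ n)
      rw [sub_add_cancel] at this
      refine this.trans_lt (max_lt (hv.sub_pow_lt_one hσ hx.le) ?_)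
      rw [map_pow]
      exact pow_lt_one₀ (v.nonneg _) hx (pow_ne_zero _ hp.ne_zero)
    -- σ maps the open unit ball into itself, so |σ(·)| is equivalent to |·| and hence a power of
    -- it; agreement at p makes the exponent 1.
    let w : AbsoluteValue L ℝ := v.comp (f := (σ : L →+* L)) σ.injective
    have hp1 : v (p : L) < 1 := by
      rw [hv.apply_prime]
      exact inv_lt_one_of_one_lt₀ (by exact_mod_cast hp.one_lt)
    have hp0 : (p : L) ≠ 0 := by exact_mod_cast hp.ne_zero
    have hequiv : v.IsEquiv w :=
      AbsoluteValue.isEquiv_of_lt_one_imp ⟨p, hp0, hp1.ne⟩ h2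
    obtain ⟨c, hc, hcw⟩ := AbsoluteValue.isEquiv_iff_exists_rpow_eq.1 hequiv
    have hwp : w p = v p := by
      change v (σ p) = v p
      rw [map_natCast]
    have hc1 : c = 1 := by
      have := congrFun hcw (p : L)
      simp only [hwp] at this
      have h0 := v.pos hp0
      have hlog := congrArg Real.log this
      rw [Real.log_rpow h0] at hlog
      exact mul_right_cancel₀ (Real.log_neg h0 hp1).ne (hlog.trans (one_mul _).symm)
    have := congrFun hcw x
    simp only [hc1, Real.rpow_one] at this
    exact this.symm

end Frobenius

lemma AddMonoidHom.map_aeval_end {A B : Type*} [AddCommGroup A] [AddCommGroup B] (ψ : A →+ B)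
    {f : AddMonoid.End A} {g : AddMonoid.End B} (h : ∀ a, ψ (f a) = g (ψ a)) (Φ : ℤ[X]) (a : A) :
    ψ (Polynomial.aeval f Φ a) = Polynomial.aeval g Φ (ψ a) := by
  have hpow : ∀ n a, ψ ((f ^ n) a) = (g ^ n) (ψ a) := by
    intro n
    induction n with
    | zero => intro a; rfl
    | succ n ih =>
      intro a
      rw [pow_succ, pow_succ]
      change ψ ((f ^ n) (f a)) = (g ^ n) (g (ψ a))
      rw [ih, h]
  induction Φ using Polynomial.induction_on' with
  | add P Q hP hQ =>
    rw [map_add, map_add]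
    exact (map_add ψ _ _).trans (congrArg₂ (· + ·) hP hQ)
  | monomial n m =>
    rw [Polynomial.aeval_monomial, Polynomial.aeval_monomial, eq_intCast, eq_intCast]
    change ψ ((m : AddMonoid.End A) ((f ^ n) a)) = (m : AddMonoid.End B) ((g ^ n) (ψ a))
    rw [AddMonoid.End.intCast_apply, AddMonoid.End.intCast_apply, ← hpow]
    exact map_zsmul ψ _ _

/-- M has finitely many K-embeddings into L, so two powers of σ agree on M. -/
lemma IntermediateField.exists_pow_apply_eq {K L : Type*} [Field K] [Field L] [Algebra K L]
    (M : IntermediateField K L) [FiniteDimensional K M] (σ : L ≃ₐ[K] L) :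
    ∃ N, 0 < N ∧ ∀ x ∈ M, (σ ^ N) x = x := by
  obtain ⟨i, j, hij, e⟩ := Finite.exists_ne_map_eq_of_infinite
    fun i : ℕ => ((σ ^ i : L ≃ₐ[K] L) : L →ₐ[K] L).comp M.val
  wlog hlt : i < j generalizing i j
  · exact this j i hij.symm e.symm (lt_of_le_of_ne (not_lt.1 hlt) hij.symm)
  refine ⟨j - i, by omega, fun x hx => (σ ^ i).injective ?_⟩
  have e' := DFunLike.congr_fun e ⟨x, hx⟩
  change (σ ^ i) x = (σ ^ j) x at e'
  rw [e', ← AlgEquiv.mul_apply, ← pow_add]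
  congr 2
  omega

/-! ### Transfer to the integral model and the lower bound. -/

namespace WeierstrassCurve

section Galois

variable {K L : Type*} [Field K] [Field L] [Algebra K L] [DecidableEq L] (E : WeierstrassCurve K)

lemma galoisEnd_pow (σ : L ≃ₐ[K] L) (N : ℕ) : E.galoisEnd σ ^ N = E.galoisEnd (σ ^ N) := by
  induction N with
  | zero =>
    ext P
    rcases P with _ | ⟨x, y, h⟩ <;> rfl
  | succ N ih =>
    rw [pow_succ, ih]
    ext P
    rcases P with _ | ⟨x, y, h⟩ <;> rfl

lemma galoisEnd_some_eq {σ : L ≃ₐ[K] L} {x y : L} (h : (E.baseChange L).toAffine.Nonsingular x y)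
    (hx : σ x = x) (hy : σ y = y) : E.galoisEnd σ (.some x y h) = .some x y h := by
  refine (Affine.Point.map_some (W' := E) (σ : L →ₐ[K] L) h).trans ?_
  simp [hx, hy]

variable {R : Type*} [CommRing R] [Algebra R K] [Algebra R L] [IsScalarTower R K L]
  {W : WeierstrassCurve R} [(E.baseChange L).IsElliptic] [(W.baseChange L).IsElliptic]
  {u r s t : K}

lemma IsVariableChange.pointHom_pointEnd (h : IsVariableChange (E.baseChange L) (W.baseChange L)
    (algebraMap K L u) (algebraMap K L r) (algebraMap K L s) (algebraMap K L t)) (σ : L ≃ₐ[K] L)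
    (P : (W.baseChange L).toAffine.Point) :
    h.pointHom (W.pointEnd ((σ : L →ₐ[K] L).restrictScalars R) P) =
      E.galoisEnd σ (h.pointHom P) := by
  rcases P with _ | ⟨x, y, hxy⟩
  · rfl
  · refine (h.pointHom_some _).trans (Eq.trans ?_
      (Affine.Point.map_some (W' := E) (σ : L →ₐ[K] L) _).symm)
    refine (Affine.Point.some.injEq ..).mpr ⟨?_, ?_⟩ <;> simp

end Galois

/-- A curve with good reduction has a smooth integral model. -/
lemma HasGoodReductionAt.exists_model {K : Type*} [Field K] [NumberField K] {E : WeierstrassCurve K}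
    {𝔭 : IsDedekindDomain.HeightOneSpectrum (𝓞 K)} (hE : E.HasGoodReductionAt 𝔭) :
    ∃ (W : WeierstrassCurve (𝔭.valuation K).integer) (u r s t : K), W.IsElliptic ∧
      IsVariableChange E (W.baseChange K) u r s t := by
  classical
  obtain ⟨C, hC⟩ := hE
  refine ⟨integralModel _ (C • E), C.u, C.r, C.s, C.t, ?_, ?_⟩
  · rw [isElliptic_iff]
    by_contra hu
    have := hC.goodReduction
    rw [← integralModel_Δ_eq (𝔭.valuation K).integer (C • E)] at this
    refine ((IsDedekindDomain.HeightOneSpectrum.valuation_lt_one_iff_mem _ _).2 ?_).ne this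
    exact (IsLocalRing.mem_maximalIdeal _).2 hu
  · rw [baseChange_integralModel_eq]
    exact isVariableChange_smul C E

lemma IsVariableChange.map {K L : Type*} [Field K] [Field L] {V V' : WeierstrassCurve K}
    {u r s t : K} (h : IsVariableChange V V' u r s t) (φ : K →+* L) :
    IsVariableChange (V.map φ) (V'.map φ) (φ u) (φ r) (φ s) (φ t) where
  u_ne_zero := (map_ne_zero φ).2 h.u_ne_zero
  a₁ := by simpa [map_ofNat φ 2, map_ofNat φ 3] using congrArg φ h.a₁
  a₂ := by simpa [map_ofNat φ 2, map_ofNat φ 3] using congrArg φ h.a₂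
  a₃ := by simpa [map_ofNat φ 2, map_ofNat φ 3] using congrArg φ h.a₃
  a₄ := by simpa [map_ofNat φ 2, map_ofNat φ 3] using congrArg φ h.a₄
  a₆ := by simpa [map_ofNat φ 2, map_ofNat φ 3] using congrArg φ h.a₆

section Main

variable {K L : Type*} [Field K] [NumberField K] [Field L] [DecidableEq L] [CharZero L]
  [Algebra K L] [Algebra.IsAlgebraic K L] [IsAlgClosed L] {E : WeierstrassCurve K} [E.IsElliptic]
  {R : Type*} [CommRing R] [Algebra R K] [Algebra R L] [IsScalarTower R K L]
  {W : WeierstrassCurve R} [W.IsElliptic] {u r s t : K}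
  (h : IsVariableChange (E.baseChange L) (W.baseChange L)
    (algebraMap K L u) (algebraMap K L r) (algebraMap K L s) (algebraMap K L t))
  {v : AbsoluteValue L ℝ} {p n : ℕ} {σ : L ≃ₐ[K] L}
  (hσ : IsFrobeniusLift v p n ((σ : L →ₐ[K] L).restrictScalars R))
  {ℓ : ℕ} [Fact ℓ.Prime] {Φ : ℤ[X]}
  (hΦ : Φ.map (Int.castRingHom ℤ_[ℓ]) = TateModule.charpoly ℓ (E.galoisEnd σ))
  {P : (E.baseChange L).toAffine.Point} (hP : ∀ n : ℕ, 0 < n → n • P ≠ 0)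

/-- A point not killed by ℓ is all that finiteness of the ℓ-torsion requires. -/
lemma tateModule_finite (hℓ : ℓ ≠ 0) (hP : ∀ n : ℕ, 0 < n → n • P ≠ 0) :
    Module.Finite ℤ_[ℓ] (TateModule ℓ (E.baseChange L).toAffine.Point) :=
  TateModule.finite (finite_setOf_nsmul_eq_zero (hP ℓ (Nat.pos_of_ne_zero hℓ)))

include hΦ hP h in
lemma aeval_pointEnd_tateModule {t : ℕ → (W.baseChange L).toAffine.Point} (ht : t ∈ TateModule ℓ _)
    (m : ℕ) : Polynomial.aeval (W.pointEnd ((σ : L →ₐ[K] L).restrictScalars R)) Φ (t m) = 0 := by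
  have hℓ : ℓ.Prime := Fact.out
  have := tateModule_finite (ℓ := ℓ) hℓ.ne_zero hP
  apply h.pointHom_injective
  rw [AddMonoidHom.map_aeval_end h.pointHom (h.pointHom_pointEnd E σ), map_zero]
  exact TateModule.aeval_eq_zero hΦ ⟨fun n => h.pointHom (t n),
    (congrArg h.pointHom ht.1).trans (map_zero _),
    fun n => by rw [← map_nsmul, ht.2]⟩ m

-- A common factor would give a nonzero σ^N-fixed vector in the Tate module, which is carried to the
-- integral model and contradicts the finiteness of points fixed by a power of Frobenius.
include hΦ hP hσ h in
lemma isCoprime_charpoly (hn : n ≠ 0) (hℓp : ℓ ≠ p) {N : ℕ} (hN : 0 < N) :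
    IsCoprime (Φ.map (Int.castRingHom ℚ)) (Polynomial.X ^ N - 1) := by
  have hℓ : ℓ.Prime := Fact.out
  have := tateModule_finite (ℓ := ℓ) hℓ.ne_zero hP
  by_contra hc
  obtain ⟨t, ht0, ht⟩ := TateModule.exists_fixed hΦ hc
  choose d hd using h.pointHom_surjective
  have hz := hσ.tateModule_eq_zero (W := W) (t := fun m => d (t.1 m)) hn hℓp hN
    ⟨h.pointHom_injective (by rw [hd, t.2.1, map_zero]),
      fun m => h.pointHom_injective (by rw [map_nsmul, hd, hd, t.2.2])⟩ fun m => by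
    apply h.pointHom_injective
    have := AddMonoidHom.map_aeval_end h.pointHom (h.pointHom_pointEnd E σ) (Polynomial.X ^ N)
      (d (t.1 m))
    simp only [map_pow, Polynomial.aeval_X] at this
    rw [this, hd, ht]
  refine ht0 (Subtype.ext (funext fun m => ?_))
  rw [← hd (t.1 m), congrFun hz m]
  exact map_zero _

include hσ h hΦ hP in
lemma nsmul_aeval_galoisEnd_ne_zero (hn : n ≠ 0) (hℓp : ℓ ≠ p) {m : ℕ} (hm : 0 < m) :
    m • Polynomial.aeval (E.galoisEnd σ) Φ P ≠ 0 := by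
  have hfix : ∃ N, 0 < N ∧ (E.galoisEnd σ ^ N) P = P := by
    rcases P with _ | ⟨x, y, hxy⟩
    · exact ⟨1, one_pos, rfl⟩
    · have : FiniteDimensional K (IntermediateField.adjoin K {x, y}) :=
        IntermediateField.finiteDimensional_adjoin fun z _ => Algebra.IsIntegral.isIntegral z
      obtain ⟨N, hN, hfix⟩ := (IntermediateField.adjoin K {x, y}).exists_pow_apply_eq σ
      refine ⟨N, hN, ?_⟩
      rw [galoisEnd_pow]
      exact E.galoisEnd_some_eq hxy (hfix x (IntermediateField.subset_adjoin K _ (by simp)))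
        (hfix y (IntermediateField.subset_adjoin K _ (by simp)))
  obtain ⟨N, hN, hfix⟩ := hfix
  exact nsmul_aeval_ne_zero (isCoprime_charpoly h hσ hΦ hP hn hℓp hN) hfix hP hm

-- On the integral model the bound |X| ≥ c⁻² turns ½ log max(1, |X|) into at least -log c. M
-- contains K and the coordinates of the point, hence also the coordinates on the model.
include hΦ hσ h in
theorem le_localHeight_aeval (hn : n ≠ 0) (hℓp : ℓ ≠ p) {c : ℝ} (hc : 0 < c) (hpc : (p : ℝ)⁻¹ ≤ c)
    {M : IntermediateField K L} (hM : ∀ x ∈ M, v x < 1 → v x ≤ c) {m : ℕ} (hm : 0 < m)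
    (hMm : ∀ x ∈ M, v x ≤ 1 → v (x ^ p ^ m - x) < 1) {x y : L}
    (hxy : (E.baseChange L).toAffine.Nonsingular x y) (hx : x ∈ M) (hy : y ∈ M)
    (hP : ∀ n : ℕ, 0 < n → n • (.some x y hxy : (E.baseChange L).toAffine.Point) ≠ 0) :
    ((-Real.log c : ℝ) : WithTop ℝ) ≤ (E.baseChange L).localHeight v
      (Polynomial.aeval (E.galoisEnd σ) Φ (.some x y hxy)) := by
  have hne := fun m hm => nsmul_aeval_galoisEnd_ne_zero h hσ hΦ hP hn hℓp (m := m) hm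
  have hvc : IsVariableChange (E.baseChange L) ((W.baseChange hσ.integers).map
      (hσ.integers.val : hσ.integers →+* L)) (algebraMap K L u) (algebraMap K L r)
      (algebraMap K L s) (algebraMap K L t) := by
    have e : (W.baseChange hσ.integers).map (hσ.integers.val : hσ.integers →+* L) =
        W.baseChange L := W.map_map _ _
    rw [e]; exact h
  have hneron := isNeronFunction_goodHeight (i := (hσ.integers.val : hσ.integers →+* L)) hσ.nonarch
    (fun a => a.2) (fun x hx => ⟨⟨x, hx⟩, rfl⟩) _ hvc
  rw [localHeight_eq hneron fun m => hne _ (by positivity), WithTop.coe_le_coe]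
  have hMσ : ∀ x ∈ M.toSubfield, v x ≤ 1 → v (σ x - x ^ p ^ n) ≤ c := fun x hx hx1 =>
    hσ.sub_le hc hpc hM hm hMm hx hx1
  have hR : ∀ r : R, v (algebraMap R L r - algebraMap R L r ^ p ^ n) ≤ c := fun r => by
    have hmem : algebraMap R L r ∈ M.toSubfield := by
      rw [IsScalarTower.algebraMap_apply R K L]; exact M.algebraMap_mem _
    have := hMσ _ hmem (hσ.map_base r)
    rw [IsScalarTower.algebraMap_apply R K L, σ.commutes] at this
    rw [IsScalarTower.algebraMap_apply R K L]
    exact this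
  obtain ⟨P', hP'⟩ := h.pointHom_surjective (.some x y hxy)
  rw [← hP'] at hne hP ⊢
  rcases P' with _ | ⟨X, Y, hXY⟩
  · cases hP'
  have hu := h.u_ne_zero
  have hP2 := (Affine.Point.some.injEq ..).mp ((h.pointHom_some hXY).symm.trans hP')
  have hMK : ∀ a : K, algebraMap K L a ∈ M := M.algebraMap_mem
  have hXM : X ∈ M := by
    have e : X = (x - algebraMap K L r) / algebraMap K L u ^ 2 := by
      rw [← hP2.1]; field_simp; ring
    rw [e]
    exact div_mem (sub_mem hx (hMK r)) (pow_mem (hMK u) 2)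
  have hYM : Y ∈ M := by
    have e : Y = (y - algebraMap K L u ^ 2 * algebraMap K L s * X - algebraMap K L t) /
        algebraMap K L u ^ 3 := by
      rw [← hP2.2]; field_simp; ring
    rw [e]
    exact div_mem (sub_mem (sub_mem hy (mul_mem (mul_mem (pow_mem (hMK u) 2) (hMK s)) hXM)) (hMK t))
      (pow_mem (hMK u) 3)
  have htw := hσ.aeval_eq_zero_or_one_le (W := W) (M := M.toSubfield)
    (fun t ht m => aeval_pointEnd_tateModule h hΦ hP ht m) hn hℓp hpc hR hMσ hXY hXM hYM
    fun m hm e => hP m hm (by rw [← map_nsmul, e, map_zero])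
  have hcomm := AddMonoidHom.map_aeval_end h.pointHom (h.pointHom_pointEnd E σ) Φ (.some X Y hXY)
  rw [← hcomm] at hne ⊢
  rcases htw with e | ⟨X', Y', h', e, hle⟩
  · exact absurd (by rw [e, map_zero, smul_zero]) (hne 1 one_pos)
  rw [e, h.pointHom_some]
  simp only [goodHeight]
  rw [add_sub_cancel_right, mul_div_cancel_left₀ _ (pow_ne_zero 2 hu)]
  have h1 : (c ^ 2)⁻¹ ≤ v X' := by
    rw [inv_le_iff_one_le_mul₀ (by positivity), mul_comm]; exact hle
  have h2 := Real.log_le_log (by positivity) (h1.trans (le_max_right 1 _))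
  rw [Real.log_inv, Real.log_pow] at h2
  push_cast at h2
  linarith

end Main

section

variable {K L : Type*} [Field K] [NumberField K] [Field L] [CharZero L] [Algebra K L]
  {v : AbsoluteValue L ℝ} {p : ℕ} [Fact p.Prime]

/-- The ring of integers at the prime below a place consists of integers for that place. -/
lemma _root_.IsPlaceOver.map_valuation_integer_le (hv : IsPlaceOver p v)
    {𝔭 : IsDedekindDomain.HeightOneSpectrum (𝓞 K)}
    (h𝔭 : (primeIdealOf v hv.nonarch).under (𝓞 K) = 𝔭.asIdeal) (r : (𝔭.valuation K).integer) :
    v (algebraMap K L r) ≤ 1 := by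
  obtain ⟨a, d, e⟩ := 𝔭.exists_primeCompl_mul_eq_of_integer (r : K) r.2
  have hd : v (algebraMap K L ((d : 𝓞 K) : K)) = 1 :=
    le_antisymm (hv.map_integer_le _) (not_lt.1 fun h => d.2 (h𝔭.le h))
  have e' := congrArg (fun x => v (algebraMap K L x)) e
  simp only [map_mul] at e'
  have e2 : v (algebraMap K L r) * v (algebraMap K L ((d : 𝓞 K) : K)) =
    v (algebraMap K L (a : K)) := e'
  rw [hd, mul_one] at e2
  rw [e2]
  exact hv.map_integer_le a

end

end WeierstrassCurve

/-! ### The choice c = p^(-1/e). -/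

theorem mainTheorem5 {K : Type*} [Field K] [NumberField K] [DecidableEq (AlgebraicClosure K)]
    (E : WeierstrassCurve K) [E.IsElliptic]
    (𝔭 : IsDedekindDomain.HeightOneSpectrum (𝓞 K)) (hE : E.HasGoodReductionAt 𝔭)
    (p : ℕ) [Fact p.Prime]
    (v : AbsoluteValue (AlgebraicClosure K) ℝ) (hv : IsPlaceOver p v)
    (hv𝔭 : (primeIdealOf v hv.nonarch).under (𝓞 K) = 𝔭.asIdeal)
    (σ : AlgebraicClosure K ≃ₐ[K] AlgebraicClosure K)
    (hσ : WeierstrassCurve.IsFrobeniusAt σ (primeIdealOf v hv.nonarch))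
    (ℓ : ℕ) [Fact ℓ.Prime] (hℓ : ℓ ≠ p)
    (P : (E.baseChange (AlgebraicClosure K)).toAffine.Point)
    (hP : ∀ n : ℕ, 0 < n → n • P ≠ 0) :
    ((Real.log p / (((primeIdealOf v hv.nonarch).under
        (𝓞 (WeierstrassCurve.fieldOfDefinition P))).ramificationIdx ℤ : ℝ) : ℝ) : WithTop ℝ) ≤
      (E.baseChange (AlgebraicClosure K)).localHeight v
        (Polynomial.aeval (E.galoisEnd σ) (TateModule.intCharpoly ℓ (E.galoisEnd σ)) P) := by
  have hp : p.Prime := Fact.out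
  by_cases hΦ : ∃ Φ : ℤ[X], Φ.map (Int.castRingHom ℤ_[ℓ]) = TateModule.charpoly ℓ (E.galoisEnd σ)
  swap
  -- Without an integral characteristic polynomial the default is 0, which sends P to O, and the
  -- height there is ∞.
  · rw [TateModule.intCharpoly, dif_neg hΦ, map_zero]
    change _ ≤ WeierstrassCurve.localHeight v _ 0
    rw [WeierstrassCurve.localHeight, if_pos rfl]
    exact le_top
  rw [TateModule.intCharpoly, dif_pos hΦ]
  rcases P with _ | ⟨x, y, hxy⟩
  · exact absurd (one_smul ℕ _) (hP 1 one_pos)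
  change ((Real.log p / (((primeIdealOf v hv.nonarch).under
    (𝓞 (IntermediateField.adjoin K {x, y}))).ramificationIdx ℤ : ℝ) : ℝ) : WithTop ℝ) ≤ _
  set M := IntermediateField.adjoin K {x, y}
  have : FiniteDimensional K M :=
    IntermediateField.finiteDimensional_adjoin fun z _ => Algebra.IsIntegral.isIntegral z
  have : NumberField M := NumberField.of_module_finite K M
  set e := ((primeIdealOf v hv.nonarch).under (𝓞 M)).ramificationIdx ℤ with he
  have he0 : 0 < e := Ideal.ramificationIdx_pos _ _
  -- Two residue fields intervene: n belongs to K, with q = p^n, and m belongs to K(P).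
  obtain ⟨n, hn, hcard, -⟩ := hv.exists_card_quotient (M := K)
  obtain ⟨m, hm, hMm⟩ := hv.exists_pow_sub_lt (M := M)
  obtain ⟨W, u, r, s, t, hW, hvc⟩ := hE.exists_model
  have hfrob : IsFrobeniusLift v p n ((σ : AlgebraicClosure K →ₐ[K] AlgebraicClosure K).restrictScalars
      (𝔭.valuation K).integer) :=
    hv.isFrobeniusLift (hv.map_valuation_integer_le hv𝔭) fun a => by
      have := hσ a
      rw [hcard] at this
      exact this
  have hp0 : (0 : ℝ) < p := by exact_mod_cast hp.pos
  have hp1 : (1 : ℝ) < p := by exact_mod_cast hp.one_lt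
  -- With c = p^(-1/e) one has c^e = 1/p, and |z|^e ≤ 1/p whenever z in K(P) has |z| < 1.
  have hlog : Real.log p / e = -Real.log ((p : ℝ) ^ (-(e : ℝ)⁻¹)) := by
    rw [Real.log_rpow hp0]; ring
  have hce : ((p : ℝ) ^ (-(e : ℝ)⁻¹)) ^ e = (p : ℝ)⁻¹ := by
    rw [← Real.rpow_natCast, ← Real.rpow_mul hp0.le, neg_mul,
      inv_mul_cancel₀ (by exact_mod_cast he0.ne'), Real.rpow_neg_one]
  have hc0 : 0 < (p : ℝ) ^ (-(e : ℝ)⁻¹) := Real.rpow_pos_of_pos hp0 _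
  have hvcL := hvc.map (algebraMap K (AlgebraicClosure K))
  have hWL : (W.baseChange K).map (algebraMap K (AlgebraicClosure K)) =
    W.baseChange (AlgebraicClosure K) := W.map_map _ _
  rw [hWL] at hvcL
  rw [hlog]
  refine WeierstrassCurve.le_localHeight_aeval hvcL hfrob hΦ.choose_spec hn.ne' hℓ hc0 ?_ (M := M)
    (fun z hz hz1 => ?_) hm (fun z hz hz1 => hMm ⟨z, hz⟩ hz1) hxy
    (IntermediateField.subset_adjoin K _ (by simp)) (IntermediateField.subset_adjoin K _ (by simp)) hP
  · rw [← hce]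
    refine pow_le_of_le_one hc0.le (Real.rpow_le_one_of_one_le_of_nonpos hp1.le ?_) he0.ne'
    rw [neg_nonpos]; positivity
  · refine le_of_pow_le_pow_left₀ he0.ne' hc0.le ?_
    rw [hce]
    exact hv.pow_ramificationIdx_le (M := M) (x := ⟨z, hz⟩) hz1
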